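/- **Model.** Algorithms run on a randomized real RAM: memory cells, arranged in finitely many arrays indexed by integers and reached by indirect addressing, hold real numbers and are initially $0$ except for the input; comparisons, $+,-,\cdot,/$, floor, square root, memory access, and drawing a uniformly random integer from $\{0,\dots,m-1\}$ take $O(1)$ time. **Definitions.** Let $P\subseteq\mathbb{R}^d$ be a set of $n\ge 1$ points. For $r\ge 0$, the *$r$-connectivity clustering* $\mathcal{C}_r(P)$ is the partition of $P$ into the vertex sets of the connected components of the graph in which two points of $P$ are adjacent if their distance is at most $r$. A family $\mathcal{F}$ of subsets of $P$ is *upward closed* if $X\in\mathcal{F}$ and $X\subseteq Y\subseteq P$ imply $Y\in\mathcal{F}$. It is *sketchable* (with sketch size $k$, a merge procedure, a membership oracle and a time bound $c$; all of these are fixed, independently of $n$, $P$, $\mathcal{F}$ and $\varepsilon$) if it is upward closed and every $S\subseteq P$ has a sketch $\mathrm{sk}(S)\in\mathbb{R}^k$ such that (A) for all disjoint $S,T\subseteq P$, the merge procedure computes $\mathrm{sk}(S\cup T)$ from $\mathrm{sk}(S)$ and $\mathrm{sk}(T)$ in at most $c$ steps, and (B) for all $S\subseteq P$, the oracle decides from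 $\mathrm{sk}(S)$ in at most $c$ steps whether $S\in\mathcal{F}$. A partition $\mathcal{P}$ of $P$ into non-empty sets is an *$r$-connected clustering* if every $A\in\mathcal{P}$ belongs to $\mathcal{F}$ and is contained in some set of $\mathcal{C}_r(P)$. **Theorem.** For every $d$ and every fixed choice of $k$, merge procedure, oracle and $c$, there are a randomized algorithm and a constant $C$ (depending only on these data) such that the following holds for every set $P\subseteq\mathbb{R}^d$ of $n\ge1$ points, every family $\mathcal{F}$ of subsets of $P$ that is sketchable with these data, and every $\varepsilon\in(0,1)$. Suppose that an $r$-connected clustering of $P$ exists for some $r\ge 0$. Then there is a minimum $r_{\mathrm{opt}}\ge 0$ such that $P$ has an $r_{\mathrm{opt}}$-connected clustering. Given $n$, $\varepsilon$, the coordinates of the points of $P$ and the sketches of the one-point subsets of $P$, the algorithm has expected running time at most $C\,n/\varepsilon^d$, and whenever it halts it outputs a number $v$ with $$r_{\mathrm{opt}}\le v\le(1+\varepsilon)\,r_{\mathrm{opt}}.$$ -/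

import Mathlib

open scoped ENNReal

noncomputable section

/-! ### Randomized real RAM

The machine has real-valued memory cells, arranged in arrays; array `a` has one cell for every
integer, so cells are reached by indirect addressing through (rounded down) computed indices.
One step is one elementary command: an assignment, a test, a loop test, a random draw.
The available operations are `+`, `-`, `*`, `/`, floor and square root. A program is a fixed finite
text (array names and integer literals are part of the text), so the expressions in it have
bounded size and charging one step per command changes running times by a constant factor only. -/

namespace RealRAM

/-- Memory contents: `m a i` is the content of cell `i` of array `a`. -/
abbrev Store : Type := ℕ → ℤ → ℝ

/-- Arithmetic expressions. -/
inductive Term : Type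
  | const (z : ℤ)
  | get (a : ℕ) (i : Term)
  | add (x y : Term)
  | sub (x y : Term)
  | mul (x y : Term)
  | div (x y : Term)
  | floor (x : Term)
  | sqrt (x : Term)

/-- The value of an expression. Division by zero and the square root of a negative number give
zero. -/
def Term.eval (m : Store) : Term → ℝ
  | .const z => (z : ℝ)
  | .get a i => m a ⌊i.eval m⌋
  | .add x y => x.eval m + y.eval m
  | .sub x y => x.eval m - y.eval m
  | .mul x y => x.eval m * y.eval m
  | .div x y => x.eval m / y.eval m
  | .floor x => (⌊x.eval m⌋ : ℝ)
  | .sqrt x => Real.sqrt (x.eval m)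

/-- Programs.
* `assign a i x`: store the value of `x` in cell `i` of array `a`;
* `draw a i x`: store a uniformly random element of `{0, …, ⌊x⌋ - 1}` in cell `i` of array `a`;
* `cond x y c c'`: run `c` if `x ≤ y`, and `c'` otherwise;
* `loop x y c`: run `c` as long as `x ≤ y`. -/
inductive Cmd : Type
  | skip
  | assign (a : ℕ) (i x : Term)
  | draw (a : ℕ) (i x : Term)
  | seq (c c' : Cmd)
  | cond (x y : Term) (c c' : Cmd)
  | loop (x y : Term) (c : Cmd)

/-- The store after writing `v` to cell `i` of array `a`. -/
def Store.write (m : Store) (a : ℕ) (i : ℤ) (v : ℝ) : Store :=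
  Function.update m a (Function.update (m a) i v)

/-- The uniform distribution on `{0, …, ⌊x⌋ - 1}` (the point mass at `0` if `x < 1`). -/
def uniformBelow (x : ℝ) : PMF ℕ :=
  PMF.uniformOfFinset (Finset.range (max 1 ⌊x⌋₊)) ⟨0, by simp⟩

/-- A configuration: the list of commands still to be executed, and the memory. The machine has
halted when the list is empty. -/
abbrev Config : Type := List Cmd × Store

open Classical in
/-- One step of the machine. A halted configuration does not change any more. -/
def step : Config → PMF Config
  | ([], m) => PMF.pure ([], m)
  | (.skip :: k, m) => PMF.pure (k, m)
  | (.assign a i x :: k, m) => PMF.pure (k, m.write a ⌊i.eval m⌋ (x.eval m))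
  | (.draw a i x :: k, m) =>
      (uniformBelow (x.eval m)).map fun v => (k, m.write a ⌊i.eval m⌋ (v : ℝ))
  | (.seq c c' :: k, m) => PMF.pure (c :: c' :: k, m)
  | (.cond x y c c' :: k, m) =>
      PMF.pure (if x.eval m ≤ y.eval m then (c :: k, m) else (c' :: k, m))
  | (.loop x y c :: k, m) =>
      PMF.pure (if x.eval m ≤ y.eval m then (c :: .loop x y c :: k, m) else (k, m))

/-- The distribution of the configuration after `t` steps. -/
def runFor : ℕ → Config → PMF Config
  | 0, s => PMF.pure s
  | t + 1, s => (step s).bind (runFor t)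

/-- The expected number `E[T] = ∑ₜ P(T > t)` of steps until the machine halts; it is infinite if the
machine fails to halt with positive probability. -/
def expectedTime (s : Config) : ℝ≥0∞ :=
  ∑' t : ℕ, (runFor t s).toOuterMeasure {s' | s'.1 ≠ []}

end RealRAM

/-! ### Connectivity clustering -/

section Clustering

variable {ι : Type} {d : ℕ}

/-- The graph on the points `p i` in which two points are adjacent when their distance is at most
`r`, i.e. when the balls of radius `r / 2` around them intersect. -/
def distanceGraph (p : ι → EuclideanSpace ℝ (Fin d)) (r : ℝ) : SimpleGraph ι :=
  SimpleGraph.fromRel fun i j => dist (p i) (p j) ≤ r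

/-- The `r`-connectivity clustering: the vertex sets of the connected components of the distance
graph. -/
def connectivityClustering (p : ι → EuclideanSpace ℝ (Fin d)) (r : ℝ) : Set (Set ι) :=
  Set.range fun K : (distanceGraph p r).ConnectedComponent => K.supp

/-- A set of points is `r`-valid if it is contained in a set of the `r`-connectivity clustering. -/
def IsRValid (p : ι → EuclideanSpace ℝ (Fin d)) (r : ℝ) (A : Finset ι) : Prop :=
  ∃ X ∈ connectivityClustering p r, (A : Set ι) ⊆ X

/-- A partition of the points is an `r`-connected clustering (for the family `F`) if all of its
sets are in `F` and are `r`-valid. -/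
def IsConnectedClustering [Fintype ι] [DecidableEq ι] (p : ι → EuclideanSpace ℝ (Fin d))
    (F : Set (Finset ι)) (r : ℝ) (Q : Finpartition (Finset.univ : Finset ι)) : Prop :=
  ∀ A ∈ Q.parts, A ∈ F ∧ IsRValid p r A

/-- The radii `r ≥ 0` for which there is an `r`-connected clustering. -/
def connectedRadii [Fintype ι] [DecidableEq ι] (p : ι → EuclideanSpace ℝ (Fin d))
    (F : Set (Finset ι)) : Set ℝ :=
  {r | 0 ≤ r ∧ ∃ Q : Finpartition (Finset.univ : Finset ι), IsConnectedClustering p F r Q}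

end Clustering

/-! ### Sketchable families -/

/-- Constant-size sketches with constant-time procedures: the number `size` of reals in a sketch,
the procedure that computes the sketch of a disjoint union, the membership oracle, and a bound on
the number of steps of the two procedures. -/
structure SketchScheme where
  size : ℕ
  merge : RealRAM.Cmd
  oracle : RealRAM.Cmd
  time : ℕ

/-- Cells `0, …, k - 1` of array `a` contain the vector `v`. -/
def RealRAM.Store.Holds (m : RealRAM.Store) (a : ℕ) {k : ℕ} (v : Fin k → ℝ) : Prop :=
  ∀ j : Fin k, m a (j : ℤ) = v j

open Classical in
/-- `sk` assigns to every subset `S` of the ground set a sketch `sk S` as required of a sketchable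
family `F` (whose upward closedness is a separate condition).
The procedures may be called in any memory state that holds their arguments (arrays `0` and `1` for
`merge`, array `0` for `oracle`); they halt within the time bound, with the result in array `2`
for `merge`, and in cell `0` of array `1` for `oracle`. -/
structure IsSketch {ι : Type} (σ : SketchScheme) (F : Set (Finset ι))
    (sk : Finset ι → Fin σ.size → ℝ) : Prop where
  merge_spec : ∀ S T : Finset ι, Disjoint S T → ∀ m : RealRAM.Store,
    m.Holds 0 (sk S) → m.Holds 1 (sk T) →
      ∀ s ∈ (RealRAM.runFor σ.time ([σ.merge], m)).support,
        s.1 = [] ∧ s.2.Holds 2 (sk (S ∪ T))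
  oracle_spec : ∀ S : Finset ι, ∀ m : RealRAM.Store, m.Holds 0 (sk S) →
      ∀ s ∈ (RealRAM.runFor σ.time ([σ.oracle], m)).support,
        s.1 = [] ∧ s.2 1 0 = if S ∈ F then 1 else 0

/-! ### Input and output -/

/-- The input of the algorithm: array `0` starts with `n` and `ε`, array `1` contains the
coordinates of the points, point after point, and array `2` the sketches of the one-point sets, one
after the other. All other cells contain `0`. -/
def inputStore {n d k : ℕ} (p : Fin n → EuclideanSpace ℝ (Fin d)) (ε : ℝ)
    (sk : Finset (Fin n) → Fin k → ℝ) : RealRAM.Store := fun a z =>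
  match a with
  | 0 => if z = 0 then (n : ℝ) else if z = 1 then ε else 0
  | 1 => ∑ i : Fin n, ∑ j : Fin d, if z = (i : ℤ) * d + j then p i j else 0
  | 2 => ∑ i : Fin n, ∑ j : Fin k, if z = (i : ℤ) * k + j then sk {i} j else 0
  | _ => 0

/-- The output of the algorithm: cell `0` of array `0`. -/
def outputValue (m : RealRAM.Store) : ℝ := m 0 0

end

/-! ### Program logic -/

namespace RealRAM

noncomputable section

/-! Because the family is upward closed, a radius is feasible exactly when every component of the
distance graph at that radius belongs to it (`mem_connectedRadii`). Only finitely many graphs occur,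
so a least feasible radius exists (`exists_isLeast_connectedRadii`). It is approximated by a
randomized net-and-prune scheme followed by a refinement of the bounds.

The basic tool is an approximate decision. Points are rounded to a grid of side `s`, and cells
within distance `T` are joined; the components found lie between those of the true graphs at radii
`T - s (d + 1)` and `T + s (d + 1)`. The coordinates of a cell are packed into one integer in a
large base (`gridCode_adj_iff`), so that indirect addressing replaces hashing. Breadth-first search
over the cells, merging of sketches and calls of the oracle then cost at most a constant times `n +
1` times one more than the number of grid offsets (`exists_HT_decideCmd`).

The main loop keeps disjoint clusters with representatives, connected at a radius `g` with `16 g ≤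
ropt`, while all removed points are far away and already satisfied (`NetInv`). Passing to
representatives changes a distance by at most `4 g`, so decisions stay meaningful. A round draws a
random cluster and takes the distance `l` from its representative to the nearest other one. If
`ropt` is below about `l / 8`, clusters isolated at about `l / 2` are discarded, among them all with
nearest-neighbour distance at least `l` (`NetInv.prune`). If `ropt` exceeds `48 l`, the clusters are
merged into a greedy net, and at least half as many disappear as have nearest-neighbour distance at
most `l` (`NetInv.net`, `card_close_le`). Otherwise `ropt` is known up to a factor `520`. For at
least half of the draws the rank of `l` is not extreme, so the expected number of clusters drops to
at most `15/16` (`sum_roundBound_le`), and the expected total time is linear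
(`exists_good_mainLoop`). If at most one cluster is left, then `ropt ≤ g`, which forces `ropt = 0`.

The refinement returns to the original points, where `g = 0`. Each test removes a third of the
interval, at a cost proportional to `(hi / (hi - lo)) ^ d` per point. For positive `d` these costs
increase geometrically, and their sum is of order `n / ε ^ d` (`exists_HT_refineLoop`).

Worst-case time and correctness of program pieces are expressed by `HT`; `Good` combines expected
time with correctness in halting states, and `Good.draw` is where averaging over the sampled cluster
enters. -/

/-- All executions from a configuration reach a configuration satisfying `R` within `t` steps. -/
inductive Reach (R : Config → Prop) : ℕ → Config → Prop
  | done {t : ℕ} {s : Config} : R s → Reach R t s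
  | step {t : ℕ} {s : Config} : s.1 ≠ [] → (∀ s' ∈ (step s).support, Reach R t s') →
      Reach R (t + 1) s

theorem Reach.mono {R R' : Config → Prop} {t t' : ℕ} {s : Config} (h : Reach R t s)
    (ht : t ≤ t') (hR : ∀ s, R s → R' s) : Reach R' t' s := by
  induction h generalizing t' with
  | done h => exact .done (hR _ h)
  | step hs _ ih =>
    obtain ⟨u, rfl⟩ : ∃ u, t' = u + 1 := ⟨t' - 1, by omega⟩
    exact .step hs fun s' hs' => ih s' hs' (by omega)

theorem Reach.bind {R R' : Config → Prop} {t t' : ℕ} {s : Config} (h : Reach R t s)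
    (hR : ∀ s, R s → Reach R' t' s) : Reach R' (t + t') s := by
  induction h with
  | done h => exact (hR _ h).mono (by omega) fun _ => id
  | step hs _ ih =>
    rw [Nat.add_right_comm]
    exact .step hs ih

/-- Every execution of `c` from the memory `m` ends within `T` steps in a memory satisfying `Q`. -/
def HT (c : Cmd) (m : Store) (T : ℕ) (Q : Store → Prop) : Prop :=
  ∀ k : List Cmd, Reach (fun s => s.1 = k ∧ Q s.2) T (c :: k, m)

theorem HT.mono {c : Cmd} {m : Store} {T T' : ℕ} {Q Q' : Store → Prop} (h : HT c m T Q)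
    (hT : T ≤ T') (hQ : ∀ m', Q m' → Q' m') : HT c m T' Q' := fun k =>
  (h k).mono hT fun _ hs => ⟨hs.1, hQ _ hs.2⟩

theorem HT.skip {m : Store} {Q : Store → Prop} (h : Q m) : HT .skip m 1 Q := fun k =>
  .step (by simp) fun s' hs' => by
    simp only [RealRAM.step, PMF.support_pure, Set.mem_singleton_iff] at hs'
    subst hs'
    exact .done ⟨rfl, h⟩

theorem HT.assign {a : ℕ} {i x : Term} {m : Store} {Q : Store → Prop}
    (h : Q (m.write a ⌊i.eval m⌋ (x.eval m))) : HT (.assign a i x) m 1 Q := fun k =>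
  .step (by simp) fun s' hs' => by
    simp only [RealRAM.step, PMF.support_pure, Set.mem_singleton_iff] at hs'
    subst hs'
    exact .done ⟨rfl, h⟩

theorem HT.seq {c c' : Cmd} {m : Store} {T T' T'' : ℕ} {Q : Store → Prop}
    (h : HT c m T fun m' => HT c' m' T' Q) (hT : T + T' + 1 ≤ T'') : HT (.seq c c') m T'' Q :=
  fun k => by
    refine Reach.mono (t := T + T' + 1) ?_ hT fun _ => id
    refine .step (by simp) fun s' hs' => ?_
    simp only [RealRAM.step, PMF.support_pure, Set.mem_singleton_iff] at hs'
    subst hs'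
    refine (h (c' :: k)).bind ?_
    rintro ⟨k', m'⟩ ⟨rfl, h'⟩
    exact h' k

theorem HT.cond {x y : Term} {c c' : Cmd} {m : Store} {T T' : ℕ} {Q : Store → Prop}
    (h : x.eval m ≤ y.eval m → HT c m T Q) (h' : ¬ x.eval m ≤ y.eval m → HT c' m T Q)
    (hT : T + 1 ≤ T') : HT (.cond x y c c') m T' Q :=
  fun k => by
    refine Reach.mono (t := T + 1) ?_ hT fun _ => id
    refine .step (by simp) fun s' hs' => ?_
    simp only [RealRAM.step, PMF.support_pure, Set.mem_singleton_iff] at hs'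
    subst hs'
    by_cases hxy : x.eval m ≤ y.eval m
    · simpa [hxy] using h hxy k
    · simpa [hxy] using h' hxy k

theorem HT.loop_of_le {x y : Term} {c : Cmd} {m : Store} {T T' T'' : ℕ} {Q : Store → Prop}
    (hxy : x.eval m ≤ y.eval m) (h : HT c m T fun m' => HT (.loop x y c) m' T' Q)
    (hT : T + T' + 1 ≤ T'') : HT (.loop x y c) m T'' Q :=
  fun k => by
    refine Reach.mono (t := T + T' + 1) ?_ hT fun _ => id
    refine .step (by simp) fun s' hs' => ?_
    simp only [RealRAM.step, PMF.support_pure, Set.mem_singleton_iff, hxy, if_true] at hs'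
    subst hs'
    refine (h _).bind ?_
    rintro ⟨k', m'⟩ ⟨rfl, h'⟩
    exact h' k

theorem HT.loop_of_not_le {x y : Term} {c : Cmd} {m : Store} {T : ℕ} {Q : Store → Prop}
    (hxy : ¬ x.eval m ≤ y.eval m) (h : Q m) (hT : 1 ≤ T) : HT (.loop x y c) m T Q :=
  fun k => by
    refine Reach.mono (t := 1) ?_ hT fun _ => id
    refine .step (by simp) fun s' hs' => ?_
    simp only [RealRAM.step, PMF.support_pure, Set.mem_singleton_iff, hxy, if_false] at hs'
    subst hs'
    exact .done ⟨rfl, h⟩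

/-- Loops with a bound `v` on the number of iterations. -/
theorem HT.loop {x y : Term} {c : Cmd} {T : ℕ} {Q : Store → Prop} (I : ℕ → Store → Prop)
    (hbody : ∀ v m, I v m → x.eval m ≤ y.eval m →
      ∃ u, v = u + 1 ∧ HT c m T fun m' => I u m')
    (hend : ∀ v m, I v m → ¬ x.eval m ≤ y.eval m → Q m) (v : ℕ) (m : Store) (h : I v m) :
    HT (.loop x y c) m (v * (T + 1) + 1) Q := by
  induction v generalizing m with
  | zero =>
    by_cases hxy : x.eval m ≤ y.eval m
    · obtain ⟨u, hu, -⟩ := hbody _ _ h hxy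
      omega
    · exact .loop_of_not_le hxy (hend _ _ h hxy) (by omega)
  | succ v ih =>
    by_cases hxy : x.eval m ≤ y.eval m
    · obtain ⟨u, hu, hc⟩ := hbody _ _ h hxy
      obtain rfl : v = u := by omega
      exact .loop_of_le hxy (hc.mono le_rfl fun m' h' => ih m' h') (by ring_nf; omega)
    · exact .loop_of_not_le hxy (hend _ _ h hxy) (by omega)

/-! ### Procedures given by their input-output behaviour -/

/-- A step looks only at the head of the stack, so the commands below it are carried along. -/
theorem step_append (c : Cmd) (l k : List Cmd) (m : Store) :
    step (c :: (l ++ k), m) = (step (c :: l, m)).map fun s => (s.1 ++ k, s.2) := by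
  cases c <;> simp only [step, PMF.pure_map, PMF.map_comp, List.cons_append, Function.comp_def]
  all_goals split_ifs <;> simp

/-- The sketch procedures are known only through the distribution after a fixed number of steps with
nothing else on the stack. Halted configurations are stationary, so this knowledge can be
transported to an arbitrary continuation. -/
theorem reach_append {P : Store → Prop} (T : ℕ) (l k : List Cmd) (m : Store)
    (h : ∀ s ∈ (runFor T (l, m)).support, s.1 = [] ∧ P s.2) :
    Reach (fun s => s.1 = k ∧ P s.2) T (l ++ k, m) := by
  induction T generalizing l m with
  | zero =>
    obtain ⟨h1, h2⟩ := h (l, m) (by simp [runFor])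
    simp only at h1 h2
    subst h1
    exact .done ⟨rfl, h2⟩
  | succ T ih =>
    cases l with
    | nil =>
      have : ∀ t, runFor t ([], m) = PMF.pure ([], m) := by
        intro t
        induction t with
        | zero => rfl
        | succ t ih => simp [runFor, step, ih]
      rw [this] at h
      exact .done ⟨rfl, (h ([], m) (by simp)).2⟩
    | cons c l =>
      refine .step (by simp) fun s' hs' => ?_
      rw [List.cons_append, step_append, PMF.support_map] at hs'
      obtain ⟨s, hs, rfl⟩ := hs'
      refine ih _ _ fun s'' hs'' => h s'' ?_
      simp only [runFor, PMF.mem_support_bind_iff]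
      exact ⟨s, hs, hs''⟩

theorem HT.of_runFor {P : Store → Prop} {T : ℕ} {c : Cmd} {m : Store}
    (h : ∀ s ∈ (runFor T ([c], m)).support, s.1 = [] ∧ P s.2) : HT c m T P :=
  fun k => reach_append T [c] k m h

/-! ### Arrays written by a program -/

/-- The program contains a command that writes to array `a`. -/
def Cmd.Writes (a : ℕ) : Cmd → Prop
  | .skip => False
  | .assign a' _ _ => a = a'
  | .draw a' _ _ => a = a'
  | .seq c c' => c.Writes a ∨ c'.Writes a
  | .cond _ _ c c' => c.Writes a ∨ c'.Writes a
  | .loop _ _ c => c.Writes a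

theorem Store.write_apply (m : Store) (a a' : ℕ) (i i' : ℤ) (v : ℝ) :
    m.write a i v a' i' = if a' = a ∧ i' = i then v else m a' i' := by
  unfold Store.write
  by_cases h : a' = a
  · subst h
    simp [Function.update_apply]
  · simp [h]

theorem Store.write_of_ne (m : Store) {a a' : ℕ} (i : ℤ) (v : ℝ) (h : a' ≠ a) :
    m.write a i v a' = m a' := by
  simp [Store.write, h]

/-- The whole stack is considered because branches and loop bodies get pushed onto it; everything
pushed is a subprogram of the command removed. -/
theorem step_frame {a : ℕ} {l : List Cmd} {m : Store} (hl : ∀ c ∈ l, ¬ c.Writes a) {s : Config}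
    (hs : s ∈ (step (l, m)).support) : (∀ c ∈ s.1, ¬ c.Writes a) ∧ s.2 a = m a := by
  cases l with
  | nil =>
    simp only [step, PMF.support_pure, Set.mem_singleton_iff] at hs
    subst hs
    simp
  | cons c l =>
    have hc := hl c (by simp)
    have hl' : ∀ c ∈ l, ¬ c.Writes a := fun c' h => hl c' (by simp [h])
    cases c with
    | draw a' i x =>
      simp only [step, PMF.support_map] at hs
      obtain ⟨v, -, rfl⟩ := hs
      exact ⟨hl', m.write_of_ne _ _ hc⟩
    | assign a' i x =>
      simp only [step, PMF.support_pure, Set.mem_singleton_iff] at hs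
      subst hs
      exact ⟨hl', m.write_of_ne _ _ hc⟩
    | skip =>
      simp only [step, PMF.support_pure, Set.mem_singleton_iff] at hs
      subst hs
      exact ⟨hl', rfl⟩
    | seq c c' =>
      simp only [step, PMF.support_pure, Set.mem_singleton_iff] at hs
      subst hs
      simp only [Cmd.Writes, not_or] at hc
      refine ⟨?_, rfl⟩
      simpa [hc] using hl'
    | cond x y c c' =>
      simp only [step, PMF.support_pure, Set.mem_singleton_iff] at hs
      subst hs
      simp only [Cmd.Writes, not_or] at hc
      split_ifs
      · refine ⟨?_, rfl⟩
        simpa [hc] using hl'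
      · refine ⟨?_, rfl⟩
        simpa [hc] using hl'
    | loop x y c =>
      simp only [step, PMF.support_pure, Set.mem_singleton_iff] at hs
      subst hs
      have hc' := hc
      simp only [Cmd.Writes] at hc
      split_ifs
      · refine ⟨?_, rfl⟩
        simpa [hc, hc'] using hl'
      · exact ⟨hl', rfl⟩

theorem Reach.frame {A : Set ℕ} {Q : Store → Prop} {T : ℕ} {s : Config} {m : Store}
    (h : Reach (fun s => s.1 = [] ∧ Q s.2) T s)
    (hl : ∀ a ∈ A, ∀ c ∈ s.1, ¬ c.Writes a) (hm : ∀ a ∈ A, s.2 a = m a) :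
    Reach (fun s => s.1 = [] ∧ Q s.2 ∧ ∀ a ∈ A, s.2 a = m a) T s := by
  induction h with
  | done h => exact .done ⟨h.1, h.2, hm⟩
  | @step t s hs0 h ih =>
    exact .step hs0 fun s' hs' => ih s' hs' (fun a ha => (step_frame (hl a ha) hs').1)
      fun a ha => (step_frame (hl a ha) hs').2.trans (hm a ha)

theorem Reach.append {Q : Store → Prop} {T : ℕ} {s : Config} (k : List Cmd)
    (h : Reach (fun s => s.1 = [] ∧ Q s.2) T s) :
    Reach (fun s => s.1 = k ∧ Q s.2) T (s.1 ++ k, s.2) := by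
  induction h with
  | done h => exact .done ⟨by simp [h.1], h.2⟩
  | @step t s hs0 h ih =>
    obtain ⟨l, m⟩ := s
    cases l with
    | nil => exact absurd rfl hs0
    | cons c l =>
      refine .step (by simp) fun s' hs' => ?_
      rw [List.cons_append, step_append, PMF.support_map] at hs'
      obtain ⟨s, hs, rfl⟩ := hs'
      exact ih s hs

/-- A continuation could write anywhere, so the command is first run with an empty one, and the
continuation is appended afterwards. -/
theorem HT.frame {c : Cmd} {m : Store} {T : ℕ} {Q : Store → Prop} (h : HT c m T Q) :
    HT c m T fun m' => Q m' ∧ ∀ a, ¬ c.Writes a → m' a = m a := fun k =>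
  Reach.append (s := ([c], m)) (Q := fun m' => Q m' ∧ ∀ a, ¬ c.Writes a → m' a = m a) k <|
    Reach.frame (A := {a | ¬ c.Writes a}) (h []) (by simp) fun _ _ => rfl

/-! ### Expected running time and correctness of the halting states -/

/-- The expected running time from `s` is at most `B`, and every memory in which the machine may
halt satisfies `P`. -/
def Good (P : Store → Prop) (B : ℝ≥0∞) (s : Config) : Prop :=
  expectedTime s ≤ B ∧ ∀ t, ∀ s' ∈ (runFor t s).support, s'.1 = [] → P s'.2

theorem runFor_nil (t : ℕ) (m : Store) : runFor t ([], m) = PMF.pure ([], m) := by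
  induction t with
  | zero => rfl
  | succ t ih => simp [runFor, step, ih]

/-- First-step analysis: in `∑ P(T > t)` the term `t = 0` is `1`, and the shifted sum is averaged
over the first step. -/
theorem expectedTime_step {s : Config} (hs : s.1 ≠ []) :
    expectedTime s = 1 + ∑' s', step s s' * expectedTime s' := by
  unfold expectedTime
  rw [tsum_eq_zero_add' ENNReal.summable]
  congr 1
  · simp [runFor, PMF.toOuterMeasure_pure_apply, hs]
  · simp_rw [runFor, PMF.toOuterMeasure_bind_apply]
    rw [ENNReal.tsum_comm]
    simp_rw [ENNReal.tsum_mul_left]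

theorem Good.mono {P : Store → Prop} {B B' : ℝ≥0∞} {s : Config} (h : Good P B s) (hB : B ≤ B') :
    Good P B' s := ⟨h.1.trans hB, h.2⟩

theorem Good.halt {P : Store → Prop} {m : Store} (h : P m) : Good P 0 ([], m) := by
  refine ⟨?_, fun t s' hs' _ => ?_⟩
  · simp [expectedTime, runFor_nil, PMF.toOuterMeasure_pure_apply]
  · rw [runFor_nil] at hs'
    simp only [PMF.support_pure, Set.mem_singleton_iff] at hs'
    subst hs'
    exact h

theorem Good.step {P : Store → Prop} {s : Config} (B : Config → ℝ≥0∞) (hs : s.1 ≠ [])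
    (h : ∀ s' ∈ (step s).support, Good P (B s') s') :
    Good P (1 + ∑' s', RealRAM.step s s' * B s') s := by
  refine ⟨?_, fun t s' hs' h' => ?_⟩
  · rw [expectedTime_step hs]
    gcongr 1 + ?_
    refine ENNReal.tsum_le_tsum fun s' => ?_
    by_cases h0 : RealRAM.step s s' = 0
    · simp [h0]
    · gcongr
      exact (h s' ((PMF.mem_support_iff _ _).2 h0)).1
  · cases t with
    | zero =>
      simp only [runFor, PMF.support_pure, Set.mem_singleton_iff] at hs'
      subst hs'
      exact absurd h' hs
    | succ t =>
      simp only [runFor, PMF.mem_support_bind_iff] at hs'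
      obtain ⟨s1, h1, h2⟩ := hs'
      exact (h s1 h1).2 t s' h2 h'

theorem Good.step_const {P : Store → Prop} {s : Config} {B : ℝ≥0∞} (hs : s.1 ≠ [])
    (h : ∀ s' ∈ (RealRAM.step s).support, Good P B s') : Good P (1 + B) s := by
  have := Good.step (fun _ => B) hs h
  rwa [ENNReal.tsum_mul_right, PMF.tsum_coe, one_mul] at this

/-- A worst-case bound is simply added to the expected bound for what follows, so expectations
matter only where outcomes of a draw have different budgets. -/
theorem Reach.good {P : Store → Prop} {R : Config → Prop} {T : ℕ} {s : Config} {B : ℝ≥0∞}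
    (h : Reach R T s) (hR : ∀ s, R s → Good P B s) : Good P (T + B) s := by
  induction h with
  | done h => exact (hR _ h).mono (by simp)
  | step hs _ ih =>
    refine (Good.step_const hs ih).mono ?_
    push_cast
    rw [← add_assoc, add_comm (1 : ℝ≥0∞)]

theorem HT.good {P : Store → Prop} {c : Cmd} {m : Store} {T : ℕ} {Q : Store → Prop} {B : ℝ≥0∞}
    {k : List Cmd} (h : HT c m T Q) (hQ : ∀ m', Q m' → Good P B (k, m')) :
    Good P (T + B) (c :: k, m) :=
  (h k).good fun s hs => by
    obtain ⟨k', m'⟩ := s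
    obtain ⟨rfl, h⟩ := hs
    exact hQ _ h

theorem Good.draw {P : Store → Prop} {a : ℕ} {i x : Term} {k : List Cmd} {m : Store} {N : ℕ}
    (hN : 0 < N) (hx : x.eval m = N) (B : ℕ → ℝ≥0∞)
    (h : ∀ v < N, Good P (B v) (k, m.write a ⌊i.eval m⌋ (v : ℝ))) :
    Good P (1 + (∑ v ∈ Finset.range N, B v) / N) (.draw a i x :: k, m) := by
  have hr : max 1 ⌊x.eval m⌋₊ = N := by simp [hx]; omega
  have hstep : RealRAM.step (.draw a i x :: k, m) =
    (uniformBelow (x.eval m)).map fun v : ℕ => (k, m.write a ⌊i.eval m⌋ (v : ℝ)) := by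
    simp only [RealRAM.step, bind, pure, PMF.map]
    rw [PMF.bind_bind]
    simp [Function.comp_def]
  -- Different draws give different memories, so a budget depending on the drawn value can be read
  -- as a budget on configurations.
  have hinj : Function.Injective fun v : ℕ => ((k, m.write a ⌊i.eval m⌋ (v : ℝ)) : Config) := by
    intro v w hvw
    have := congrFun (congrFun (Prod.ext_iff.1 hvw).2 a) ⌊i.eval m⌋
    simpa [Store.write_apply] using this
  have key := Good.step (P := P) (s := (.draw a i x :: k, m))
    (fun s => B (Function.invFun (fun v : ℕ => ((k, m.write a ⌊i.eval m⌋ (v : ℝ)) : Config)) s))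
    (by simp) (by
      intro s' hs'
      rw [hstep, PMF.support_map] at hs'
      obtain ⟨v, hv, rfl⟩ := hs'
      rw [Function.leftInverse_invFun hinj v]
      refine h v ?_
      simpa [uniformBelow, hr] using hv)
  refine key.mono (le_of_eq ?_)
  congr 1
  rw [hstep]
  have : ∀ (q : PMF ℕ) (f : ℕ → Config) (g : Config → ℝ≥0∞),
      ∑' s, (q.map f) s * g s = ∑' v, q v * g (f v) := by
    intro q f g
    simp_rw [PMF.map_apply, ← ENNReal.tsum_mul_right]
    rw [ENNReal.tsum_comm]
    refine tsum_congr fun v => ?_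
    rw [tsum_eq_single (f v)]
    · simp
    · intro s hs
      simp [hs]
  rw [this]
  simp_rw [Function.leftInverse_invFun hinj _]
  rw [tsum_eq_sum (s := Finset.range N)]
  · rw [div_eq_mul_inv, Finset.sum_mul]
    refine Finset.sum_congr rfl fun v hv => ?_
    rw [mul_comm]
    congr 1
    simp only [uniformBelow, hr]
    rw [PMF.uniformOfFinset_apply_of_mem _ hv, Finset.card_range]
  · intro v hv
    simp only [uniformBelow, hr]
    rw [PMF.uniformOfFinset_apply_of_notMem _ hv, zero_mul]

end
end RealRAM

/-! ### A toolkit for programs: straight-line code, variables, counting loops, copying -/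

namespace RealRAM

noncomputable section

/-! ### Loop-free programs -/

/-- The program has no loops and no random draws. -/
def Cmd.Simple : Cmd → Prop
  | .skip => True
  | .assign _ _ _ => True
  | .draw _ _ _ => False
  | .seq c c' => c.Simple ∧ c'.Simple
  | .cond _ _ c c' => c.Simple ∧ c'.Simple
  | .loop _ _ _ => False

open Classical in
/-- The effect of a simple program on the memory. -/
def Cmd.exec : Cmd → Store → Store
  | .assign a i x, m => m.write a ⌊i.eval m⌋ (x.eval m)
  | .seq c c', m => c'.exec (c.exec m)
  | .cond x y c c', m => if x.eval m ≤ y.eval m then c.exec m else c'.exec m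
  | _, m => m

/-- A bound on the number of steps of a simple program. -/
def Cmd.cost : Cmd → ℕ
  | .seq c c' => c.cost + c'.cost + 1
  | .cond _ _ c c' => max c.cost c'.cost + 1
  | _ => 1

theorem HT.exec {c : Cmd} (hc : c.Simple) {m : Store} {Q : Store → Prop} (h : Q (c.exec m)) :
    HT c m c.cost Q := by
  induction c generalizing m Q with
  | skip => exact .skip h
  | assign a i x => exact .assign h
  | draw => exact hc.elim
  | seq c c' ih ih' => exact .seq (ih hc.1 (ih' hc.2 h)) le_rfl
  | cond x y c c' ih ih' =>
    refine .cond (fun hxy => ?_) (fun hxy => ?_) le_rfl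
    · exact (ih hc.1 (by simpa [Cmd.exec, hxy] using h)).mono (le_max_left _ _) fun _ => id
    · exact (ih' hc.2 (by simpa [Cmd.exec, hxy] using h)).mono (le_max_right _ _) fun _ => id
  | loop => exact hc.elim

/-! ### Naming of the arrays -/

/-- The working arrays, beginning at `b`; arrays with tag `t` form a sequence. -/
def arr (b t i : ℕ) : ℕ := b + Nat.pair t i

@[simp] theorem arr_inj {b t i t' i' : ℕ} : arr b t i = arr b t' i' ↔ t = t' ∧ i = i' := by
  simp [arr, Nat.pair_eq_pair]

theorem le_arr (b t i : ℕ) : b ≤ arr b t i := Nat.le_add_right _ _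

/-- The memory cell used for the scalar variable with tag `t`. -/
def Term.var (b t : ℕ) : Term := .get (arr b t 0) (.const 0)

@[simp] theorem Term.eval_var (b t : ℕ) (m : Store) : (Term.var b t).eval m = m (arr b t 0) 0 := by
  simp [Term.var, Term.eval]

/-- Assignment to a scalar variable. -/
def Cmd.set (b t : ℕ) (x : Term) : Cmd := .assign (arr b t 0) (.const 0) x

@[simp] theorem Cmd.exec_set (b t : ℕ) (x : Term) (m : Store) :
    (Cmd.set b t x).exec m = m.write (arr b t 0) 0 (x.eval m) := by
  simp [Cmd.set, Cmd.exec, Term.eval]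

@[simp] theorem Cmd.simple_set (b t : ℕ) (x : Term) : (Cmd.set b t x).Simple := trivial

theorem HT.set {b t : ℕ} {x : Term} {m : Store} {Q : Store → Prop}
    (h : Q (m.write (arr b t 0) 0 (x.eval m))) : HT (.set b t x) m 1 Q :=
  .assign (by simpa [Term.eval] using h)

/-- Sequential composition of a list of programs. -/
def Cmd.block : List Cmd → Cmd
  | [] => .skip
  | c :: l => .seq c (Cmd.block l)

/-- The program writes only to arrays below `b` and to working arrays with tags in `L`. -/
def Cmd.Within (b : ℕ) (L : List ℕ) (c : Cmd) : Prop :=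
  ∀ a, c.Writes a → a < b ∨ ∃ t ∈ L, ∃ i, a = arr b t i

/-- The working arrays with tags outside `L` are the same. -/
def Frame (b : ℕ) (L : List ℕ) (m m' : Store) : Prop :=
  ∀ t i, t ∉ L → m' (arr b t i) = m (arr b t i)

theorem Frame.refl {b : ℕ} {L : List ℕ} (m : Store) : Frame b L m m := fun _ _ _ => rfl

theorem Frame.trans {b : ℕ} {L : List ℕ} {m m' m'' : Store} (h : Frame b L m m')
    (h' : Frame b L m' m'') : Frame b L m m'' := fun t i ht => (h' t i ht).trans (h t i ht)

theorem Frame.mono {b : ℕ} {L L' : List ℕ} {m m' : Store} (h : Frame b L m m') (hL : L ⊆ L') :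
    Frame b L' m m' := fun t i ht => h t i fun h' => ht (hL h')

theorem Frame.write {b : ℕ} {L : List ℕ} {m m' : Store} (h : Frame b L m m') {t : ℕ} (ht : t ∈ L)
    (i : ℕ) (z : ℤ) (v : ℝ) : Frame b L m (m'.write (arr b t i) z v) := fun t' i' ht' => by
  rw [Store.write_of_ne, h _ _ ht']
  rintro h
  rw [arr_inj] at h
  exact ht' (h.1 ▸ ht)

theorem Cmd.Within.mono {b : ℕ} {L L' : List ℕ} {c : Cmd} (h : c.Within b L) (hL : L ⊆ L') :
    c.Within b L' := fun a ha => (h a ha).imp id fun ⟨t, ht, i⟩ => ⟨t, hL ht, i⟩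

theorem HT.within {b : ℕ} {L : List ℕ} {c : Cmd} {m : Store} {T : ℕ} {Q : Store → Prop}
    (hc : c.Within b L) (h : HT c m T Q) : HT c m T fun m' => Q m' ∧ Frame b L m m' :=
  h.frame.mono le_rfl fun m' h' => ⟨h'.1, fun t i ht => h'.2 _ fun hw => by
    rcases hc _ hw with h1 | ⟨t', ht', i', h1⟩
    · exact absurd (le_arr b t i) (by omega)
    · rw [arr_inj] at h1
      exact ht (h1.1 ▸ ht')⟩

@[simp] theorem Cmd.within_skip {b : ℕ} {L : List ℕ} : Cmd.skip.Within b L := fun _ h => h.elim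

@[simp] theorem Cmd.within_assign {b t i : ℕ} {L : List ℕ} {x y : Term} :
    (Cmd.assign (arr b t i) x y).Within b L ↔ t ∈ L := by
  constructor
  · intro h
    rcases h _ rfl with h | ⟨t', ht', i', h⟩
    · exact absurd (le_arr b t i) (by omega)
    · rw [arr_inj] at h
      exact h.1 ▸ ht'
  · rintro h a rfl
    exact .inr ⟨t, h, i, rfl⟩

@[simp] theorem Cmd.within_set {b t : ℕ} {L : List ℕ} {x : Term} :
    (Cmd.set b t x).Within b L ↔ t ∈ L := Cmd.within_assign

@[simp] theorem Cmd.within_seq {b : ℕ} {L : List ℕ} {c c' : Cmd} :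
    (Cmd.seq c c').Within b L ↔ c.Within b L ∧ c'.Within b L := by
  simp [Cmd.Within, Cmd.Writes, or_imp, forall_and]

@[simp] theorem Cmd.within_cond {b : ℕ} {L : List ℕ} {x y : Term} {c c' : Cmd} :
    (Cmd.cond x y c c').Within b L ↔ c.Within b L ∧ c'.Within b L := by
  simp [Cmd.Within, Cmd.Writes, or_imp, forall_and]

@[simp] theorem Cmd.within_loop {b : ℕ} {L : List ℕ} {x y : Term} {c : Cmd} :
    (Cmd.loop x y c).Within b L ↔ c.Within b L := Iff.rfl

@[simp] theorem Cmd.within_block {b : ℕ} {L : List ℕ} {l : List Cmd} :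
    (Cmd.block l).Within b L ↔ ∀ c ∈ l, c.Within b L := by
  induction l with
  | nil => simp [Cmd.block]
  | cons c l ih => simp [Cmd.block, ih]

@[simp] theorem Cmd.simple_block {l : List Cmd} :
    (Cmd.block l).Simple ↔ ∀ c ∈ l, c.Simple := by
  induction l with
  | nil => simp [Cmd.block, Cmd.Simple]
  | cons c l ih => simp [Cmd.block, Cmd.Simple, ih]

/-! ### Counting loops -/

/-- Run the body for the values `0, …, N - 1` of the variable with tag `t`. -/
def Cmd.for (b t : ℕ) (N : Term) (c : Cmd) : Cmd :=
  .seq (.set b t (.const 0))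
    (.loop (.add (.var b t) (.const 1)) N (.seq c (.set b t (.add (.var b t) (.const 1)))))

@[simp] theorem Cmd.within_for {b t : ℕ} {N : Term} {L : List ℕ} {c : Cmd} :
    (Cmd.for b t N c).Within b L ↔ t ∈ L ∧ c.Within b L := by
  simp only [Cmd.for, within_seq, within_set, within_loop]
  tauto

/-- The invariant is demanded after the counter has been advanced, since the increment belongs to
the iteration. The limit `N` is evaluated anew each time and must therefore be stable under all
writes of the loop. -/
theorem HT.for {b t : ℕ} {N : Term} {c : Cmd} {L : List ℕ} (hc : c.Within b L) (ht : t ∉ L)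
    {m : Store} {n T : ℕ} {Q : Store → Prop} (I : ℕ → Store → Prop)
    (hN : ∀ m', Frame b (t :: L) m m' → N.eval m' = n)
    (h0 : I 0 (m.write (arr b t 0) 0 0))
    (hbody : ∀ j < n, ∀ m', Frame b (t :: L) m m' → m' (arr b t 0) 0 = j → I j m' →
      HT c m' T fun m'' => I (j + 1) (m''.write (arr b t 0) 0 (j + 1)))
    (hQ : ∀ m', Frame b (t :: L) m m' → m' (arr b t 0) 0 = n → I n m' → Q m') :
    HT (.for b t N c) m ((T + 6) * (n + 1)) Q := by
  refine .seq (T := 1) (T' := n * (T + 2 + 1) + 1) (.set ?_) (by ring_nf; omega)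
  refine HT.loop (T := T + 2) (fun v m' => ∃ j, j + v = n ∧ Frame b (t :: L) m m' ∧
    m' (arr b t 0) 0 = j ∧ I j m') ?_ ?_ n _ ?_
  · rintro v m' ⟨j, hj, hf, hv, hI⟩ hle
    simp only [Term.eval, Term.eval_var, hv, hN m' hf] at hle
    have hlt : j < n := by exact_mod_cast (by push_cast at hle; linarith : ((j : ℝ)) < n)
    refine ⟨v - 1, by omega, ?_⟩
    refine .seq (T := T) (T' := 1) (((hbody j hlt m' hf hv hI).within hc).mono le_rfl ?_) le_rfl
    rintro m'' ⟨hI', hf'⟩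
    refine .set ⟨j + 1, by omega, ?_, ?_, ?_⟩
    · exact (hf.trans (hf'.mono (by simp))).write (by simp) _ _ _
    · simp [Term.eval, Store.write_apply, hf' t 0 ht, hv]
    · simpa [Term.eval, hf' t 0 ht, hv] using hI'
  · rintro v m' ⟨j, hj, hf, hv, hI⟩ hle
    simp only [Term.eval, Term.eval_var, hv, hN m' hf] at hle
    have hlt : ¬ j < n := by
      intro h
      apply hle
      push_cast
      exact_mod_cast h
    obtain rfl : j = n := by omega
    exact hQ m' hf hv hI
  · refine ⟨0, by simp, (Frame.refl m).write (by simp) _ _ _, ?_, ?_⟩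
    · simp [Store.write_apply, Term.eval]
    · simpa [Term.eval] using h0

/-! ### Unrolled sums, powers and copies -/

/-- `f 0 + ⋯ + f (n - 1)` -/
def Term.sum (f : ℕ → Term) : ℕ → Term
  | 0 => .const 0
  | n + 1 => .add (Term.sum f n) (f n)

@[simp] theorem Term.eval_sum (f : ℕ → Term) (n : ℕ) (m : Store) :
    (Term.sum f n).eval m = ∑ i ∈ Finset.range n, (f i).eval m := by
  induction n with
  | zero => simp [Term.sum, Term.eval]
  | succ n ih => rw [Term.sum, Term.eval, ih, Finset.sum_range_succ]

/-- `x ^ n` -/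
def Term.pow (x : Term) : ℕ → Term
  | 0 => .const 1
  | n + 1 => .mul (Term.pow x n) x

@[simp] theorem Term.eval_pow (x : Term) (n : ℕ) (m : Store) :
    (Term.pow x n).eval m = x.eval m ^ n := by
  induction n with
  | zero => simp [Term.pow, Term.eval]
  | succ n ih => rw [Term.pow, Term.eval, ih, pow_succ]

/-- Copy `k` cells; the `l`-th one from cell `s l` of array `src l` to cell `e l` of array
`dst l`. -/
def Cmd.copy (dst : ℕ → ℕ) (e : ℕ → Term) (src : ℕ → ℕ) (s : ℕ → Term) : ℕ → Cmd
  | 0 => .skip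
  | k + 1 => .seq (Cmd.copy dst e src s k) (.assign (dst k) (e k) (.get (src k) (s k)))

@[simp] theorem Cmd.simple_copy (dst : ℕ → ℕ) (e : ℕ → Term) (src : ℕ → ℕ) (s : ℕ → Term)
    (k : ℕ) : (Cmd.copy dst e src s k).Simple := by
  induction k with
  | zero => trivial
  | succ k ih => exact ⟨ih, trivial⟩

theorem Cmd.writes_copy {dst : ℕ → ℕ} {e : ℕ → Term} {src : ℕ → ℕ} {s : ℕ → Term}
    {k a : ℕ} : (Cmd.copy dst e src s k).Writes a ↔ ∃ l < k, a = dst l := by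
  induction k with
  | zero => simp [Cmd.copy, Cmd.Writes]
  | succ k ih => simp only [Cmd.copy, Cmd.Writes, ih, Nat.lt_succ_iff_lt_or_eq, or_and_right,
      exists_or, exists_eq_left]

/-- Condition `hsd` only excludes reading a cell that is the target of another index; source and
target of the same index may coincide, as when a row is moved onto itself. -/
theorem Cmd.exec_copy (dst : ℕ → ℕ) (e : ℕ → Term) (src : ℕ → ℕ) (s : ℕ → Term) (k : ℕ)
    (m : Store) (ze zs : ℕ → ℤ)
    (he : ∀ m' : Store, (∀ a, (∀ l, a ≠ dst l) → m' a = m a) → ∀ l, ⌊(e l).eval m'⌋ = ze l)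
    (hs : ∀ m' : Store, (∀ a, (∀ l, a ≠ dst l) → m' a = m a) → ∀ l, ⌊(s l).eval m'⌋ = zs l)
    (hd : ∀ l l', l ≠ l' → ¬ (dst l = dst l' ∧ ze l = ze l'))
    (hsd : ∀ l l', l ≠ l' → ¬ (src l = dst l' ∧ zs l = ze l')) :
    (∀ l < k, (Cmd.copy dst e src s k).exec m (dst l) (ze l) = m (src l) (zs l)) ∧
    (∀ a z, (∀ l < k, ¬ (a = dst l ∧ z = ze l)) →
      (Cmd.copy dst e src s k).exec m a z = m a z) := by
  induction k with
  | zero => simp [Cmd.copy, Cmd.exec]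
  | succ k ih =>
    obtain ⟨ih1, ih2⟩ := ih
    have hfr : ∀ a, (∀ l, a ≠ dst l) → (Cmd.copy dst e src s k).exec m a = m a := by
      intro a ha
      funext z
      exact ih2 a z fun l _ h => ha l h.1
    simp only [Cmd.copy, Cmd.exec, Term.eval, he _ hfr, hs _ hfr, Store.write_apply]
    refine ⟨fun l hl => ?_, fun a z h => ?_⟩
    · by_cases hlk : l = k
      · subst hlk
        simp only [and_self, if_true]
        exact ih2 _ _ fun l' hl' => hsd _ _ (by omega)
      · rw [if_neg (hd l k hlk)]
        exact ih1 l (by omega)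
    · rw [if_neg (h k (by omega))]
      exact ih2 _ _ fun l hl => h l (by omega)

end
end RealRAM

/-! ### Calls of the sketch procedures -/

namespace RealRAM

noncomputable section

/-- A bound on the names of the arrays written by a program. -/
def Cmd.bound : Cmd → ℕ
  | .skip => 0
  | .assign a _ _ => a + 1
  | .draw a _ _ => a + 1
  | .seq c c' => max c.bound c'.bound
  | .cond _ _ c c' => max c.bound c'.bound
  | .loop _ _ c => c.bound

theorem Cmd.lt_bound {c : Cmd} {a : ℕ} (h : c.Writes a) : a < c.bound := by
  induction c with
  | skip => exact h.elim
  | assign a' i x => exact Nat.lt_succ_of_le (le_of_eq h)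
  | draw a' i x => exact Nat.lt_succ_of_le (le_of_eq h)
  | seq c c' ih ih' => exact lt_max_iff.2 (h.imp ih ih')
  | cond x y c c' ih ih' => exact lt_max_iff.2 (h.imp ih ih')
  | loop x y c ih => exact ih h

/-- The first array that is used neither for the input nor by the sketch procedures. -/
def _root_.SketchScheme.base (σ : SketchScheme) : ℕ :=
  max 3 (max σ.merge.bound σ.oracle.bound)

theorem three_le_base (σ : SketchScheme) : 3 ≤ σ.base := le_max_left _ _

theorem ne_arr {σ : SketchScheme} {a : ℕ} (ha : a < 3) (t i : ℕ) : a ≠ arr σ.base t i :=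
  ((ha.trans_le (three_le_base σ)).trans_le (le_arr _ _ _)).ne

theorem within_merge (σ : SketchScheme) (L : List ℕ) : σ.merge.Within σ.base L := fun _ h =>
  .inl ((Cmd.lt_bound h).trans_le ((le_max_left _ _).trans (le_max_right _ _)))

theorem within_oracle (σ : SketchScheme) (L : List ℕ) : σ.oracle.Within σ.base L := fun _ h =>
  .inl ((Cmd.lt_bound h).trans_le ((le_max_right _ _).trans (le_max_right _ _)))

theorem Cmd.within_copy {b t k : ℕ} {L : List ℕ} {e s : ℕ → Term} {src : ℕ → ℕ} (ht : t ∈ L) :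
    (Cmd.copy (arr b t) e src s k).Within b L := fun a ha => by
  obtain ⟨l, -, rfl⟩ := Cmd.writes_copy.1 ha
  exact .inr ⟨t, ht, l, rfl⟩

theorem Cmd.within_copy_const {b a k : ℕ} (ha : a < b) {L : List ℕ} {e s : ℕ → Term}
    {src : ℕ → ℕ} : (Cmd.copy (fun _ => a) e src s k).Within b L := fun a' ha' => by
  obtain ⟨l, -, rfl⟩ := Cmd.writes_copy.1 ha'
  exact .inl ha

/-- The cells `z` of the first `k` arrays with tag `t` contain the vector `v`. -/
def Row (b t : ℕ) (m : Store) (z : ℤ) {k : ℕ} (v : Fin k → ℝ) : Prop :=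
  ∀ l : Fin k, m (arr b t l) z = v l

/-- Merge row `x` of the arrays with tag `t'` into row `y` of the arrays with tag `t`, where `x`
and `y` are variables. -/
def mergeCall (σ : SketchScheme) (t y t' x : ℕ) : Cmd :=
  .block [.copy (fun _ => 0) (fun l => .const l) (arr σ.base t) (fun _ => .var σ.base y) σ.size,
    .copy (fun _ => 1) (fun l => .const l) (arr σ.base t') (fun _ => .var σ.base x) σ.size,
    σ.merge,
    .copy (arr σ.base t) (fun _ => .var σ.base y) (fun _ => 2) (fun l => .const l) σ.size]

theorem within_mergeCall (σ : SketchScheme) {t y t' x : ℕ} {L : List ℕ} (ht : t ∈ L) :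
    (mergeCall σ t y t' x).Within σ.base L := by
  have := three_le_base σ
  simp only [mergeCall, Cmd.within_block, List.forall_mem_cons, List.not_mem_nil,
    IsEmpty.forall_iff, implies_true, and_true]
  exact ⟨Cmd.within_copy_const (by omega), Cmd.within_copy_const (by omega), within_merge σ _,
    Cmd.within_copy ht⟩

/-- Copying row `y` of the arrays with tag `t` to the cells `0, 1, …` of an array `a < 3`. -/
theorem copy_to_array (σ : SketchScheme) (a : ℕ) (ha : a < 3) (t y : ℕ) (m : Store) (z : ℤ)
    (hz : m (arr σ.base y 0) 0 = z) {v : Fin σ.size → ℝ} (hv : Row σ.base t m z v) :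
    let m' := (Cmd.copy (fun _ => a) (fun l => .const l) (arr σ.base t)
      (fun _ => .var σ.base y) σ.size).exec m
    m'.Holds a v ∧ ∀ a', a' ≠ a → m' a' = m a' := by
  obtain ⟨h1, h2⟩ := Cmd.exec_copy (fun _ => a) (fun l => .const l) (arr σ.base t)
      (fun _ => .var σ.base y) σ.size m (fun l => l) (fun _ => z)
      (by intros; simp [Term.eval])
      (by
        intro m' hm' l
        rw [Term.eval_var, hm' _ fun _ => (ne_arr ha _ _).symm, hz, Int.floor_intCast])
      (by
        intro l l' hl h
        exact hl (by exact_mod_cast h.2))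
      (fun l l' _ h => ne_arr ha _ _ h.1.symm)
  refine ⟨fun l => (h1 l l.2).trans (hv l), fun a' ha' => ?_⟩
  funext z'
  exact h2 a' z' fun l _ h => ha' h.1

/-- The procedure may spoil any array below `σ.base`, so all lasting data live above, and only
arguments and result pass through arrays `0`, `1`, `2`. The condition `y ≠ t` protects the row index
while the result is copied back. -/
theorem HT.mergeCall {ι : Type} {σ : SketchScheme} {F : Set (Finset ι)}
    {sk : Finset ι → Fin σ.size → ℝ} (hsk : IsSketch σ F sk) (t y t' x : ℕ) (m : Store)
    (zx zy : ℤ) (hx : m (arr σ.base x 0) 0 = zx) (hy : m (arr σ.base y 0) 0 = zy) (hty : y ≠ t)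
    {S S' : Finset ι}
    (hS : Row σ.base t m zy (sk S)) (hS' : Row σ.base t' m zx (sk S'))
    [DecidableEq ι] (hd : Disjoint S S') :
    HT (mergeCall σ t y t' x) m
      (3 * (Cmd.copy (fun _ => 0) (fun l => .const l) (fun _ => 0) (fun _ => .const 0)
        σ.size).cost + σ.time + 5)
      fun m' => Row σ.base t m' zy (sk (S ∪ S')) ∧
        (∀ l z, z ≠ zy → m' (arr σ.base t l) z = m (arr σ.base t l) z) ∧
        Frame σ.base [t] m m' := by
  have hcost : ∀ dst e src s k, (Cmd.copy dst e src s k).cost =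
      (Cmd.copy (fun _ => 0) (fun l => .const l) (fun _ => 0) (fun _ => .const 0) k).cost := by
    intro dst e src s k
    induction k with
    | zero => rfl
    | succ k ih => simp only [Cmd.copy, Cmd.cost, ih]
  have hb := three_le_base σ
  obtain ⟨h1, h1'⟩ := copy_to_array σ 0 (by norm_num) t y m zy hy hS
  set m1 := (Cmd.copy (fun _ => 0) (fun l => .const l) (arr σ.base t)
      (fun _ => .var σ.base y) σ.size).exec m with hm1
  have hx1 : m1 (arr σ.base x 0) 0 = zx := by rw [h1' _ (ne_arr (by norm_num) _ _).symm, hx]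
  have hS1 : Row σ.base t' m1 zx (sk S') := fun l => by
    rw [h1' _ (ne_arr (by norm_num) _ _).symm, hS' l]
  obtain ⟨h2, h2'⟩ := copy_to_array σ 1 (by norm_num) t' x m1 zx hx1 hS1
  set m2 := (Cmd.copy (fun _ => 1) (fun l => .const l) (arr σ.base t')
      (fun _ => .var σ.base x) σ.size).exec m1 with hm2
  have hm2' : ∀ t i, m2 (arr σ.base t i) = m (arr σ.base t i) := fun t i => by
    rw [h2' _ (ne_arr (by norm_num) _ _).symm, h1' _ (ne_arr (by norm_num) _ _).symm]
  have h0 : m2.Holds 0 (sk S) := fun l => by rw [h2' 0 (by norm_num), h1 l]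
  have hmerge : HT σ.merge m2 σ.time fun m' => m'.Holds 2 (sk (S ∪ S')) := by
    refine HT.of_runFor fun s hs => ?_
    have := hsk.merge_spec S S' hd m2 h0 h2 s hs
    -- The union in `IsSketch` is formed with classical decidability, the one here with an arbitrary
    -- instance.
    exact ⟨this.1, by convert this.2⟩
  set K := (Cmd.copy (fun _ => 0) (fun l => .const l) (fun _ => 0) (fun _ => .const 0)
        σ.size).cost
  refine .seq (T := K) (T' := 2 * K + σ.time + 4) ?_ (by ring_nf; omega)
  refine HT.mono (HT.exec (by simp) ?_) (hcost _ _ _ _ _).le fun _ => id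
  rw [← hm1]
  refine .seq (T := K) (T' := K + σ.time + 3) ?_ (by ring_nf; omega)
  refine HT.mono (HT.exec (by simp) ?_) (hcost _ _ _ _ _).le fun _ => id
  rw [← hm2]
  refine .seq (T := σ.time) (T' := K + 2) ?_ (by ring_nf; omega)
  refine (hmerge.within (within_merge σ [])).mono le_rfl ?_
  rintro m3 ⟨h3, h3'⟩
  have hm3 : ∀ t i, m3 (arr σ.base t i) = m (arr σ.base t i) := fun t i => by
    rw [h3' t i (by simp), hm2']
  refine .seq (T := K) (T' := 1) ?_ (by ring_nf; omega)
  refine HT.mono (HT.exec (by simp) ?_) (hcost _ _ _ _ _).le fun _ => id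
  obtain ⟨h4, h4'⟩ := Cmd.exec_copy (arr σ.base t) (fun _ => .var σ.base y) (fun _ => 2)
      (fun l => .const l) σ.size m3 (fun _ => zy) (fun l => l)
      (by
        intro m' hm' l
        rw [Term.eval_var, hm' _ (by simp [hty]), hm3, hy, Int.floor_intCast])
      (by intros; simp [Term.eval])
      (by
        intro l l' hl h
        exact hl (by simpa using h.1))
      (fun l l' _ h => ne_arr (by norm_num) _ _ h.1)
  refine .skip ⟨fun l => (h4 l l.2).trans (h3 l), fun l z hz => ?_, fun t'' i ht'' => ?_⟩
  · rw [h4' _ _ fun _ _ h => hz h.2, hm3]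
  · funext z
    rw [h4', hm3]
    rintro l - ⟨h, -⟩
    rw [arr_inj] at h
    simp [h.1] at ht''

/-- Call the oracle with row `y` of the arrays with tag `t`. -/
def oracleCall (σ : SketchScheme) (t y : ℕ) : Cmd :=
  .seq (.copy (fun _ => 0) (fun l => .const l) (arr σ.base t) (fun _ => .var σ.base y) σ.size)
    σ.oracle

theorem within_oracleCall (σ : SketchScheme) {t y : ℕ} {L : List ℕ} :
    (oracleCall σ t y).Within σ.base L := by
  have := three_le_base σ
  simp only [oracleCall, Cmd.within_seq]
  exact ⟨Cmd.within_copy_const (by omega), within_oracle σ _⟩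

open Classical in
theorem HT.oracleCall {ι : Type} {σ : SketchScheme} {F : Set (Finset ι)}
    {sk : Finset ι → Fin σ.size → ℝ} (hsk : IsSketch σ F sk) (t y : ℕ) (m : Store)
    (zy : ℤ) (hy : m (arr σ.base y 0) 0 = zy) {S : Finset ι}
    (hS : Row σ.base t m zy (sk S)) :
    HT (oracleCall σ t y) m ((Cmd.copy (fun _ => 0) (fun l => .const l) (arr σ.base t)
      (fun _ => .var σ.base y) σ.size).cost + σ.time + 1)
      fun m' => (m' 1 0 = if S ∈ F then 1 else 0) ∧ Frame σ.base [] m m' := by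
  obtain ⟨h1, h1'⟩ := copy_to_array σ 0 (by norm_num) t y m zy hy hS
  refine .seq (HT.exec (by simp) ?_) le_rfl
  refine ((HT.of_runFor (P := fun m' => m' 1 0 = if S ∈ F then 1 else 0)
    fun s hs => hsk.oracle_spec S _ h1 s hs).within
    (within_oracle σ [])).mono le_rfl ?_
  rintro m' ⟨h, h'⟩
  exact ⟨h, fun t i ht => (h' t i ht).trans (h1' _ (ne_arr (by norm_num) _ _).symm)⟩

end
end RealRAM

/-! ### Grid codes -/

/-- An integer combination of powers of `M` with small coefficients vanishes only trivially. -/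
theorem eq_zero_of_sum_mul_pow_eq_zero {M : ℤ} {c : ℕ → ℤ} {n : ℕ} (hc : ∀ k < n, |c k| < M)
    (h : ∑ k ∈ Finset.range n, c k * M ^ k = 0) : ∀ k < n, c k = 0 := by
  induction n generalizing c with
  | zero => simp
  | succ n ih =>
    have hM : 0 < M := (abs_nonneg _).trans_lt (hc 0 (by omega))
    rw [Finset.sum_range_succ'] at h
    have h1 : ∑ k ∈ Finset.range n, c (k + 1) * M ^ (k + 1) =
        M * ∑ k ∈ Finset.range n, c (k + 1) * M ^ k := by
      rw [Finset.mul_sum]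
      exact Finset.sum_congr rfl fun k _ => by ring
    rw [h1] at h
    -- Modulo `M` only the constant coefficient survives, and it is smaller than `M` in absolute
    -- value.
    have h0 : c 0 = 0 := Int.eq_zero_of_abs_lt_dvd
      (m := M) ⟨-∑ k ∈ Finset.range n, c (k + 1) * M ^ k, by linarith⟩ (hc 0 (by omega))
    rw [h0] at h
    have h2 : ∑ k ∈ Finset.range n, c (k + 1) * M ^ k = 0 := by
      have : M * ∑ k ∈ Finset.range n, c (k + 1) * M ^ k = 0 := by linarith
      exact (mul_eq_zero.1 this).resolve_left hM.ne'
    intro k hk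
    cases k with
    | zero => exact h0
    | succ k => exact ih (fun k hk => hc (k + 1) (by omega)) h2 k (by omega)

section Grid

variable (d m : ℕ) (X : ℕ → ℕ → ℝ) (s T : ℝ)

/-- The coordinates of the grid cell of side `s` that contains the point `X j`. -/
noncomputable def gridCoord (j k : ℕ) : ℤ := ⌊X j k / s⌋

/-- The largest absolute value of a coordinate of an offset of length at most `T`. -/
noncomputable def gridRadius : ℕ := ⌊T / s⌋₊

/-- The number of offsets in one coordinate. -/
noncomputable def gridWidth : ℕ := 2 * gridRadius s T + 1

/-- The base of the encoding of grid cells by integers. -/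
noncomputable def gridBase : ℤ :=
  4 * (∑ j ∈ Finset.range m, ∑ k ∈ Finset.range d, gridCoord X s j k * gridCoord X s j k)
    + 2 * gridRadius s T + 1

/-- The code of the grid cell of the point `X j`. -/
noncomputable def gridCode (j : ℕ) : ℤ :=
  ∑ k ∈ Finset.range d, gridCoord X s j k * gridBase d m X s T ^ k

/-- The coordinates of the `t`-th offset. -/
noncomputable def offsetCoord (t k : ℕ) : ℤ :=
  (t / gridWidth s T ^ k : ℕ) - gridWidth s T * (t / gridWidth s T ^ (k + 1) : ℕ) -
    gridRadius s T

open Classical in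
/-- The code of the `t`-th offset; it is `0` for offsets longer than `T`. -/
noncomputable def offsetCode (t : ℕ) : ℤ :=
  if ((∑ k ∈ Finset.range d, offsetCoord s T t k * offsetCoord s T t k : ℤ) : ℝ) * (s * s) ≤ T * T
  then ∑ k ∈ Finset.range d, offsetCoord s T t k * gridBase d m X s T ^ k else 0

variable {d m X s T}

theorem abs_gridCoord_le {j k : ℕ} (hj : j < m) (hk : k < d) :
    |gridCoord X s j k| ≤
      ∑ j ∈ Finset.range m, ∑ k ∈ Finset.range d, gridCoord X s j k * gridCoord X s j k := by
  have h0 : ∀ j k, 0 ≤ gridCoord X s j k * gridCoord X s j k := fun j k => mul_self_nonneg _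
  -- An integer is bounded in absolute value by its square, so a sum of squares gives a common bound
  -- without computing a maximum.
  calc |gridCoord X s j k| ≤ gridCoord X s j k * gridCoord X s j k := by
        rw [← abs_mul_abs_self]
        rcases (abs_nonneg (gridCoord X s j k)).eq_or_lt with h | h
        · simp [← h]
        · nlinarith
    _ ≤ ∑ k ∈ Finset.range d, gridCoord X s j k * gridCoord X s j k :=
        Finset.single_le_sum (f := fun k => gridCoord X s j k * gridCoord X s j k)
          (fun k _ => h0 j k) (Finset.mem_range.2 hk)
    _ ≤ _ := Finset.single_le_sum
          (f := fun j => ∑ k ∈ Finset.range d, gridCoord X s j k * gridCoord X s j k)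
          (fun j _ => Finset.sum_nonneg fun k _ => h0 j k) (Finset.mem_range.2 hj)

/-- The definition uses only floors of quotients, as the machine must; it amounts to a digit of `t`
in base `gridWidth`, centred at zero. -/
theorem offsetCoord_eq (t k : ℕ) :
    offsetCoord s T t k = (t / gridWidth s T ^ k % gridWidth s T : ℕ) - gridRadius s T := by
  unfold offsetCoord
  have h := Nat.div_add_mod (t / gridWidth s T ^ k) (gridWidth s T)
  rw [Nat.div_div_eq_div_mul, ← pow_succ] at h
  have h' : (gridWidth s T : ℤ) * (t / gridWidth s T ^ (k + 1) : ℕ) +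
      (t / gridWidth s T ^ k % gridWidth s T : ℕ) = (t / gridWidth s T ^ k : ℕ) := by
    exact_mod_cast h
  linarith

theorem abs_offsetCoord_le (t k : ℕ) : |offsetCoord s T t k| ≤ gridRadius s T := by
  have h : t / gridWidth s T ^ k % gridWidth s T < gridWidth s T :=
    Nat.mod_lt _ (by unfold gridWidth; omega)
  rw [offsetCoord_eq, abs_le]
  unfold gridWidth at h ⊢
  constructor <;> omega

theorem exists_offsetCoord_eq (o : ℕ → ℤ) (ho : ∀ k < d, |o k| ≤ gridRadius s T) :
    ∃ t < gridWidth s T ^ d, ∀ k < d, offsetCoord s T t k = o k := by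
  have hlt : ∀ k < d, (o k + gridRadius s T).toNat < gridWidth s T := by
    intro k hk
    have := abs_le.1 (ho k hk)
    unfold gridWidth
    omega
  let f : Fin d → Fin (gridWidth s T) := fun k => ⟨(o k + gridRadius s T).toNat, hlt k k.2⟩
  refine ⟨finFunctionFinEquiv f, (finFunctionFinEquiv f).2, fun k hk => ?_⟩
  rw [offsetCoord_eq]
  have h1 := finFunctionFinEquiv_symm_apply_val (finFunctionFinEquiv f) ⟨k, hk⟩
  rw [Equiv.symm_apply_apply] at h1
  rw [← h1]
  have := abs_le.1 (ho k hk)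
  simp only [f]
  omega

/-- The base exceeds every possible value of a coordinate difference minus an offset coordinate, so
equality of codes forces equality coordinate by coordinate. Geometric adjacency of cells thus
becomes one integer equation per offset. -/
theorem gridCode_adj_iff (hs : 0 < s) (hT : 0 ≤ T) {i j : ℕ} (hi : i < m) (hj : j < m) :
    (∃ t < gridWidth s T ^ d, gridCode d m X s T j = gridCode d m X s T i + offsetCode d m X s T t)
      ↔ ((∑ k ∈ Finset.range d, (gridCoord X s j k - gridCoord X s i k) ^ 2 : ℤ) : ℝ) * s ^ 2
        ≤ T ^ 2 := by
  have key : ∀ o : ℕ → ℤ, (∀ k < d, |o k| ≤ gridRadius s T) →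
      gridCode d m X s T j = gridCode d m X s T i +
        ∑ k ∈ Finset.range d, o k * gridBase d m X s T ^ k →
      ∀ k < d, gridCoord X s j k - gridCoord X s i k = o k := by
    intro o ho h k hk
    have := eq_zero_of_sum_mul_pow_eq_zero (M := gridBase d m X s T) (n := d)
      (c := fun k => gridCoord X s j k - gridCoord X s i k - o k) (fun k hk => ?_) ?_ k hk
    · linarith
    · have h1 := abs_le.1 (abs_gridCoord_le (X := X) (s := s) hi hk)
      have h2 := abs_le.1 (abs_gridCoord_le (X := X) (s := s) hj hk)
      have h3 := abs_le.1 (ho k hk)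
      rw [abs_lt]
      unfold gridBase
      constructor <;> linarith
    · simp only [sub_mul, Finset.sum_sub_distrib]
      simp only [gridCode] at h
      linarith
  constructor
  · rintro ⟨t, ht, h⟩
    unfold offsetCode at h
    split_ifs at h with hc
    · have := key _ (fun k _ => abs_offsetCoord_le t k) h
      rw [Finset.sum_congr rfl fun k hk => by rw [this k (Finset.mem_range.1 hk)]]
      simpa only [sq] using hc
    -- An offset that is too long has code `0`; the two points then share a cell, and the distance
    -- of a cell to itself is zero.
    · have := key (fun _ => 0) (by simp) (by simpa using h)
      rw [Finset.sum_congr rfl fun k hk => by rw [this k (Finset.mem_range.1 hk)]]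
      simpa using sq_nonneg T
  · intro h
    obtain ⟨t, ht, hto⟩ := exists_offsetCoord_eq (d := d) (s := s) (T := T)
      (fun k => gridCoord X s j k - gridCoord X s i k) (by
        intro k hk
        have h1 : ((gridCoord X s j k - gridCoord X s i k) ^ 2 : ℤ) ≤
            ∑ k ∈ Finset.range d, (gridCoord X s j k - gridCoord X s i k) ^ 2 :=
          Finset.single_le_sum (f := fun k => (gridCoord X s j k - gridCoord X s i k) ^ 2)
            (fun k _ => sq_nonneg _) (Finset.mem_range.2 hk)
        have h2 : (((gridCoord X s j k - gridCoord X s i k) ^ 2 : ℤ) : ℝ) * s ^ 2 ≤ T ^ 2 :=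
          le_trans (by gcongr) h
        push_cast at h2
        rw [← mul_pow] at h2
        have h3 := abs_le_of_sq_le_sq h2 hT
        have h4 : |((gridCoord X s j k - gridCoord X s i k : ℤ) : ℝ)| ≤ T / s := by
          rw [le_div_iff₀ hs]
          rw [abs_mul, abs_of_pos hs] at h3
          push_cast
          exact h3
        have h5 : (|gridCoord X s j k - gridCoord X s i k| : ℤ) ≤ ⌊T / s⌋ :=
          Int.le_floor.2 (by push_cast; push_cast at h4; exact h4)
        unfold gridRadius
        rwa [Int.natCast_floor_eq_floor (div_nonneg hT hs.le)])
    refine ⟨t, ht, ?_⟩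
    have hc : ((∑ k ∈ Finset.range d, offsetCoord s T t k * offsetCoord s T t k : ℤ) : ℝ) *
        (s * s) ≤ T * T := by
      rw [Finset.sum_congr rfl fun k hk => by rw [hto k (Finset.mem_range.1 hk)]]
      simpa only [sq] using h
    rw [offsetCode, if_pos hc, Finset.sum_congr rfl fun k hk => by
      rw [hto k (Finset.mem_range.1 hk)]]
    simp only [sub_mul, Finset.sum_sub_distrib, gridCode]
    ring

end Grid

namespace RealRAM

noncomputable section

/-! ### The program that computes grid codes

Tags of the working arrays: `2` number of points, `6` length `T`, `7` side `s`, `8` loop counter,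
`10` base, `11` width, `12` number of offsets, `16` radius; `30` codes of the points, `31` codes of
the offsets, `32` table from codes to points, `40` coordinates of the points. -/

variable (b d : ℕ)

/-- The `k`-th grid coordinate of the current point. -/
def coordTerm (k : ℕ) : Term := .floor (.div (.get (arr b 40 k) (.var b 8)) (.var b 7))

/-- The `k`-th coordinate of the current offset. -/
def offsetTerm (k : ℕ) : Term :=
  .sub (.sub (.floor (.div (.var b 8) (.pow (.var b 11) k)))
    (.mul (.var b 11) (.floor (.div (.var b 8) (.pow (.var b 11) (k + 1)))))) (.var b 16)

def gridPrelude : Cmd := .block [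
  .set b 16 (.floor (.div (.var b 6) (.var b 7))),
  .set b 11 (.add (.mul (.const 2) (.var b 16)) (.const 1)),
  .set b 12 (.pow (.var b 11) d),
  .set b 10 (.const 0)]

def gridBaseCmd : Cmd :=
  .for b 8 (.var b 2) (.set b 10 (.add (.var b 10)
    (.sum (fun k => .mul (coordTerm b k) (coordTerm b k)) d)))

def gridBaseEnd : Cmd :=
  .set b 10 (.add (.add (.mul (.const 4) (.var b 10)) (.mul (.const 2) (.var b 16))) (.const 1))

def offsetCmd : Cmd :=
  .for b 8 (.var b 12)
    (.cond (.mul (.sum (fun k => .mul (offsetTerm b k) (offsetTerm b k)) d)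
        (.mul (.var b 7) (.var b 7))) (.mul (.var b 6) (.var b 6))
      (.assign (arr b 31 0) (.var b 8)
        (.sum (fun k => .mul (offsetTerm b k) (.pow (.var b 10) k)) d))
      (.assign (arr b 31 0) (.var b 8) (.const 0)))

def codeCmd : Cmd :=
  .for b 8 (.var b 2) (.assign (arr b 30 0) (.var b 8)
    (.sum (fun k => .mul (coordTerm b k) (.pow (.var b 10) k)) d))

def dictCmd : Cmd :=
  .for b 8 (.var b 2) (.assign (arr b 32 0) (.get (arr b 30 0) (.var b 8)) (.var b 8))

/-- Compute the codes of the points and of the offsets, and the table from codes to points. -/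
def gridCmd : Cmd :=
  .block [gridPrelude b d, gridBaseCmd b d, gridBaseEnd b, offsetCmd b d, codeCmd b d, dictCmd b]

theorem within_gridCmd : (gridCmd b d).Within b [8, 10, 11, 12, 16, 30, 31, 32] := by
  simp [gridCmd, gridPrelude, gridBaseCmd, gridBaseEnd, offsetCmd, codeCmd, dictCmd]

/-- The memory holds codes of `n` points and `cnt` offsets, and a table from codes to points. -/
structure GridMem (m : Store) (n cnt : ℕ) (code off : ℕ → ℤ) : Prop where
  count : m (arr b 12 0) 0 = cnt
  codes : ∀ j < n, m (arr b 30 0) j = code j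
  offs : ∀ t < cnt, m (arr b 31 0) t = off t
  dict : ∀ j < n, ∃ r < n, code r = code j ∧ m (arr b 32 0) (code j) = r

variable {b d}

theorem GridMem.congr {L : List ℕ} {m m' : Store} {n cnt : ℕ} {code off : ℕ → ℤ}
    (h : GridMem b m n cnt code off) (hf : Frame b L m m') (h12 : 12 ∉ L) (h30 : 30 ∉ L)
    (h31 : 31 ∉ L) (h32 : 32 ∉ L) : GridMem b m' n cnt code off := by
  obtain ⟨h1, h2, h3, h4⟩ := h
  rw [← hf _ _ h12] at h1
  rw [← hf _ _ h30] at h2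
  rw [← hf _ _ h31] at h3
  rw [← hf _ _ h32] at h4
  exact ⟨h1, h2, h3, h4⟩

theorem floor_natCast_div_pow (a B k : ℕ) : ⌊(a : ℝ) / (B : ℝ) ^ k⌋ = ((a / B ^ k : ℕ) : ℤ) := by
  rw [← Nat.cast_pow, ← Int.natCast_floor_eq_floor (by positivity), Nat.floor_div_natCast,
    Nat.floor_natCast]

theorem HT.gridBaseCmd {X : ℕ → ℕ → ℝ} {s : ℝ} {n : ℕ} (m : Store)
    (hn : m (arr b 2 0) 0 = n) (hs : m (arr b 7 0) 0 = s) (h0 : m (arr b 10 0) 0 = 0)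
    (hX : ∀ j < n, ∀ k < d, m (arr b 40 k) j = X j k) :
    HT (gridBaseCmd b d) m ((1 + 6) * (n + 1)) fun m' => m' (arr b 10 0) 0 =
      ((∑ j ∈ Finset.range n, ∑ k ∈ Finset.range d, gridCoord X s j k * gridCoord X s j k : ℤ) :
        ℝ) := by
  refine HT.for (L := [10]) (by simp) (by simp) (n := n) (fun j m' => m' (arr b 10 0) 0 =
      ((∑ j ∈ Finset.range j, ∑ k ∈ Finset.range d, gridCoord X s j k * gridCoord X s j k : ℤ) :
        ℝ)) ?_ ?_ ?_ ?_
  · intro m' hf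
    rw [Term.eval_var, hf _ _ (by simp), hn]
  · simp [Store.write_apply, h0]
  · intro j hj m' hf hv hI
    refine .set ?_
    have : ∀ k < d, (coordTerm b k).eval m' = gridCoord X s j k := by
      intro k hk
      simp only [coordTerm, Term.eval, Term.eval_var, hv, Int.floor_natCast]
      rw [hf _ _ (by simp), hf _ _ (by simp), hX j hj k hk, hs]
      rfl
    simp only [Store.write_apply, Term.eval, Term.eval_var, Term.eval_sum, arr_inj]
    norm_num
    rw [hI, Finset.sum_range_succ]
    push_cast
    congr 1
    refine Finset.sum_congr rfl fun k hk => ?_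
    rw [this k (Finset.mem_range.1 hk)]
  · intro m' _ _ h
    exact h

theorem HT.offsetCmd {X : ℕ → ℕ → ℝ} {s T : ℝ} {n : ℕ} (m : Store)
    (hc : m (arr b 12 0) 0 = (gridWidth s T ^ d : ℕ)) (hs : m (arr b 7 0) 0 = s)
    (hT : m (arr b 6 0) 0 = T)
    (hM : m (arr b 10 0) 0 = gridBase d n X s T) (hB : m (arr b 11 0) 0 = gridWidth s T)
    (hK : m (arr b 16 0) 0 = gridRadius s T) :
    HT (offsetCmd b d) m ((2 + 6) * (gridWidth s T ^ d + 1)) fun m' =>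
      ∀ t < gridWidth s T ^ d, m' (arr b 31 0) t = offsetCode d n X s T t := by
  refine HT.for (L := [31]) (by simp) (by simp) (n := gridWidth s T ^ d)
    (fun j m' => ∀ t < j, m' (arr b 31 0) t = offsetCode d n X s T t) ?_ ?_ ?_ ?_
  · intro m' hf
    rw [Term.eval_var, hf _ _ (by simp), hc]
  · simp
  · intro j hj m' hf hv hI
    have ho : ∀ k, (offsetTerm b k).eval m' = offsetCoord s T j k := by
      intro k
      simp only [offsetTerm, Term.eval, Term.eval_var, Term.eval_pow, hv]
      rw [hf _ _ (by simp), hf _ _ (by simp), hB, hK, floor_natCast_div_pow,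
        floor_natCast_div_pow, offsetCoord]
      push_cast
      rfl
    have e6 : m' (arr b 6 0) 0 = T := by rw [hf _ _ (by simp), hT]
    have e7 : m' (arr b 7 0) 0 = s := by rw [hf _ _ (by simp), hs]
    have e10 : m' (arr b 10 0) 0 = gridBase d n X s T := by rw [hf _ _ (by simp), hM]
    refine .cond (T := 1) (fun h => .assign fun t ht => ?_) (fun h => .assign fun t ht => ?_) le_rfl
    all_goals
      simp only [Term.eval, Term.eval_var, Term.eval_sum, ho, e6, e7] at h
      simp only [Store.write_apply, arr_inj, Term.eval, Term.eval_var, hv, Int.floor_natCast,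
        Term.eval_sum, Term.eval_pow, ho, e10]
      norm_num
      split_ifs with htj
    · subst htj
      rw [offsetCode, if_pos (by push_cast; exact h)]
      push_cast
      rfl
    · exact hI t (by omega)
    · subst htj
      rw [offsetCode, if_neg (by push_cast; exact h)]
      simp
    · exact hI t (by omega)
  · intro m' _ _ h
    exact h

theorem HT.codeCmd {X : ℕ → ℕ → ℝ} {s T : ℝ} {n : ℕ} (m : Store)
    (hn : m (arr b 2 0) 0 = n) (hs : m (arr b 7 0) 0 = s)
    (hM : m (arr b 10 0) 0 = gridBase d n X s T)
    (hX : ∀ j < n, ∀ k < d, m (arr b 40 k) j = X j k) :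
    HT (codeCmd b d) m ((1 + 6) * (n + 1)) fun m' =>
      ∀ j < n, m' (arr b 30 0) j = gridCode d n X s T j := by
  refine HT.for (L := [30]) (by simp) (by simp) (n := n)
    (fun j m' => ∀ t < j, m' (arr b 30 0) t = gridCode d n X s T t) ?_ ?_ ?_ ?_
  · intro m' hf
    rw [Term.eval_var, hf _ _ (by simp), hn]
  · simp
  · intro j hj m' hf hv hI
    have ho : ∀ k < d, (coordTerm b k).eval m' = gridCoord X s j k := by
      intro k hk
      simp only [coordTerm, Term.eval, Term.eval_var, hv, Int.floor_natCast]
      rw [hf _ _ (by simp), hf _ _ (by simp), hX j hj k hk, hs]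
      rfl
    have e10 : m' (arr b 10 0) 0 = gridBase d n X s T := by rw [hf _ _ (by simp), hM]
    refine .assign fun t ht => ?_
    simp only [Store.write_apply, arr_inj, Term.eval, Term.eval_var, hv, Int.floor_natCast,
      Term.eval_sum, Term.eval_pow, e10]
    norm_num
    split_ifs with htj
    · subst htj
      rw [gridCode]
      push_cast
      refine Finset.sum_congr rfl fun k hk => ?_
      rw [ho k (Finset.mem_range.1 hk)]
    · exact hI t (by omega)
  · intro m' _ _ h
    exact h

/-- Later points overwrite earlier ones in the same cell; the surviving entry becomes the
representative of that cell. -/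
theorem HT.dictCmd {n : ℕ} (m : Store) {code : ℕ → ℤ}
    (hn : m (arr b 2 0) 0 = n) (hcode : ∀ j < n, m (arr b 30 0) j = code j) :
    HT (dictCmd b) m ((1 + 6) * (n + 1)) fun m' =>
      ∀ j < n, ∃ r < n, code r = code j ∧ m' (arr b 32 0) (code j) = r := by
  refine HT.for (L := [32]) (by simp) (by simp) (n := n)
    (fun j m' => ∀ t < j, ∃ r < n, code r = code t ∧ m' (arr b 32 0) (code t) = r) ?_ ?_ ?_ ?_
  · intro m' hf
    rw [Term.eval_var, hf _ _ (by simp), hn]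
  · simp
  · intro j hj m' hf hv hI
    refine .assign fun t ht => ?_
    have e30 : m' (arr b 30 0) j = code j := by rw [hf _ _ (by simp), hcode j hj]
    simp only [Store.write_apply, arr_inj, Term.eval, Term.eval_var, hv, Int.floor_natCast, e30,
      Int.floor_intCast]
    norm_num
    by_cases htj : code t = code j
    · exact ⟨j, hj, htj.symm, by simp [htj]⟩
    · simp only [htj, if_false]
      exact hI t (by
        rcases Nat.lt_succ_iff_lt_or_eq.1 ht with h | rfl
        · exact h
        · exact absurd rfl htj)
  · intro m' _ _ h
    exact h

theorem HT.gridCmd {X : ℕ → ℕ → ℝ} {s T : ℝ} {n : ℕ} (m : Store) (hs0 : 0 < s) (hT0 : 0 ≤ T)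
    (hn : m (arr b 2 0) 0 = n) (hs : m (arr b 7 0) 0 = s) (hT : m (arr b 6 0) 0 = T)
    (hX : ∀ j < n, ∀ k < d, m (arr b 40 k) j = X j k) :
    HT (gridCmd b d) m (50 * (n + 1) * (gridWidth s T ^ d + 1)) fun m' =>
      GridMem b m' n (gridWidth s T ^ d) (gridCode d n X s T) (offsetCode d n X s T) := by
  set W := gridWidth s T ^ d with hW
  refine .seq (T := 9) (T' := 1 + (21 * (n + 1) + 8 * (W + 1) + 6)) ?_
    (by ring_nf; nlinarith [Nat.zero_le (n * W)])
  have hfloor : (⌊T / s⌋ : ℝ) = gridRadius s T := by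
    rw [gridRadius, natCast_floor_eq_intCast_floor (div_nonneg hT0 hs0.le)]
  refine HT.mono (HT.within (b := b) (L := [10, 11, 12, 16]) (by simp [gridPrelude])
    (HT.exec (c := gridPrelude b d) (by simp [gridPrelude])
      (Q := fun m1 => m1 (arr b 16 0) 0 = gridRadius s T ∧ m1 (arr b 11 0) 0 = gridWidth s T ∧
        m1 (arr b 12 0) 0 = W ∧ m1 (arr b 10 0) 0 = 0) ?_))
    (by simp [gridPrelude, Cmd.block, Cmd.cost, Cmd.set]) ?_
  · simp [gridPrelude, Cmd.block, Cmd.exec, Store.write_apply, Term.eval, hs, hT, hfloor,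
      gridWidth, hW]
  rintro m1 ⟨⟨hK, hB, hC, h0⟩, f1⟩
  refine .seq (T := 7 * (n + 1)) (T' := 1 + (14 * (n + 1) + 8 * (W + 1) + 5)) ?_
    (by ring_nf; omega)
  refine HT.mono (HT.within (b := b) (L := [8, 10]) (by simp [RealRAM.gridBaseCmd]) (HT.gridBaseCmd m1
    (by rw [f1 _ _ (by simp), hn]) (by rw [f1 _ _ (by simp), hs]) h0 (X := X) (fun j hj k hk => by
      rw [f1 _ _ (by simp), hX j hj k hk]))) (by omega) ?_
  rintro m2 ⟨h10, f2⟩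
  refine .seq (T := 1) (T' := 14 * (n + 1) + 8 * (W + 1) + 4) ?_ (by ring_nf; omega)
  refine HT.mono (HT.within (b := b) (L := [10]) (by simp [gridBaseEnd]) (HT.set
    (Q := fun m3 => m3 (arr b 10 0) 0 = gridBase d n X s T) ?_)) le_rfl ?_
  · simp only [Store.write_apply, Term.eval, Term.eval_var, h10, f2 16 0 (by simp), hK]
    simp [gridBase]
  rintro m3 ⟨hM, f3⟩
  have f13 : Frame b [8, 10, 11, 12, 16] m m3 :=
    ((f1.mono (by simp)).trans (f2.mono (by simp))).trans (f3.mono (by simp))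
  have f23 : Frame b [8, 10] m1 m3 := f2.trans (f3.mono (by simp))
  refine .seq (T := 8 * (W + 1)) (T' := 14 * (n + 1) + 3) ?_ (by ring_nf; omega)
  refine HT.mono (HT.within (b := b) (L := [8, 31]) (by simp [RealRAM.offsetCmd]) (HT.offsetCmd m3
    (by rw [f23 _ _ (by simp), hC]) (by rw [f13 _ _ (by simp), hs])
    (by rw [f13 _ _ (by simp), hT]) hM (by rw [f23 _ _ (by simp), hB])
    (by rw [f23 _ _ (by simp), hK]))) (by omega) ?_
  rintro m4 ⟨hO, f4⟩
  have f14 : Frame b [8, 10, 11, 12, 16, 31] m m4 := (f13.mono (by simp)).trans (f4.mono (by simp))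
  refine .seq (T := 7 * (n + 1)) (T' := 7 * (n + 1) + 2) ?_ (by ring_nf; omega)
  refine HT.mono (HT.within (b := b) (L := [8, 30]) (by simp [RealRAM.codeCmd]) (HT.codeCmd m4
    (by rw [f14 _ _ (by simp), hn]) (by rw [f14 _ _ (by simp), hs])
    (by rw [f4 _ _ (by simp), hM]) (fun j hj k hk => by
      rw [f14 _ _ (by simp), hX j hj k hk]))) (by omega) ?_
  rintro m5 ⟨hcode, f5⟩
  refine .seq (T := 7 * (n + 1)) (T' := 1) ?_ (by ring_nf; omega)
  refine HT.mono (HT.within (b := b) (L := [8, 32]) (by simp [RealRAM.dictCmd]) (HT.dictCmd m5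
    (by rw [f5 _ _ (by simp), f14 _ _ (by simp), hn]) hcode)) (by omega) ?_
  rintro m6 ⟨hdict, f6⟩
  refine .skip ⟨?_, ?_, ?_, hdict⟩
  · rw [f6 _ _ (by simp), f5 _ _ (by simp), f4 _ _ (by simp), f23 _ _ (by simp), hC]
  · intro j hj
    rw [f6 _ _ (by simp), hcode j hj]
  · intro t ht
    rw [f6 _ _ (by simp), f5 _ _ (by simp), hO t ht]

end
end RealRAM

/-! ### Breadth-first search -/

/-- Two points below `n` are adjacent if their codes differ by one of the first `cnt` offsets. -/
def CodeAdj (n cnt : ℕ) (code off : ℕ → ℤ) (i j : ℕ) : Prop :=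
  i < n ∧ j < n ∧ ∃ t < cnt, code j = code i + off t

/-- State of a breadth-first search: `qu` lists the `tl` points visited so far, those before `h`
have been processed, `lab` contains the labels (`-1` for points not visited), and all points
before `ap` have a visited representative. -/
structure BFSInv (adj : ℕ → ℕ → Prop) (rep : ℕ → ℕ) (n : ℕ) (qu : ℕ → ℕ) (lab : ℕ → ℤ)
    (h tl ap : ℕ) : Prop where
  hle : h ≤ tl
  aple : ap ≤ n
  qlt : ∀ i < tl, qu i < n
  qrep : ∀ i < tl, rep (qu i) = qu i
  qinj : ∀ i < tl, ∀ j < tl, qu i = qu j → i = j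
  qvis : ∀ i < tl, lab (qu i) ≠ -1
  vis : ∀ j < n, lab j ≠ -1 → ∃ i < tl, qu i = j
  conn : ∀ j < n, lab j ≠ -1 → ∃ r < n, lab j = (r : ℕ) ∧ Relation.EqvGen adj r j
  clos : ∀ i < h, ∀ j, adj (qu i) j → lab (rep j) = lab (qu i)
  unif : ∀ i j, h ≤ i → i < tl → h ≤ j → j < tl → lab (qu i) = lab (qu j)
  scan : ∀ j < ap, lab (rep j) ≠ -1

namespace BFSInv

variable {adj : ℕ → ℕ → Prop} {rep : ℕ → ℕ} {n : ℕ} {qu : ℕ → ℕ} {lab : ℕ → ℤ} {h tl ap : ℕ}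

theorem tl_le (H : BFSInv adj rep n qu lab h tl ap) : tl ≤ n := by
  have := Finset.card_le_card_of_injOn (s := Finset.range tl) (t := Finset.range n) qu
    (fun i hi => by simpa using H.qlt i (by simpa using hi))
    (fun i hi j hj hij => H.qinj i (by simpa using hi) j (by simpa using hj) hij)
  simpa using this

/-- A new point must carry the label common to all waiting points, which keeps the queue uniform.
With an empty queue the condition is vacuous, and a new component may start. -/
theorem visit (H : BFSInv adj rep n qu lab h tl ap) {v r : ℕ} (hv : v < n) (hrv : rep v = v)
    (hlab : lab v = -1) (hr : r < n) (hc : Relation.EqvGen adj r v)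
    (hu : ∀ i, h ≤ i → i < tl → lab (qu i) = r) :
    BFSInv adj rep n (Function.update qu tl v) (Function.update lab v r) h (tl + 1) ap := by
  have hq : ∀ i < tl, Function.update qu tl v i = qu i := fun i hi =>
    Function.update_of_ne hi.ne _ _
  have hne : ∀ i < tl, qu i ≠ v := fun i hi h => H.qvis i hi (h ▸ hlab)
  have hl : ∀ j, lab j ≠ -1 → Function.update lab v (r : ℤ) j = lab j := fun j hj =>
    Function.update_of_ne (fun h => hj (by rw [h, hlab])) _ _
  have hcases : ∀ i, i < tl + 1 → i < tl ∨ i = tl := fun i hi => by omega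
  refine ⟨H.hle.trans (Nat.le_succ _), H.aple, ?_, ?_, ?_, ?_, ?_, ?_, ?_, ?_, ?_⟩
  · intro i hi
    rcases hcases i hi with hi | rfl
    · rw [hq i hi]; exact H.qlt i hi
    · simpa using hv
  · intro i hi
    rcases hcases i hi with hi | rfl
    · rw [hq i hi]; exact H.qrep i hi
    · simpa using hrv
  · intro i hi j hj hij
    rcases hcases i hi with hi | rfl <;> rcases hcases j hj with hj | rfl
    · rw [hq i hi, hq j hj] at hij
      exact H.qinj i hi j hj hij
    · rw [hq i hi, Function.update_self] at hij
      exact absurd hij (hne i hi)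
    · rw [hq j hj, Function.update_self] at hij
      exact absurd hij.symm (hne j hj)
    · rfl
  · intro i hi
    rcases hcases i hi with hi | rfl
    · rw [hq i hi, hl _ (H.qvis i hi)]; exact H.qvis i hi
    · simp only [Function.update_self]; omega
  · intro j hj hlj
    by_cases hjv : j = v
    · exact ⟨tl, by omega, by simp [hjv]⟩
    · rw [Function.update_of_ne hjv] at hlj
      obtain ⟨i, hi, rfl⟩ := H.vis j hj hlj
      exact ⟨i, by omega, hq i hi⟩
  · intro j hj hlj
    by_cases hjv : j = v
    · subst hjv
      exact ⟨r, hr, by simp, hc⟩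
    · rw [Function.update_of_ne hjv] at hlj ⊢
      exact H.conn j hj hlj
  · intro i hi j hij
    have hi' := hi.trans_le H.hle
    rw [hq i hi'] at hij ⊢
    have := H.clos i hi j hij
    rw [hl _ (H.qvis i hi'), hl _ (this ▸ H.qvis i hi'), this]
  · have : ∀ i, h ≤ i → i < tl + 1 →
        Function.update lab v (r : ℤ) (Function.update qu tl v i) = r := by
      intro i h1 h2
      rcases hcases i h2 with hi | rfl
      · rw [hq i hi, hl _ (H.qvis i hi), hu i h1 hi]
      · simp
    intro i j h1 h2 h3 h4
    rw [this i h1 h2, this j h3 h4]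
  · intro j hj
    rw [hl _ (H.scan j hj)]
    exact H.scan j hj

theorem advance (H : BFSInv adj rep n qu lab h tl ap) (hlt : h < tl)
    (hc : ∀ j, adj (qu h) j → lab (rep j) = lab (qu h)) :
    BFSInv adj rep n qu lab (h + 1) tl ap :=
  { H with
    hle := hlt
    clos := fun i hi j hij => by
      rcases Nat.lt_succ_iff_lt_or_eq.1 hi with hi | rfl
      · exact H.clos i hi j hij
      · exact hc j hij
    unif := fun i j h1 h2 h3 h4 => H.unif i j (by omega) h2 (by omega) h4 }

theorem scan_succ (H : BFSInv adj rep n qu lab h tl ap) (hlt : ap < n) (hc : lab (rep ap) ≠ -1) :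
    BFSInv adj rep n qu lab h tl (ap + 1) :=
  { H with
    aple := hlt
    scan := fun j hj => by
      rcases Nat.lt_succ_iff_lt_or_eq.1 hj with hj | rfl
      · exact H.scan j hj
      · exact hc }

/-- If the visited neighbour has been processed, symmetry of adjacency puts the head of the queue
among its neighbours; if it is still waiting, all waiting points share one label. -/
theorem lab_eq (H : BFSInv adj rep n qu lab h tl ap) (hlt : h < tl)
    (hsymm : ∀ i j, adj i j → adj j i) {v : ℕ} (hv : v < n) (hvis : lab v ≠ -1)
    (hadj : adj (qu h) v) : lab v = lab (qu h) := by
  obtain ⟨i, hi, rfl⟩ := H.vis v hv hvis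
  by_cases hih : i < h
  · have := H.clos i hih _ (hsymm _ _ hadj)
    rw [H.qrep h hlt] at this
    exact this.symm
  · exact H.unif i h (by omega) hi le_rfl hlt

/-- Once the queue is exhausted and all points are scanned, `clos` makes labels constant along
edges, while `conn` links every point to its label. Hence equal labels mean connectedness. -/
theorem final (H : BFSInv adj rep n qu lab h h n) (hadj : ∀ i j, adj i j → i < n ∧ j < n)
    (hrep : ∀ j < n, rep j < n)
    (hrepadj : ∀ i j, adj i j → adj (rep i) j) (hrefl : ∀ j < n, adj (rep j) j) :
    ∃ f : ℕ → ℕ, (∀ j < n, f j < n ∧ lab (rep j) = f j) ∧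
      ∀ i < n, ∀ j < n, f i = f j ↔ Relation.EqvGen adj i j := by
  have h1 : ∀ j < n, ∃ r < n, lab (rep j) = (r : ℕ) ∧ Relation.EqvGen adj r (rep j) := fun j hj =>
    H.conn _ (hrep j hj) (H.scan j hj)
  have h2 : ∀ i j, adj i j → lab (rep i) = lab (rep j) := by
    intro i j hij
    obtain ⟨hi, hj⟩ := hadj i j hij
    obtain ⟨a, ha, hqa⟩ := H.vis (rep i) (hrep i hi) (H.scan i hi)
    rw [← hqa]
    refine (H.clos a ha j ?_).symm
    rw [hqa]
    exact hrepadj i j hij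
  have h3 : ∀ i j, Relation.EqvGen adj i j → lab (rep i) = lab (rep j) := by
    intro i j hij
    induction hij with
    | rel _ _ h => exact h2 _ _ h
    | refl => rfl
    | symm _ _ _ ih => exact ih.symm
    | trans _ _ _ _ _ ih ih' => exact ih.trans ih'
  choose! f hf1 hf2 hf3 using h1
  refine ⟨f, fun j hj => ⟨hf1 j hj, hf2 j hj⟩, fun i hi j hj => ⟨fun hij => ?_, fun hij => ?_⟩⟩
  · have h4 : ∀ j < n, Relation.EqvGen adj (f j) j := fun j hj =>
      (hf3 j hj).trans _ _ _ (.rel _ _ (hrefl j hj))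
    exact ((h4 i hi).symm _ _).trans _ _ _ (hij ▸ h4 j hj)
  · have := h3 i j hij
    rw [hf2 i hi, hf2 j hj] at this
    exact_mod_cast this

theorem neg_one_le (H : BFSInv adj rep n qu lab h tl ap) : ∀ j < n, -1 ≤ lab j := by
  intro j hj
  by_cases hl : lab j = -1
  · exact hl.ge
  · obtain ⟨r, -, hr, -⟩ := H.conn j hj hl
    omega

end BFSInv

namespace RealRAM

noncomputable section

/-! ### The program for the search

Tags of the working arrays: `9` counter, `18` code, `19` current point, `20` head of the queue,
`21` tail of the queue, `22` scanning position, `23` result of a table lookup; `33` labels of the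
representatives, `34` queue, `36` labels. -/

variable (b : ℕ)

/-- Run `c` if the table contains a point whose code is that of the current point plus the current
offset. -/
def probe (c : Cmd) : Cmd := .block [
  .set b 18 (.add (.get (arr b 30 0) (.var b 19)) (.get (arr b 31 0) (.var b 9))),
  .set b 23 (.get (arr b 32 0) (.var b 18)),
  .cond (.const 0) (.var b 23) (.cond (.add (.var b 23) (.const 1)) (.var b 2)
    (.cond (.get (arr b 30 0) (.var b 23)) (.var b 18)
      (.cond (.var b 18) (.get (arr b 30 0) (.var b 23)) c .skip) .skip) .skip) .skip]

/-- Append the point found to the queue. -/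
def enqueue (x : Term) : Cmd :=
  .cond (.get (arr b 33 0) (.var b 23)) (.const (-1)) (.block [
    .assign (arr b 33 0) (.var b 23) x,
    .assign (arr b 34 0) (.var b 21) (.var b 23),
    .set b 21 (.add (.var b 21) (.const 1))]) .skip

def bfsProcess : Cmd := .block [
  .set b 19 (.get (arr b 34 0) (.var b 20)),
  .set b 20 (.add (.var b 20) (.const 1)),
  .for b 9 (.var b 12) (probe b (enqueue b (.get (arr b 33 0) (.var b 19))))]

def bfsScan : Cmd := .block [
  .set b 23 (.get (arr b 32 0) (.get (arr b 30 0) (.var b 22))),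
  .set b 22 (.add (.var b 22) (.const 1)),
  enqueue b (.var b 23)]

/-- As `ap ≤ n` and `h ≤ tl` throughout, the single comparison `ap + h + 1 ≤ n + tl` says that an
unscanned or an unprocessed point remains. -/
def bfsLoop : Cmd :=
  .loop (.add (.add (.var b 22) (.var b 20)) (.const 1)) (.add (.var b 2) (.var b 21))
    (.cond (.add (.var b 20) (.const 1)) (.var b 21) (bfsProcess b) (bfsScan b))

/-- Label the connected components. -/
def bfsCmd : Cmd := .block [
  .for b 8 (.var b 2) (.assign (arr b 33 0) (.var b 8) (.const (-1))),
  .set b 20 (.const 0), .set b 21 (.const 0), .set b 22 (.const 0),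
  bfsLoop b,
  .for b 8 (.var b 2) (.assign (arr b 36 0) (.var b 8)
    (.get (arr b 33 0) (.get (arr b 32 0) (.get (arr b 30 0) (.var b 8)))))]

theorem within_bfsCmd : (bfsCmd b).Within b [8, 9, 18, 19, 20, 21, 22, 23, 33, 34, 36] := by
  simp [bfsCmd, bfsLoop, bfsProcess, bfsScan, probe, enqueue]

variable {b}

-- At codes of empty cells the table may hold initial zeros or remnants of earlier grids. A lookup
-- certifies itself: the entry has to be an index below `n` whose point has the code sought. No
-- clearing of the table is needed for the search.
open Classical in
theorem exec_probe {m : Store} {n cnt : ℕ} {code off : ℕ → ℤ}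
    (hn : m (arr b 2 0) 0 = n) (hcode : ∀ j < n, m (arr b 30 0) j = code j)
    (hoff : ∀ t < cnt, m (arr b 31 0) t = off t)
    {u t : ℕ} (hu : u < n) (ht : t < cnt) (h19 : m (arr b 19 0) 0 = u) (h9 : m (arr b 9 0) 0 = t)
    (c : Cmd) :
    (probe b c).exec m =
      (let C := code u + off t
       let v := m (arr b 32 0) C
       let m1 := (m.write (arr b 18 0) 0 C).write (arr b 23 0) 0 v
       if 0 ≤ v ∧ v + 1 ≤ n ∧ code ⌊v⌋₊ = C then c.exec m1 else m1) := by
  simp only [probe, Cmd.block, Cmd.exec, Cmd.exec_set, Term.eval, Term.eval_var, h19, h9,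
    Int.floor_natCast, hcode u hu, hoff t ht, Store.write_apply, arr_inj]
  norm_num
  simp only [hn, ← Int.cast_add]
  set v := m (arr b 32 0) (code u + off t)
  by_cases h0 : 0 ≤ v
  · by_cases h1 : v + 1 ≤ n
    · have hlt : ⌊v⌋₊ < n := (Nat.floor_lt h0).2 (by linarith)
      have h2 : m (arr b 30 0) ⌊v⌋ = code ⌊v⌋₊ := by
        rw [← hcode _ hlt, Int.natCast_floor_eq_floor h0]
      simp only [h0, h1, h2, if_true, true_and]
      by_cases h3 : code ⌊v⌋₊ = code u + off t
      · simp [h3]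
      · rw [if_neg h3]
        split_ifs with h4 h5
        · exact absurd (le_antisymm (by exact_mod_cast h4) (by exact_mod_cast h5)) h3
        · rfl
        · rfl
    · simp [h0, h1]
  · simp [h0]

/-- The memory represents the state of a search. -/
structure BFSMem (b : ℕ) (m : Store) (n : ℕ) (qu : ℕ → ℕ) (lab : ℕ → ℤ) (h tl ap : ℕ) :
    Prop where
  head : m (arr b 20 0) 0 = h
  tail : m (arr b 21 0) 0 = tl
  pos : m (arr b 22 0) 0 = ap
  labs : ∀ j < n, m (arr b 33 0) j = lab j
  queue : ∀ i < tl, m (arr b 34 0) i = qu i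

theorem BFSMem.congr {L : List ℕ} {m m' : Store} {n : ℕ} {qu : ℕ → ℕ} {lab : ℕ → ℤ} {h tl ap : ℕ}
    (H : BFSMem b m n qu lab h tl ap) (hf : Frame b L m m')
    (hL : 20 ∉ L ∧ 21 ∉ L ∧ 22 ∉ L ∧ 33 ∉ L ∧ 34 ∉ L) : BFSMem b m' n qu lab h tl ap := by
  obtain ⟨h1, h2, h3, h4, h5⟩ := H
  rw [← hf _ _ hL.1] at h1
  rw [← hf _ _ hL.2.1] at h2
  rw [← hf _ _ hL.2.2.1] at h3
  rw [← hf _ _ hL.2.2.2.1] at h4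
  rw [← hf _ _ hL.2.2.2.2] at h5
  exact ⟨h1, h2, h3, h4, h5⟩

theorem enqueue_spec {m : Store} {n : ℕ} {qu : ℕ → ℕ} {lab : ℕ → ℤ} {h tl ap v : ℕ} {r : ℤ}
    {x : Term} (H : BFSMem b m n qu lab h tl ap) (hv : v < n) (h23 : m (arr b 23 0) 0 = v)
    (hlab : ∀ j < n, -1 ≤ lab j) (hx : x.eval m = r) :
    (lab v = -1 → BFSMem b ((enqueue b x).exec m) n (Function.update qu tl v)
      (Function.update lab v r) h (tl + 1) ap) ∧
    (lab v ≠ -1 → (enqueue b x).exec m = m) := by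
  obtain ⟨h20, h21, h22, h33, h34⟩ := H
  simp only [enqueue, Cmd.block, Cmd.exec, Cmd.exec_set, Term.eval, Term.eval_var, h23, hx,
    Int.floor_natCast, h33 v hv]
  constructor
  · intro h
    rw [if_pos (by rw [h])]
    refine ⟨?_, ?_, ?_, ?_, ?_⟩
    · simp [Store.write_apply, h20]
    · simp [Store.write_apply, h21]
    · simp [Store.write_apply, h22]
    · intro j hj
      by_cases hjv : j = v
      · simp [Store.write_apply, hjv]
      · simp [Store.write_apply, hjv, h33 j hj]
    · intro i hi
      by_cases hit : i = tl
      · simp [Store.write_apply, hit, h21, h23]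
      · simp [Store.write_apply, hit, h21, h34 i (by omega)]
  · intro h
    rw [if_neg]
    intro h'
    have : lab v ≤ -1 := by exact_mod_cast h'
    exact h (le_antisymm this (hlab v hv))

/-- Hypotheses under which the search works. -/
structure BFSData (n cnt : ℕ) (code off : ℕ → ℤ) (rep : ℕ → ℕ) : Prop where
  symm : ∀ i j, CodeAdj n cnt code off i j → CodeAdj n cnt code off j i
  refl : ∀ i < n, CodeAdj n cnt code off i i
  lt : ∀ j < n, rep j < n
  code_rep : ∀ j < n, code (rep j) = code j
  congr : ∀ i < n, ∀ j < n, code i = code j → rep i = rep j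

theorem HT.bfsProcess {m : Store} {n cnt : ℕ} {code off : ℕ → ℤ} {rep : ℕ → ℕ}
    (D : BFSData n cnt code off rep) (hn : m (arr b 2 0) 0 = n)
    (hg : GridMem b m n cnt code off) (hrep : ∀ j < n, m (arr b 32 0) (code j) = rep j)
    {qu : ℕ → ℕ} {lab : ℕ → ℤ} {h tl ap : ℕ}
    (H : BFSInv (CodeAdj n cnt code off) rep n qu lab h tl ap)
    (M : BFSMem b m n qu lab h tl ap) (hlt : h < tl) :
    HT (bfsProcess b) m ((40 + 6) * (cnt + 1) + 6) fun m' => ∃ qu' lab' tl',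
      BFSInv (CodeAdj n cnt code off) rep n qu' lab' (h + 1) tl' ap ∧
      BFSMem b m' n qu' lab' (h + 1) tl' ap := by
  have hu : qu h < n := H.qlt h hlt
  set u := qu h with hudef
  refine .seq (T := 1) (T' := (40 + 6) * (cnt + 1) + 4) (.set ?_) (by ring_nf; omega)
  refine .seq (T := 1) (T' := (40 + 6) * (cnt + 1) + 2) (.set ?_) (by ring_nf; omega)
  refine .seq (T := (40 + 6) * (cnt + 1)) (T' := 1) ?_ (by ring_nf; omega)
  have hq : m (arr b 34 0) h = u := M.queue h hlt
  simp only [Term.eval, Term.eval_var, M.head, Int.floor_natCast, hq, Store.write_apply, arr_inj]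
  norm_num
  set m1 := (m.write (arr b 19 0) 0 u).write (arr b 20 0) 0 (h + 1) with hm1
  have f1 : Frame b [19, 20] m m1 := ((Frame.refl m).write (by simp) _ _ _).write (by simp) _ _ _
  have M1 : BFSMem b m1 n qu lab (h + 1) tl ap := by
    obtain ⟨h20, h21, h22, h33, h34⟩ := M
    refine ⟨?_, ?_, ?_, ?_, ?_⟩ <;> simp [m1, Store.write_apply, *]
    · exact h33
    · exact h34
  have h19 : m1 (arr b 19 0) 0 = u := by simp [m1, Store.write_apply]
  -- The stored head is already `h + 1`, whereas the search invariant stays at `h` until all offsets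
  -- have been probed; the last clause records the neighbours treated so far.
  refine HT.for (L := [18, 21, 23, 33, 34]) (by simp [probe, enqueue]) (by simp) (n := cnt)
    (fun t m' => ∃ qu' lab' tl', BFSInv (CodeAdj n cnt code off) rep n qu' lab' h tl' ap ∧
      BFSMem b m' n qu' lab' (h + 1) tl' ap ∧ h < tl' ∧ qu' h = u ∧
      ∀ t' < t, ∀ j < n, code j = code u + off t' → lab' (rep j) = lab' u) ?_ ?_ ?_ ?_
  · intro m' hf
    rw [Term.eval_var, hf _ _ (by simp), f1 _ _ (by simp), hg.count]
  · exact ⟨qu, lab, tl, H, M1.congr ((Frame.refl _).write (L := [9]) (by simp) _ _ _) (by simp),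
      hlt, rfl, by simp⟩
  · rintro t ht m' hf h9 ⟨qu', lab', tl', H', M', hlt', hqu', hdone⟩
    have ff : Frame b [9, 18, 19, 20, 21, 23, 33, 34] m m' :=
      (f1.mono (by simp)).trans (hf.mono (by simp))
    refine (HT.exec (by simp [probe, enqueue, Cmd.Simple]) ?_).mono (T := (probe b (enqueue b
      (.get (arr b 33 0) (.var b 19)))).cost) (Nat.le_of_ble_eq_true rfl) fun _ => id
    rw [exec_probe (by rw [ff _ _ (by simp), hn])
      (fun j hj => by rw [ff _ _ (by simp), hg.codes j hj])
      (fun j hj => by rw [ff _ _ (by simp), hg.offs j hj]) hu ht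
      (by rw [hf _ _ (by simp), h19]) h9]
    have f32 : m' (arr b 32 0) = m (arr b 32 0) := ff _ _ (by simp)
    have e19 : m' (arr b 19 0) 0 = u := by rw [hf _ _ (by simp), h19]
    simp only [f32]
    set v := m (arr b 32 0) (code u + off t) with hv
    set m2 := (m'.write (arr b 18 0) 0 ((code u + off t : ℤ) : ℝ)).write (arr b 23 0) 0 v with hm2
    have f2 : Frame b [18, 23] m' m2 :=
      ((Frame.refl m').write (by simp) _ _ _).write (by simp) _ _ _
    have M2 := M'.congr f2 (by simp)
    have fin : ∀ (m3 : Store), Frame b [9] m3 (m3.write (arr b 9 0) 0 (t + 1)) := fun m3 =>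
      (Frame.refl m3).write (by simp) _ _ _
    split_ifs with hvalid
    · obtain ⟨hv0, hv1, hvc⟩ := hvalid
      have hwn : ⌊v⌋₊ < n := (Nat.floor_lt hv0).2 (by linarith)
      set w := ⌊v⌋₊ with hw
      have hvw : v = rep w := by rw [hv, ← hvc, hrep w hwn]
      -- The table stores representatives only, so the point found represents its own cell.
      have hww : w = rep w := by
        conv_lhs => rw [hw, hvw, Nat.floor_natCast]
      have hvw' : v = w := by rw [hvw, ← hww]
      have hadj : CodeAdj n cnt code off u w := ⟨hu, hwn, t, ht, hvc⟩
      have hrepw : ∀ j < n, code j = code u + off t → rep j = w := fun j hj hc => by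
        rw [hww]
        exact D.congr j hj w hwn (hc.trans hvc.symm)
      have hlu : lab' u ≠ -1 := hqu' ▸ H'.qvis h hlt'
      have hx : (Term.get (arr b 33 0) (.var b 19)).eval m2 = lab' u := by
        simp only [Term.eval, Term.eval_var]
        rw [f2 _ _ (by simp), f2 _ _ (by simp), e19, Int.floor_natCast, M'.labs u hu]
      obtain ⟨hE1, hE2⟩ := enqueue_spec (x := .get (arr b 33 0) (.var b 19)) M2 hwn
        (by simp [m2, Store.write_apply, hvw']) H'.neg_one_le hx
      by_cases hl : lab' w = -1
      · obtain ⟨r, hr, hr1, hr2⟩ := H'.conn u hu hlu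
        have hne : u ≠ w := fun h => hlu (h ▸ hl)
        refine ⟨Function.update qu' tl' w, Function.update lab' w (lab' u), tl' + 1, ?_,
          (hE1 hl).congr (fin _) (by simp), by omega, ?_, ?_⟩
        · rw [hr1]
          refine H'.visit hwn hww.symm hl hr (hr2.trans _ _ _ (.rel _ _ hadj)) ?_
          intro i h1 h2
          rw [H'.unif i h h1 h2 le_rfl hlt', hqu', hr1]
        · rw [Function.update_of_ne hlt'.ne, hqu']
        · intro t' ht' j hj hc
          rw [Function.update_of_ne hne]
          rcases Nat.lt_succ_iff_lt_or_eq.1 ht' with ht' | rfl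
          · have := hdone t' ht' j hj hc
            rwa [Function.update_of_ne]
            intro h
            rw [h, hl] at this
            exact hlu this.symm
          · rw [hrepw j hj hc, Function.update_self]
      · refine ⟨qu', lab', tl', H', ?_, hlt', hqu', ?_⟩
        · rw [hE2 hl]
          exact M2.congr (fin _) (by simp)
        · intro t' ht' j hj hc
          rcases Nat.lt_succ_iff_lt_or_eq.1 ht' with ht' | rfl
          · exact hdone t' ht' j hj hc
          · rw [hrepw j hj hc, ← hqu']
            exact H'.lab_eq hlt' D.symm hwn hl (hqu' ▸ hadj)
    · refine ⟨qu', lab', tl', H', M2.congr (fin _) (by simp), hlt', hqu', ?_⟩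
      intro t' ht' j hj hc
      rcases Nat.lt_succ_iff_lt_or_eq.1 ht' with ht' | rfl
      · exact hdone t' ht' j hj hc
      -- A point with this code would have made the table entry valid.
      · exfalso
        apply hvalid
        have hvj : v = rep j := by rw [hv, ← hc, hrep j hj]
        have := D.lt j hj
        rw [hvj]
        refine ⟨by positivity, by exact_mod_cast this, ?_⟩
        rw [Nat.floor_natCast, D.code_rep j hj, hc]
  · rintro m' - - ⟨qu', lab', tl', H', M', hlt', hqu', hdone⟩
    refine .skip ⟨qu', lab', tl', H'.advance hlt' ?_, M'⟩
    rintro j ⟨-, hj, t, ht, hc⟩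
    rw [hqu'] at hc ⊢
    exact hdone t ht j hj hc

theorem HT.bfsScan {m : Store} {n cnt : ℕ} {code off : ℕ → ℤ} {rep : ℕ → ℕ}
    (D : BFSData n cnt code off rep)
    (hg : GridMem b m n cnt code off) (hrep : ∀ j < n, m (arr b 32 0) (code j) = rep j)
    {qu : ℕ → ℕ} {lab : ℕ → ℤ} {h ap : ℕ}
    (H : BFSInv (CodeAdj n cnt code off) rep n qu lab h h ap)
    (M : BFSMem b m n qu lab h h ap) (hlt : ap < n) :
    HT (bfsScan b) m 16 fun m' => ∃ qu' lab' tl',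
      BFSInv (CodeAdj n cnt code off) rep n qu' lab' h tl' (ap + 1) ∧
      BFSMem b m' n qu' lab' h tl' (ap + 1) := by
  refine (HT.exec (by simp [RealRAM.bfsScan, enqueue, Cmd.Simple]) ?_).mono
    (T := (RealRAM.bfsScan b).cost) (Nat.le_of_ble_eq_true rfl) fun _ => id
  have e : (Term.get (arr b 32 0) (.get (arr b 30 0) (.var b 22))).eval m = rep ap := by
    simp only [Term.eval, Term.eval_var, M.pos, Int.floor_natCast, hg.codes ap hlt,
      Int.floor_intCast, hrep ap hlt]
  simp only [RealRAM.bfsScan, Cmd.block, Cmd.exec, Cmd.exec_set, e]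
  set m1 := (m.write (arr b 23 0) 0 (rep ap : ℝ)).write (arr b 22 0) 0
    (((Term.var b 22).add (Term.const 1)).eval (m.write (arr b 23 0) 0 (rep ap : ℝ))) with hm1
  have M1 : BFSMem b m1 n qu lab h h (ap + 1) := by
    obtain ⟨h20, h21, h22, h33, h34⟩ := M
    refine ⟨?_, ?_, ?_, ?_, ?_⟩ <;> simp [m1, Store.write_apply, Term.eval, *]
    · exact h33
    · exact h34
  have h23 : m1 (arr b 23 0) 0 = rep ap := by simp [m1, Store.write_apply]
  have hrr : rep (rep ap) = rep ap := D.congr _ (D.lt ap hlt) _ hlt (D.code_rep ap hlt)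
  obtain ⟨hE1, hE2⟩ := enqueue_spec (x := .var b 23) (r := rep ap) M1 (D.lt ap hlt) h23
    H.neg_one_le (by simp [h23])
  by_cases hl : lab (rep ap) = -1
  · refine ⟨_, _, _, ?_, hE1 hl⟩
    -- The queue is empty here, so nothing constrains the new label.
    have H2 := H.visit (D.lt ap hlt) hrr hl (D.lt ap hlt) (.refl _) (by intros; omega)
    refine H2.scan_succ hlt ?_
    rw [Function.update_self]
    omega
  · refine ⟨qu, lab, h, H.scan_succ hlt hl, ?_⟩
    rw [hE2 hl]
    exact M1

theorem HT.bfsCmd {m : Store} {n cnt : ℕ} {code off : ℕ → ℤ}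
    (hsymm : ∀ i j, CodeAdj n cnt code off i j → CodeAdj n cnt code off j i)
    (hrefl : ∀ i < n, CodeAdj n cnt code off i i)
    (hn : m (arr b 2 0) 0 = n) (hg : GridMem b m n cnt code off) :
    HT (bfsCmd b) m (200 * (n + 1) * (cnt + 1)) fun m' => ∃ f : ℕ → ℕ,
      (∀ j < n, f j < n ∧ m' (arr b 36 0) j = f j) ∧
      ∀ i < n, ∀ j < n, f i = f j ↔ Relation.EqvGen (CodeAdj n cnt code off) i j := by
  obtain ⟨rep, hrep1, hrep2, hrep⟩ : ∃ rep : ℕ → ℕ, (∀ j < n, rep j < n) ∧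
      (∀ j < n, code (rep j) = code j) ∧ ∀ j < n, m (arr b 32 0) (code j) = rep j := by
    have := hg.dict
    choose! rep h1 h2 h3 using this
    exact ⟨rep, h1, h2, h3⟩
  have D : BFSData n cnt code off rep := ⟨hsymm, hrefl, hrep1, hrep2, fun i hi j hj h => by
    have h1 := hrep i hi
    rw [h, hrep j hj] at h1
    exact_mod_cast h1.symm⟩
  set B := 46 * (cnt + 1) + 7 with hB
  refine .seq (T := 7 * (n + 1)) (T' := 2 * n * (B + 1) + 1 + 7 * (n + 1) + 9) ?_
    (by simp only [hB]; ring_nf; nlinarith [Nat.zero_le (n * cnt)])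
  refine HT.mono (HT.within (b := b) (L := [8, 33]) (by simp) (HT.for (b := b) (t := 8) (L := [33])
    (by simp) (by simp) (n := n) (T := 1) (m := m) (Q := fun m' => ∀ j < n, m' (arr b 33 0) j = -1)
    (fun j m' => ∀ i < j, m' (arr b 33 0) i = -1) ?_ ?_ ?_ ?_)) (by omega) ?_
  · intro m' hf
    rw [Term.eval_var, hf _ _ (by simp), hn]
  · simp
  · intro j hj m' hf hv hI
    refine .assign fun i hi => ?_
    simp only [Store.write_apply, Term.eval, Term.eval_var, hv, arr_inj, Int.floor_natCast]
    norm_num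
    intro hij
    exact hI i (by omega)
  · intro m' _ _ h
    exact h
  rintro m1 ⟨h33, f1⟩
  refine .seq (T := 1) (T' := 2 * n * (B + 1) + 1 + 7 * (n + 1) + 7) (.set ?_) (by omega)
  refine .seq (T := 1) (T' := 2 * n * (B + 1) + 1 + 7 * (n + 1) + 5) (.set ?_) (by omega)
  refine .seq (T := 1) (T' := 2 * n * (B + 1) + 1 + 7 * (n + 1) + 3) (.set ?_) (by omega)
  simp only [Term.eval]
  set m2 := ((m1.write (arr b 20 0) 0 ((0 : ℤ) : ℝ)).write (arr b 21 0) 0 ((0 : ℤ) : ℝ)).write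
    (arr b 22 0) 0 ((0 : ℤ) : ℝ) with hm2
  have f2 : Frame b [8, 20, 21, 22, 33] m m2 :=
    (((f1.mono (by simp)).write (by simp) _ _ _).write (by simp) _ _ _).write (by simp) _ _ _
  refine .seq (T := 2 * n * (B + 1) + 1) (T' := 7 * (n + 1) + 2) ?_ (by omega)
  -- Each iteration advances the head or the scanning position by one, and neither exceeds `n`; this
  -- gives at most `2 * n` iterations.
  refine HT.mono (HT.loop (T := B) (Q := fun m' => Frame b [8, 9, 18, 19, 20, 21, 22, 23, 33, 34]
      m m' ∧ ∃ qu lab h, BFSInv (CodeAdj n cnt code off) rep n qu lab h h n ∧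
        BFSMem b m' n qu lab h h n)
    (fun v m' => Frame b [8, 9, 18, 19, 20, 21, 22, 23, 33, 34] m m' ∧
      ∃ qu lab h tl ap, v = (n - h) + (n - ap) ∧
        BFSInv (CodeAdj n cnt code off) rep n qu lab h tl ap ∧
        BFSMem b m' n qu lab h tl ap) ?_ ?_ (2 * n) m2 ?_) le_rfl ?_
  · rintro v m' ⟨ff, qu, lab, h, tl, ap, hv, H, M⟩ hle
    have htl := H.tl_le
    have hhl := H.hle
    have hap := H.aple
    have e2 : m' (arr b 2 0) 0 = n := by rw [ff _ _ (by simp), hn]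
    have e32 : ∀ j < n, m' (arr b 32 0) (code j) = rep j := fun j hj => by
      rw [ff _ _ (by simp), hrep j hj]
    simp only [Term.eval, Term.eval_var, M.pos, M.head, M.tail, e2] at hle
    norm_num at hle
    have hle' : ap + h + 1 ≤ n + tl := by exact_mod_cast hle
    have hg' := hg.congr ff (by simp) (by simp) (by simp) (by simp)
    refine ⟨v - 1, by omega, ?_⟩
    refine .cond (T := B - 1) (fun hlt => ?_) (fun hlt => ?_) (by omega)
    · simp only [Term.eval, Term.eval_var, M.head, M.tail] at hlt
      norm_num at hlt
      have hlt' : h + 1 ≤ tl := by exact_mod_cast hlt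
      refine ((HT.bfsProcess D e2 hg' e32 H M hlt').within (b := b)
        (L := [9, 18, 19, 20, 21, 23, 33, 34])
        (by simp [RealRAM.bfsProcess, probe, enqueue])).mono (by omega) ?_
      rintro m'' ⟨⟨qu', lab', tl', H', M'⟩, f'⟩
      exact ⟨ff.trans (f'.mono (by simp)), qu', lab', h + 1, tl', ap, by omega, H', M'⟩
    · simp only [Term.eval, Term.eval_var, M.head, M.tail] at hlt
      norm_num at hlt
      have hlt' : tl < h + 1 := by exact_mod_cast hlt
      obtain rfl : tl = h := by omega
      refine ((HT.bfsScan D hg' e32 H M (by omega)).within (b := b)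
        (L := [21, 22, 23, 33, 34])
        (by simp [RealRAM.bfsScan, enqueue])).mono (by omega) ?_
      rintro m'' ⟨⟨qu', lab', tl', H', M'⟩, f'⟩
      exact ⟨ff.trans (f'.mono (by simp)), qu', lab', tl, tl', ap + 1, by omega, H', M'⟩
  · rintro v m' ⟨ff, qu, lab, h, tl, ap, hv, H, M⟩ hle
    have htl := H.tl_le
    have hhl := H.hle
    have hap := H.aple
    have e2 : m' (arr b 2 0) 0 = n := by rw [ff _ _ (by simp), hn]
    simp only [Term.eval, Term.eval_var, M.pos, M.head, M.tail, e2] at hle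
    norm_num at hle
    have hle' : n + tl < ap + h + 1 := by exact_mod_cast hle
    obtain rfl : ap = n := by omega
    obtain rfl : tl = h := by omega
    exact ⟨ff, qu, lab, tl, H, M⟩
  · refine ⟨f2.mono (by simp), fun _ => 0, fun _ => -1, 0, 0, 0, by omega, ?_, ?_⟩
    · constructor <;> simp
    · constructor <;> simp [m2, Store.write_apply]
      exact h33
  rintro m3 ⟨f3, qu, lab, h, H, M⟩
  obtain ⟨f, hf1, hf2⟩ := H.final (fun i j h => ⟨h.1, h.2.1⟩) hrep1
    (fun i j h => ⟨hrep1 i h.1, h.2.1, by rw [hrep2 i h.1]; exact h.2.2⟩)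
    (fun j hj => by
      obtain ⟨-, -, h⟩ := hrefl j hj
      exact ⟨hrep1 j hj, hj, by rw [hrep2 j hj]; exact h⟩)
  refine .seq (T := 7 * (n + 1)) (T' := 1) ?_ (by omega)
  refine HT.mono (HT.for (b := b) (t := 8) (L := [36])
    (by simp) (by simp) (n := n) (T := 1) (m := m3) (Q := fun m' => ∀ j < n, m' (arr b 36 0) j = f j)
    (fun j m' => ∀ i < j, m' (arr b 36 0) i = f i) ?_ ?_ ?_ ?_) (by omega)
    (fun m' h => .skip ⟨f, fun j hj => ⟨(hf1 j hj).1, h j hj⟩, hf2⟩)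
  · intro m' hf
    rw [Term.eval_var, hf _ _ (by simp), f3 _ _ (by simp), hn]
  · simp
  · intro j hj m' hf hv hI
    have e : (Term.get (arr b 33 0) (.get (arr b 32 0) (.get (arr b 30 0) (.var b 8)))).eval m'
        = f j := by
      simp only [Term.eval, Term.eval_var, hv, Int.floor_natCast]
      rw [hf 30 _ (by simp), f3 30 _ (by simp), hg.codes j hj, Int.floor_intCast,
        hf 32 _ (by simp), f3 32 _ (by simp), hrep j hj, Int.floor_natCast,
        hf 33 _ (by simp), M.labs _ (hrep1 j hj), (hf1 j hj).2]
      simp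
    refine .assign fun i hi => ?_
    rw [e]
    simp only [Store.write_apply, Term.eval_var, hv, arr_inj, Int.floor_natCast]
    norm_num
    split_ifs with hij
    · rw [hij]
    · exact hI i (by omega)
  · intro m' _ _ h
    exact h

end
end RealRAM

namespace RealRAM

noncomputable section

variable (b : ℕ)

/-! ### Greedy nets

Tags of the working arrays: `24` the net point that represents the current point; `32` table from
codes to net points, `36` the net points that represent the points. -/

def netClear : Cmd :=
  .for b 8 (.var b 2) (.assign (arr b 32 0) (.get (arr b 30 0) (.var b 8)) (.const (-1)))

def netSearch : Cmd := .for b 9 (.var b 12) (probe b (.set b 24 (.var b 23)))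

def netStep : Cmd := .block [
    .set b 24 (.var b 8),
    .set b 19 (.var b 8),
    netSearch b,
    .assign (arr b 36 0) (.var b 8) (.var b 24),
    .cond (.var b 8) (.var b 24)
      (.assign (arr b 32 0) (.get (arr b 30 0) (.var b 8)) (.var b 8)) .skip]

/-- Assign every point to an adjacent earlier net point, if there is one, and make it a net point
otherwise. -/
def netCmd : Cmd := .seq (netClear b) (.for b 8 (.var b 2) (netStep b))

theorem within_netCmd : (netCmd b).Within b [8, 9, 18, 19, 23, 24, 32, 36] := by
  simp [netCmd, netClear, netStep, netSearch, probe]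

/-- `f` assigns the points before `j` to net points, which are pairwise not adjacent. -/
structure IsNet (adj : ℕ → ℕ → Prop) (f : ℕ → ℕ) (j : ℕ) : Prop where
  le : ∀ i < j, f i ≤ i
  idem : ∀ i < j, f (f i) = f i
  mem_adj : ∀ i < j, f i ≠ i → adj i (f i)
  sep : ∀ i < j, ∀ i' < i, f i = i → f i' = i' → ¬ adj i i'

variable {b}

theorem IsNet.succ {adj : ℕ → ℕ → Prop} {f : ℕ → ℕ} {j w : ℕ} (h : IsNet adj f j)
    (hw : (w = j ∧ ∀ i < j, f i = i → ¬ adj j i) ∨ (w < j ∧ f w = w ∧ adj j w)) :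
    IsNet adj (Function.update f j w) (j + 1) := by
  have hne : ∀ i, i < j → Function.update f j w i = f i := fun i hi =>
    Function.update_of_ne hi.ne _ _
  have hc : ∀ i, i < j + 1 → i < j ∨ i = j := fun i hi => by omega
  refine ⟨fun i hi => ?_, fun i hi => ?_, fun i hi hf => ?_, fun i hi i' hi' h1 h2 => ?_⟩
  · rcases hc i hi with hi | rfl
    · rw [hne i hi]; exact h.le i hi
    · rw [Function.update_self]; omega
  · rcases hc i hi with hi | rfl
    · rw [hne i hi, hne _ ((h.le i hi).trans_lt hi)]; exact h.idem i hi
    · rw [Function.update_self]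
      rcases hw with ⟨rfl, -⟩ | ⟨hw, hfw, -⟩
      · rw [Function.update_self]
      · rw [hne w hw, hfw]
  · rcases hc i hi with hi | rfl
    · rw [hne i hi] at hf ⊢; exact h.mem_adj i hi hf
    · rw [Function.update_self] at hf ⊢
      rcases hw with ⟨rfl, -⟩ | ⟨hw, -, ha⟩
      · exact absurd rfl hf
      · exact ha
  · rcases hc i hi with hi | rfl
    · rw [hne i hi] at h1
      rw [hne i' (hi'.trans hi)] at h2
      exact h.sep i hi i' hi' h1 h2
    · rw [Function.update_self] at h1
      rw [hne i' hi'] at h2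
      rcases hw with ⟨-, hw⟩ | ⟨hw, -, -⟩
      · exact hw i' hi' h2
      · omega

/-- The table left by the grid program lists arbitrary points. The entry `-1`, rejected by `probe`,
reserves the occupied cells for net points. -/
theorem HT.netClear {m : Store} {n cnt : ℕ} {code off : ℕ → ℤ}
    (hn : m (arr b 2 0) 0 = n) (hg : GridMem b m n cnt code off) :
    HT (netClear b) m (7 * (n + 1)) fun m' => ∀ j < n, m' (arr b 32 0) (code j) = -1 := by
  refine HT.for (L := [32]) (by simp) (by simp) (n := n) (T := 1)
    (fun j m' => ∀ i < j, m' (arr b 32 0) (code i) = -1) ?_ ?_ ?_ ?_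
  · intro m' hf
    rw [Term.eval_var, hf _ _ (by simp), hn]
  · simp
  · intro j hj m' hf hv hI
    have e30 : m' (arr b 30 0) j = code j := by rw [hf _ _ (by simp), hg.codes j hj]
    refine .assign fun i hi => ?_
    simp only [Store.write_apply, Term.eval, Term.eval_var, hv, arr_inj, Int.floor_natCast, e30,
      Int.floor_intCast]
    norm_num
    intro hij
    refine hI i ?_
    rcases Nat.lt_succ_iff_lt_or_eq.1 hi with h | rfl
    · exact h
    · exact absurd rfl hij
  · intro m' _ _ h
    exact h

/-- The table contains the net points before `j`. -/
def NetTable (b : ℕ) (m : Store) (n : ℕ) (code : ℕ → ℤ) (f : ℕ → ℕ) (j : ℕ) : Prop :=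
  ∀ i < n, (m (arr b 32 0) (code i) = -1 ∧ ∀ r < j, f r = r → code r ≠ code i) ∨
    ∃ r < j, f r = r ∧ code r = code i ∧ m (arr b 32 0) (code i) = r

/-- An accepted entry belongs to an occupied cell and is not `-1`, so it is a net point; a rejected
one shows that no earlier net point has the code sought. -/
theorem HT.netSearch {m : Store} {n cnt : ℕ} {code off : ℕ → ℤ}
    (hn : m (arr b 2 0) 0 = n) (hc : m (arr b 12 0) 0 = cnt)
    (hcode : ∀ j < n, m (arr b 30 0) j = code j)
    (hoff : ∀ t < cnt, m (arr b 31 0) t = off t)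
    {f : ℕ → ℕ} {j : ℕ} (hj : j < n) (h19 : m (arr b 19 0) 0 = j) (h24 : m (arr b 24 0) 0 = j)
    (ht : NetTable b m n code f j) :
    HT (netSearch b) m ((20 + 6) * (cnt + 1)) fun m' => ∃ w : ℕ, m' (arr b 24 0) 0 = w ∧
      ((w = j ∧ ∀ i < j, f i = i → ¬ CodeAdj n cnt code off j i) ∨
        (w < j ∧ f w = w ∧ CodeAdj n cnt code off j w)) := by
  refine HT.for (L := [18, 23, 24]) (by simp [probe]) (by simp) (n := cnt) (T := 20)
    (fun t m' => ∃ w : ℕ, m' (arr b 24 0) 0 = w ∧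
      ((w = j ∧ ∀ i < j, f i = i → ∀ t' < t, code i ≠ code j + off t') ∨
        (w < j ∧ f w = w ∧ CodeAdj n cnt code off j w))) ?_ ?_ ?_ ?_
  · intro m' hf
    rw [Term.eval_var, hf _ _ (by simp), hc]
  · exact ⟨j, by simp [Store.write_apply, h24], .inl ⟨rfl, by simp⟩⟩
  · rintro t htc m' hf h9 ⟨w, hw, hI⟩
    refine (HT.exec (by simp [probe, Cmd.Simple]) ?_).mono
      (T := (probe b (.set b 24 (.var b 23))).cost) (Nat.le_of_ble_eq_true rfl) fun _ => id
    rw [exec_probe (by rw [hf _ _ (by simp), hn])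
      (fun j hj => by rw [hf _ _ (by simp), hcode j hj])
      (fun j hj => by rw [hf _ _ (by simp), hoff j hj]) hj htc
      (by rw [hf _ _ (by simp), h19]) h9]
    have f32 : m' (arr b 32 0) = m (arr b 32 0) := hf _ _ (by simp)
    simp only [f32]
    set v := m (arr b 32 0) (code j + off t) with hv
    split_ifs with hvalid
    · obtain ⟨hv0, hv1, hvc⟩ := hvalid
      have hwn : ⌊v⌋₊ < n := (Nat.floor_lt hv0).2 (by linarith)
      have hv2 := ht _ hwn
      rw [hvc, ← hv] at hv2
      rcases hv2 with ⟨h, -⟩ | ⟨r, hr, hfr, hcr, hvr⟩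
      · linarith
      · refine ⟨r, ?_, .inr ⟨hr, hfr, hj, hr.trans hj, t, htc, hcr⟩⟩
        simp [Store.write_apply, Cmd.exec_set, hvr]
    · refine ⟨w, by simp [Store.write_apply, hw], hI.imp (fun h => ⟨h.1, ?_⟩) id⟩
      intro i hi hfi t' ht' hcc
      rcases Nat.lt_succ_iff_lt_or_eq.1 ht' with ht' | rfl
      · exact h.2 i hi hfi t' ht' hcc
      · rcases ht i (hi.trans hj) with ⟨-, h'⟩ | ⟨r, hr, -, hcr, hvr⟩
        · exact h' i hi hfi rfl
        · apply hvalid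
          rw [hcc, ← hv] at hvr
          have := hr.trans hj
          rw [hvr]
          refine ⟨by positivity, by exact_mod_cast this, ?_⟩
          rw [Nat.floor_natCast, hcr, hcc]
  · rintro m' - - ⟨w, hw, h⟩
    refine ⟨w, hw, h.imp (fun h => ⟨h.1, ?_⟩) id⟩
    rintro i hi hfi ⟨-, -, t, ht, hcc⟩
    exact h.2 i hi hfi t ht hcc

theorem HT.netCmd {m : Store} {n cnt : ℕ} {code off : ℕ → ℤ}
    (hn : m (arr b 2 0) 0 = n) (hg : GridMem b m n cnt code off) :
    HT (netCmd b) m (100 * (n + 1) * (cnt + 1)) fun m' => ∃ f : ℕ → ℕ,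
      (∀ j < n, m' (arr b 36 0) j = f j) ∧ IsNet (CodeAdj n cnt code off) f n := by
  set B := 26 * (cnt + 1) + 12 with hB
  refine .seq (T := 7 * (n + 1)) (T' := (B + 6) * (n + 1)) ?_
    (by simp only [hB]; ring_nf; nlinarith [Nat.zero_le (n * cnt)])
  refine ((HT.netClear hn hg).within (b := b) (L := [8, 32]) (by simp [RealRAM.netClear])).mono
    le_rfl ?_
  rintro m1 ⟨h32, f1⟩
  refine HT.for (L := [9, 18, 19, 23, 24, 32, 36])
    (by simp [RealRAM.netStep, RealRAM.netSearch, probe]) (by simp)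
    (n := n) (T := B) (fun j m' => ∃ f : ℕ → ℕ, IsNet (CodeAdj n cnt code off) f j ∧
      NetTable b m' n code f j ∧ ∀ i < j, m' (arr b 36 0) i = f i) ?_ ?_ ?_ ?_
  · intro m' hf
    rw [Term.eval_var, hf _ _ (by simp), f1 _ _ (by simp), hn]
  · refine ⟨id, by constructor <;> simp, fun i hi => .inl ⟨?_, by simp⟩, by simp⟩
    simp [Store.write_apply, h32 i hi]
  · rintro j hj m' hf hv ⟨f, hnet, htab, h36⟩
    have ff : Frame b [8, 9, 18, 19, 23, 24, 32, 36] m m' :=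
      (f1.mono (by simp)).trans (hf.mono (by simp))
    refine .seq (T := 1) (T' := 26 * (cnt + 1) + 10) (.set ?_) (by omega)
    refine .seq (T := 1) (T' := 26 * (cnt + 1) + 8) (.set ?_) (by omega)
    refine .seq (T := 26 * (cnt + 1)) (T' := 7) ?_ (by omega)
    have e8 : (Term.var b 8).eval m' = j := by rw [Term.eval_var, hv]
    have e8' : (Term.var b 8).eval (m'.write (arr b 24 0) 0 j) = j := by
      simp [Store.write_apply, hv]
    rw [e8, e8']
    set m2 := (m'.write (arr b 24 0) 0 j).write (arr b 19 0) 0 j with hm2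
    have f2 : Frame b [19, 24] m' m2 :=
      ((Frame.refl _).write (by simp) _ _ _).write (by simp) _ _ _
    have g2 : Frame b [8, 9, 18, 19, 23, 24, 32, 36] m m2 := ff.trans (f2.mono (by simp))
    refine ((HT.netSearch (b := b) (m := m2) (n := n) (cnt := cnt) (code := code) (off := off)
      (f := f) (by rw [g2 _ _ (by simp), hn]) (by rw [g2 _ _ (by simp), hg.count])
      (fun i hi => by rw [g2 _ _ (by simp), hg.codes i hi])
      (fun i hi => by rw [g2 _ _ (by simp), hg.offs i hi]) hj
      (by simp [m2, Store.write_apply]) (by simp [m2, Store.write_apply])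
      (by
        intro i hi
        rw [f2 _ _ (by simp)]
        exact htab i hi)).within (b := b) (L := [9, 18, 23, 24])
        (by simp [RealRAM.netSearch, probe])).mono le_rfl ?_
    rintro m3 ⟨⟨w, h24, hw⟩, f3⟩
    have hnet' := hnet.succ hw
    have f3' : Frame b [9, 18, 19, 23, 24] m' m3 := (f2.mono (by simp)).trans (f3.mono (by simp))
    have hv3 : m3 (arr b 8 0) 0 = j := by rw [f3' _ _ (by simp), hv]
    have hc3 : m3 (arr b 30 0) j = code j := by
      rw [f3' _ _ (by simp), ff _ _ (by simp), hg.codes j hj]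
    have h36' : ∀ i < j, m3 (arr b 36 0) i = f i := fun i hi => by
      rw [f3' _ _ (by simp), h36 i hi]
    have htab' : NetTable b m3 n code f j := by
      intro i hi
      rw [f3' _ _ (by simp)]
      exact htab i hi
    refine (HT.exec (by simp [Cmd.Simple, Cmd.block]) ?_).mono (Nat.le_of_ble_eq_true rfl)
      fun _ => id
    simp only [Cmd.block, Cmd.exec, Term.eval, Term.eval_var, hv3, Store.write_apply, arr_inj,
      Int.floor_natCast, h24]
    norm_num
    simp only [hc3, Int.floor_intCast]
    have hne : ∀ i, i < j → Function.update f j w i = f i := fun i hi =>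
      Function.update_of_ne hi.ne _ _
    refine ⟨Function.update f j w, hnet', ?_, ?_⟩
    · intro i hi
      rcases hw with ⟨rfl, -⟩ | ⟨hw, -, -⟩
      · simp only [le_refl, if_true, Store.write_apply, arr_inj]
        norm_num
        by_cases hcc : code i = code w
        · exact .inr ⟨w, by omega, by simp, hcc.symm, by simp [hcc]⟩
        · rcases htab' i hi with ⟨h1, h2⟩ | ⟨r, hr, h1, h2, h3⟩
          · refine .inl ⟨by simp [hcc, h1], fun r hr hfr h => ?_⟩
            rcases hr.lt_or_eq with hr | rfl
            · rw [hne r hr] at hfr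
              exact h2 r hr hfr h
            · exact hcc h.symm
          · exact .inr ⟨r, by omega, by rw [hne r hr, h1], h2, by simp [hcc, h3]⟩
      · rw [if_neg (by omega)]
        simp only [Store.write_apply, arr_inj]
        norm_num
        rcases htab' i hi with ⟨h1, h2⟩ | ⟨r, hr, h1, h2, h3⟩
        · refine .inl ⟨h1, fun r hr hfr h => ?_⟩
          rcases hr.lt_or_eq with hr | rfl
          · rw [hne r hr] at hfr
            exact h2 r hr hfr h
          · rw [Function.update_self] at hfr
            omega
        · exact .inr ⟨r, by omega, by rw [hne r hr, h1], h2, h3⟩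
    · intro i hi
      have : ∀ m4 : Store, (m4 (arr b 36 0) i = if i = j then (w : ℝ) else f i) →
          m4 (arr b 36 0) i = (Function.update f j w i : ℕ) := by
        intro m4 h
        rw [h, Function.update_apply]
        split_ifs <;> rfl
      apply this
      split_ifs with h1 h2 h2 <;> simp [Store.write_apply, h2]
      · exact h36' i (by omega)
      · exact h36' i (by omega)
  · rintro m' - - ⟨f, hnet, -, h36⟩
    exact ⟨f, h36, hnet⟩

end
end RealRAM

/-! ### Operations on labelled clusters: merging, testing, selecting -/

namespace RealRAM

noncomputable section

/-! ### Sketches of unions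

Tags of the working arrays: `13` flag, `25` current label; `35` sizes of the unions, `36` labels,
`41` sketches, `42` sketches of the unions. -/

/-- The union of the sets with label `c` among the first `n` ones. -/
def fiberUnion {ι : Type} [DecidableEq ι] (S : ℕ → Finset ι) (f : ℕ → ℕ) (n c : ℕ) : Finset ι :=
  ((Finset.range n).filter fun j => f j = c).biUnion S

/-- The number of sets with label `c` among the first `n` ones. -/
def fiberCard (f : ℕ → ℕ) (n c : ℕ) : ℕ := ((Finset.range n).filter fun j => f j = c).card

theorem fiberCard_succ (f : ℕ → ℕ) (n c : ℕ) :
    fiberCard f (n + 1) c = fiberCard f n c + if f n = c then 1 else 0 := by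
  unfold fiberCard
  rw [Finset.range_add_one, Finset.filter_insert]
  split_ifs with h
  · rw [Finset.card_insert_of_notMem (by simp)]
  · rfl

theorem fiberCard_pos {f : ℕ → ℕ} {n j : ℕ} (hj : j < n) : 0 < fiberCard f n (f j) :=
  Finset.card_pos.2 ⟨j, by simp [hj]⟩

theorem fiberUnion_succ_of_ne {ι : Type} [DecidableEq ι] (S : ℕ → Finset ι) {f : ℕ → ℕ} {n c : ℕ}
    (h : f n ≠ c) : fiberUnion S f (n + 1) c = fiberUnion S f n c := by
  unfold fiberUnion
  rw [Finset.range_add_one, Finset.filter_insert, if_neg h]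

theorem fiberUnion_succ_self {ι : Type} [DecidableEq ι] (S : ℕ → Finset ι) (f : ℕ → ℕ) (n : ℕ) :
    fiberUnion S f (n + 1) (f n) = fiberUnion S f n (f n) ∪ S n := by
  unfold fiberUnion
  rw [Finset.range_add_one, Finset.filter_insert, if_pos rfl, Finset.biUnion_insert,
    Finset.union_comm]

theorem fiberUnion_eq_empty {ι : Type} [DecidableEq ι] (S : ℕ → Finset ι) {f : ℕ → ℕ} {n c : ℕ}
    (h : fiberCard f n c = 0) : fiberUnion S f n c = ∅ := by
  unfold fiberUnion
  rw [Finset.card_eq_zero.1 h, Finset.biUnion_empty]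

variable (σ : SketchScheme)

def fiberClear : Cmd :=
  .for σ.base 8 (.var σ.base 2) (.assign (arr σ.base 35 0) (.var σ.base 8) (.const 0))

def fiberStep : Cmd := .block [
  .set σ.base 25 (.get (arr σ.base 36 0) (.var σ.base 8)),
  .cond (.get (arr σ.base 35 0) (.var σ.base 25)) (.const 0)
    (.copy (arr σ.base 42) (fun _ => .var σ.base 25) (arr σ.base 41) (fun _ => .var σ.base 8)
      σ.size)
    (mergeCall σ 42 25 41 8),
  .assign (arr σ.base 35 0) (.var σ.base 25)
    (.add (.get (arr σ.base 35 0) (.var σ.base 25)) (.const 1))]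

/-- Merge the sketches of the sets with the same label. -/
def fiberCmd : Cmd :=
  .seq (fiberClear σ) (.for σ.base 8 (.var σ.base 2) (fiberStep σ))

theorem within_fiberStep : (fiberStep σ).Within σ.base [25, 35, 42] := by
  simp [fiberStep, within_mergeCall, Cmd.within_copy]

theorem within_fiberCmd : (fiberCmd σ).Within σ.base [8, 25, 35, 42] := by
  simp [fiberCmd, fiberClear, (within_fiberStep σ).mono]

variable {σ}

/-- The memory holds the sketches of the unions of the first `j` sets. -/
structure FiberMem {ι : Type} [DecidableEq ι] (σ : SketchScheme)
    (sk : Finset ι → Fin σ.size → ℝ) (m : Store) (n : ℕ) (S : ℕ → Finset ι) (f : ℕ → ℕ) (j : ℕ) :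
    Prop where
  card : ∀ c < n, m (arr σ.base 35 0) c = fiberCard f j c
  row : ∀ c < n, 0 < fiberCard f j c → Row σ.base 42 m c (sk (fiberUnion S f j c))

theorem FiberMem.congr {ι : Type} [DecidableEq ι] {sk : Finset ι → Fin σ.size → ℝ} {m m' : Store}
    {n : ℕ} {S : ℕ → Finset ι} {f : ℕ → ℕ} {j : ℕ} {L : List ℕ}
    (H : FiberMem σ sk m n S f j) (h : Frame σ.base L m m') (h35 : 35 ∉ L) (h42 : 42 ∉ L) :
    FiberMem σ sk m' n S f j :=
  ⟨fun c hc => by rw [h _ _ h35, H.card c hc], fun c hc hp l => by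
    rw [h _ _ h42, H.row c hc hp l]⟩

/-- The sketch of the empty set is not part of the input. So the first set with a given label is
copied and only further ones are merged, the counters telling the two cases apart. Here and below,
`K` is chosen before all data that vary with the input. -/
theorem exists_HT_fiberCmd (σ : SketchScheme) : ∃ K : ℕ, ∀ {ι : Type} [DecidableEq ι]
    {F : Set (Finset ι)} {sk : Finset ι → Fin σ.size → ℝ}, IsSketch σ F sk →
    ∀ (m : Store) (n : ℕ) (S : ℕ → Finset ι) (f : ℕ → ℕ), m (arr σ.base 2 0) 0 = n →
    (∀ j < n, f j < n ∧ m (arr σ.base 36 0) j = f j) →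
    (∀ j < n, Row σ.base 41 m j (sk (S j))) →
    (∀ i < n, ∀ j < n, i ≠ j → Disjoint (S i) (S j)) →
    HT (fiberCmd σ) m (K * (n + 1)) fun m' => FiberMem σ sk m' n S f n := by
  set c0 := Cmd.cost (.copy (arr σ.base 42) (fun _ => .var σ.base 25) (arr σ.base 41) (fun _ => .var σ.base 8)
      σ.size)
  set c1 := (3 * (Cmd.copy (fun _ => 0) (fun l => .const l) (fun _ => 0) (fun _ => .const 0)
        σ.size).cost + σ.time + 5)
  refine ⟨c0 + c1 + 22, fun {ι} _ {F sk} hsk m n S f hn hf hS hdisj => ?_⟩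
  refine .seq (T := 7 * (n + 1)) (T' := (c0 + c1 + 8 + 6) * (n + 1)) ?_
    (by ring_nf; omega)
  refine HT.mono (HT.within (b := σ.base) (L := [8, 35]) (by simp [fiberClear]) (HT.for (b := σ.base) (t := 8)
    (L := [35]) (by simp) (by simp) (n := n) (T := 1) (m := m)
    (Q := fun m' => ∀ j < n, m' (arr σ.base 35 0) j = 0)
    (fun j m' => ∀ i < j, m' (arr σ.base 35 0) i = 0) ?_ ?_ ?_ ?_)) (by omega) ?_
  · intro m' hf
    rw [Term.eval_var, hf _ _ (by simp), hn]
  · simp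
  · intro j hj m' hf hv hI
    refine .assign fun i hi => ?_
    simp only [Store.write_apply, Term.eval, Term.eval_var, hv, arr_inj, Int.floor_natCast]
    norm_num
    intro hij
    exact hI i (by omega)
  · intro m' _ _ h
    exact h
  rintro m1 ⟨h35, f1⟩
  refine HT.for (L := [25, 35, 42]) (within_fiberStep σ) (by simp) (n := n) (T := c0 + c1 + 8)
    (fun j m' => FiberMem σ sk m' n S f j) ?_ ?_ ?_ ?_
  · intro m' hf
    rw [Term.eval_var, hf _ _ (by simp), f1 _ _ (by simp), hn]
  · refine FiberMem.congr (L := [8]) (m := m1) ⟨fun c hc => ?_, fun c hc h => ?_⟩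
      ((Frame.refl _).write (by simp) _ _ _) (by simp) (by simp)
    · rw [h35 c hc]
      simp [fiberCard]
    · simp [fiberCard] at h
  · intro j hj m' hf' hv H
    obtain ⟨hfj, hfm⟩ := hf j hj
    refine .seq (T := 1) (T' := c0 + c1 + 6) (.set ?_) (by omega)
    have e36 : (Term.get (arr σ.base 36 0) (.var σ.base 8)).eval m' = f j := by
      simp only [Term.eval, Term.eval_var, hv, Int.floor_natCast]
      rw [hf' _ _ (by simp), f1 _ _ (by simp), hfm]
    rw [e36]
    set m2 := m'.write (arr σ.base 25 0) 0 (f j) with hm2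
    have f2 : Frame σ.base [25] m' m2 := (Frame.refl _).write (by simp) _ _ _
    have H2 := H.congr f2 (by simp) (by simp)
    have e25 : m2 (arr σ.base 25 0) 0 = f j := by simp [m2, Store.write_apply]
    have e8 : m2 (arr σ.base 8 0) 0 = j := by rw [f2 _ _ (by simp), hv]
    have r41 : Row σ.base 41 m2 j (sk (S j)) := fun l => by
      rw [f2 _ _ (by simp), hf' _ _ (by simp), f1 _ _ (by simp), hS j hj l]
    have hcard : (Term.get (arr σ.base 35 0) (.var σ.base 25)).eval m2 = fiberCard f j (f j) := by
      simp only [Term.eval, Term.eval_var, e25, Int.floor_natCast]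
      exact H2.card _ hfj
    refine .seq (T := c0 + c1 + 1) (T' := 4) ?_ (by omega)
    refine HT.mono (T := c0 + c1 + 1) (Q := fun m3 => Row σ.base 42 m3 (f j)
      (sk (fiberUnion S f (j + 1) (f j))) ∧ (∀ l (z : ℤ), z ≠ f j →
        m3 (arr σ.base 42 l) z = m2 (arr σ.base 42 l) z) ∧ Frame σ.base [42] m2 m3)
      (.cond (T := c0 + c1) (fun h => ?_) (fun h => ?_) le_rfl) le_rfl ?_
    · rw [hcard] at h
      have h0 : fiberCard f j (f j) = 0 := by
        simp only [Term.eval] at h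
        exact_mod_cast le_antisymm h (by simp)
      obtain ⟨hE1, hE2⟩ := Cmd.exec_copy (arr σ.base 42) (fun _ => .var σ.base 25) (arr σ.base 41)
        (fun _ => .var σ.base 8) σ.size m2 (fun _ => f j) (fun _ => j)
        (fun m3 h3 l => by rw [Term.eval_var, h3 _ (by simp), e25, Int.floor_natCast])
        (fun m3 h3 l => by rw [Term.eval_var, h3 _ (by simp), e8, Int.floor_natCast])
        (fun l l' hl h => hl (by simpa using h.1))
        (fun l l' hl h => by simp at h)
      refine (HT.exec (by simp) ⟨fun l => ?_, fun l z hz => ?_, fun t i ht => ?_⟩).mono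
        (T := c0) (by omega) fun _ => id
      · rw [hE1 l l.2, r41 l, fiberUnion_succ_self, fiberUnion_eq_empty S h0, Finset.empty_union]
      · exact hE2 _ _ fun _ _ h => hz h.2
      · funext z
        refine hE2 _ _ ?_
        rintro l - ⟨h, -⟩
        rw [arr_inj] at h
        simp [h.1] at ht
    · rw [hcard] at h
      have h0 : 0 < fiberCard f j (f j) := by
        simp only [Term.eval] at h
        push Not at h
        exact_mod_cast h
      refine (HT.mergeCall hsk 42 25 41 8 m2 j (f j) (by rw [e8]; simp) (by rw [e25]; simp) (by simp)
        (H2.row _ hfj h0) r41 ?_).mono (by omega) ?_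
      · unfold fiberUnion
        rw [Finset.disjoint_biUnion_left]
        intro i hi
        simp only [Finset.mem_filter, Finset.mem_range] at hi
        exact hdisj i (by omega) j hj (by omega)
      · rintro m3 ⟨h1, h2, h3⟩
        rw [fiberUnion_succ_self]
        exact ⟨h1, h2, h3⟩
    · rintro m3 ⟨h42, h42', f3⟩
      refine .seq (T := 1) (T' := 1) (.assign (.skip ?_)) (by omega)
      have e25' : m3 (arr σ.base 25 0) 0 = f j := by rw [f3 _ _ (by simp), e25]
      have e35 : ∀ c : ℕ, c < n → m3 (arr σ.base 35 0) c = fiberCard f j c := fun c hc => by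
        rw [f3 _ _ (by simp), H2.card c hc]
      refine FiberMem.congr (L := [8]) ⟨fun c hc => ?_, fun c hc hp => ?_⟩
        ((Frame.refl _).write (by simp) _ _ _) (by simp) (by simp)
      · simp only [Store.write_apply, Term.eval, Term.eval_var, e25', Int.floor_natCast,
          fiberCard_succ, e35 _ hfj]
        by_cases hcf : c = f j
        · simp [hcf]
        · simp [hcf, Ne.symm hcf, e35 c hc]
      · intro l
        rw [Store.write_of_ne _ _ _ (by simp)]
        by_cases hcf : c = f j
        · subst hcf
          exact h42 l
        · rw [h42' _ _ (by exact_mod_cast hcf), fiberUnion_succ_of_ne S (Ne.symm hcf)]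
          refine H2.row c hc ?_ l
          rwa [fiberCard_succ, if_neg (Ne.symm hcf)] at hp
  · intro m' _ _ h
    exact h

/-! ### Testing all unions -/

def oracleStep (σ : SketchScheme) : Cmd :=
  .cond (.const 1) (.get (arr σ.base 35 0) (.var σ.base 8))
    (.seq (oracleCall σ 42 8)
      (.cond (.get 1 (.const 0)) (.const 0) (.set σ.base 13 (.const 0)) .skip)) .skip

/-- Test whether all unions belong to the family. -/
def oracleCmd (σ : SketchScheme) : Cmd :=
  .seq (.set σ.base 13 (.const 1)) (.for σ.base 8 (.var σ.base 2) (oracleStep σ))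

theorem within_oracleStep (σ : SketchScheme) : (oracleStep σ).Within σ.base [13] := by
  simp [oracleStep, within_oracleCall]

theorem within_oracleCmd (σ : SketchScheme) : (oracleCmd σ).Within σ.base [8, 13] := by
  simp [oracleCmd, (within_oracleStep σ).mono]

open Classical in
/-- The truth value of a proposition as a number. -/
def truth (P : Prop) : ℝ := if P then 1 else 0

theorem truth_of {P : Prop} (h : P) : truth P = 1 := if_pos h

theorem truth_of_not {P : Prop} (h : ¬ P) : truth P = 0 := if_neg h

theorem exists_HT_oracleCmd (σ : SketchScheme) : ∃ K : ℕ, ∀ {ι : Type} [DecidableEq ι]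
    {F : Set (Finset ι)} {sk : Finset ι → Fin σ.size → ℝ}, IsSketch σ F sk →
    ∀ (m : Store) (n : ℕ) (S : ℕ → Finset ι) (f : ℕ → ℕ), m (arr σ.base 2 0) 0 = n →
    (∀ j < n, f j < n) → FiberMem σ sk m n S f n →
    HT (oracleCmd σ) m (K * (n + 1)) fun m' =>
      m' (arr σ.base 13 0) 0 = truth (∀ j < n, fiberUnion S f n (f j) ∈ F) := by
  set c0 := (Cmd.copy (fun _ => 0) (fun l => .const l) (arr σ.base 42)
      (fun _ => .var σ.base 8) σ.size).cost + σ.time + 1 with hc0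
  refine ⟨c0 + 20, fun {ι} _ {F sk} hsk m n S f hn hf H => ?_⟩
  refine .seq (T := 1) (T' := (c0 + 4 + 6) * (n + 1)) (.set ?_)
    (by ring_nf; omega)
  refine HT.for (L := [13]) (within_oracleStep σ) (by simp) (n := n) (T := c0 + 4)
    (fun j m' => m' (arr σ.base 13 0) 0 =
      truth (∀ c < j, 0 < fiberCard f n c → fiberUnion S f n c ∈ F)) ?_ ?_ ?_ ?_
  · intro m' hf
    rw [Term.eval_var, hf _ _ (by simp), Store.write_of_ne _ _ _ (by simp), hn]
  · simp [Store.write_apply, Term.eval, truth]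
  · intro j hj m' hf' hv hI
    have f0 : Frame σ.base [8, 13] m m' :=
      ((Frame.refl m).write (L := [8, 13]) (by simp) _ _ _).trans hf'
    have H' := H.congr f0 (by simp) (by simp)
    have e35 : (Term.get (arr σ.base 35 0) (.var σ.base 8)).eval m' = fiberCard f n j := by
      simp only [Term.eval, Term.eval_var, hv, Int.floor_natCast]
      exact H'.card j hj
    have hsplit : (∀ c < j + 1, 0 < fiberCard f n c → fiberUnion S f n c ∈ F) ↔
        (∀ c < j, 0 < fiberCard f n c → fiberUnion S f n c ∈ F) ∧
        (0 < fiberCard f n j → fiberUnion S f n j ∈ F) := by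
      constructor
      · exact fun h => ⟨fun c hc => h c (by omega), h j (by omega)⟩
      · rintro ⟨h1, h2⟩ c hc
        rcases Nat.lt_succ_iff_lt_or_eq.1 hc with hc | rfl
        · exact h1 c hc
        · exact h2
    refine .cond (T := c0 + 3) (fun h => ?_) (fun h => ?_) le_rfl
    · rw [e35] at h
      have hp : 0 < fiberCard f n j := by
        simp only [Term.eval] at h
        exact_mod_cast h
      refine .seq (T := c0) (T' := 2) ((HT.oracleCall hsk 42 8 m' j (by rw [hv]; simp)
        (H'.row j hj hp)).mono le_rfl ?_) le_rfl
      rintro m2 ⟨h2, f2⟩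
      refine .cond (T := 1) (fun h => .set ?_) (fun h => .skip ?_) le_rfl
      all_goals
        simp only [Term.eval, Int.floor_intCast, h2] at h
        rw [hsplit]
        simp only [Store.write_apply, arr_inj, Term.eval]
      · have hF : fiberUnion S f n j ∉ F := by
          intro hF
          norm_num [hF] at h
        rw [truth_of_not fun h' => hF (h'.2 hp)]
        simp
      · have hF : fiberUnion S f n j ∈ F := by
          by_contra hF
          norm_num [hF] at h
        rw [f2 _ _ (by simp), hI]
        simp [hF]
    · rw [e35] at h
      have hp : ¬ 0 < fiberCard f n j := by
        simp only [Term.eval] at h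
        intro h'
        apply h
        exact_mod_cast h'
      refine HT.mono (.skip ?_) (by omega) fun _ => id
      rw [Store.write_of_ne _ _ _ (by simp), hI, hsplit]
      simp only [hp, false_imp_iff, and_true]
  · intro m' _ _ h
    rw [h]
    congr 1
    -- The loop runs through all conceivable labels; those with a positive counter are the values of
    -- `f`.
    refine propext ⟨fun h j hj => h _ (hf j hj) (fiberCard_pos hj), fun h c hc hp => ?_⟩
    obtain ⟨j, hj⟩ := Finset.card_pos.1 hp
    simp only [Finset.mem_filter, Finset.mem_range] at hj
    exact hj.2 ▸ h j hj.1

/-! ### Selecting points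

Tags of the working arrays: `17` number of selected points. -/

def selectStep (σ : SketchScheme) (d t : ℕ) (x y : Term) : Cmd :=
  .cond x y (.block [
    .copy (arr σ.base 40) (fun _ => .var σ.base 17) (arr σ.base 40) (fun _ => .var σ.base 8) d,
    .copy (arr σ.base 41) (fun _ => .var σ.base 17) (arr σ.base t) (fun _ => .var σ.base 8) σ.size,
    .set σ.base 17 (.add (.var σ.base 17) (.const 1))]) .skip

/-- Keep the points with `x ≤ y`, with the sketches in the arrays with tag `t`. -/
def selectCmd (σ : SketchScheme) (d t : ℕ) (x y : Term) : Cmd := .block [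
  .set σ.base 17 (.const 0),
  .for σ.base 8 (.var σ.base 2) (selectStep σ d t x y),
  .set σ.base 2 (.var σ.base 17)]

theorem within_selectStep (σ : SketchScheme) (d t : ℕ) (x y : Term) :
    (selectStep σ d t x y).Within σ.base [17, 40, 41] := by
  simp [selectStep, Cmd.within_copy]

theorem within_selectCmd (σ : SketchScheme) (d t : ℕ) (x y : Term) :
    (selectCmd σ d t x y).Within σ.base [2, 8, 17, 40, 41] := by
  simp [selectCmd, (within_selectStep σ d t x y).mono]

-- Compaction in place is safe because the next free row, `Nat.count keep j`, never exceeds `j`: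
-- rows not yet examined are intact.
open Classical in
theorem exists_HT_selectCmd (σ : SketchScheme) (d t : ℕ) (x y : Term) (ht : t = 41 ∨ t = 42) :
    ∃ K : ℕ, ∀ (m : Store) (n : ℕ) (X : ℕ → ℕ → ℝ) (V : ℕ → Fin σ.size → ℝ) (keep : ℕ → Prop),
    m (arr σ.base 2 0) 0 = n →
    (∀ j < n, ∀ k < d, m (arr σ.base 40 k) j = X j k) →
    (∀ j < n, keep j → Row σ.base t m j (V j)) →
    (∀ m', Frame σ.base [8, 17, 40, 41] m m' → ∀ j < n, m' (arr σ.base 8 0) 0 = j →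
      (x.eval m' ≤ y.eval m' ↔ keep j)) →
    HT (selectCmd σ d t x y) m (K * (n + 1)) fun m' =>
      m' (arr σ.base 2 0) 0 = Nat.count keep n ∧
      (∀ j < n, keep j → (∀ k < d, m' (arr σ.base 40 k) (Nat.count keep j) = X j k) ∧
        Row σ.base 41 m' (Nat.count keep j) (V j)) := by
  refine ⟨(selectStep σ d t x y).cost + 20, fun m n X V keep hn hX hV hkeep => ?_⟩
  refine .seq (T := 1) (T' := ((selectStep σ d t x y).cost + 6) * (n + 1) + 4) (.set ?_)
    (by ring_nf; omega)
  refine .seq (T := ((selectStep σ d t x y).cost + 6) * (n + 1)) (T' := 3) ?_ (by ring_nf; omega)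
  set m1 := m.write (arr σ.base 17 0) 0 ((Term.const 0).eval m) with hm1
  have f1 : Frame σ.base [17] m m1 := (Frame.refl m).write (by simp) _ _ _
  refine HT.for (L := [17, 40, 41]) (within_selectStep σ d t x y) (by simp) (n := n)
    (fun j m' => m' (arr σ.base 17 0) 0 = Nat.count keep j ∧
      (∀ i < n, j ≤ i → (∀ k < d, m' (arr σ.base 40 k) i = X i k) ∧
        (keep i → Row σ.base t m' i (V i))) ∧
      (∀ i < j, keep i → (∀ k < d, m' (arr σ.base 40 k) (Nat.count keep i) = X i k) ∧
        Row σ.base 41 m' (Nat.count keep i) (V i))) ?_ ?_ ?_ ?_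
  · intro m' hf
    rw [Term.eval_var, hf _ _ (by simp), f1 _ _ (by simp), hn]
  · have f0 : Frame σ.base [8, 17] m (m1.write (arr σ.base 8 0) 0 0) :=
      (f1.mono (by simp)).write (by simp) _ _ _
    refine ⟨by simp [m1, Store.write_apply, Term.eval], fun i hi _ => ⟨fun k hk => ?_,
      fun hki l => ?_⟩, by simp⟩
    · rw [f0 _ _ (by simp), hX i hi k hk]
    · rw [f0 _ _ (by rcases ht with rfl | rfl <;> simp), hV i hi hki l]
  · rintro j hj m' hf hv ⟨h17, hrest, hdone⟩
    have ff : Frame σ.base [8, 17, 40, 41] m m' := (f1.mono (by simp)).trans (hf.mono (by simp))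
    have hk := hkeep m' ff j hj hv
    refine HT.exec (by simp [selectStep, Cmd.Simple]) ?_
    have hcj : Nat.count keep j ≤ j := Nat.count_le _
    by_cases hkj : keep j
    · set c := Nat.count keep j with hc
      obtain ⟨hA1, hA2⟩ := Cmd.exec_copy (arr σ.base 40) (fun _ => .var σ.base 17) (arr σ.base 40)
        (fun _ => .var σ.base 8) d m' (fun _ => c) (fun _ => j)
        (fun m3 h3 l => by rw [Term.eval_var, h3 _ (by simp), h17, Int.floor_natCast])
        (fun m3 h3 l => by rw [Term.eval_var, h3 _ (by simp), hv, Int.floor_natCast])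
        (fun l l' hl h => hl (by simpa using h.1))
        (fun l l' hl h => hl (by simpa using h.1))
      simp only [selectStep, Cmd.exec, hk.2 hkj, if_true, Cmd.block, Cmd.exec_set]
      set m2 := (Cmd.copy (arr σ.base 40) (fun _ => .var σ.base 17) (arr σ.base 40)
        (fun _ => .var σ.base 8) d).exec m' with hm2
      have g2 : ∀ t i, t ≠ 40 → m2 (arr σ.base t i) = m' (arr σ.base t i) := by
        intro t i ht
        funext z
        refine hA2 _ _ ?_
        rintro l - ⟨h, -⟩
        rw [arr_inj] at h
        exact ht h.1
      have ht40 : t ≠ 40 := by rcases ht with rfl | rfl <;> simp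
      obtain ⟨hB1, hB2⟩ := Cmd.exec_copy (arr σ.base 41) (fun _ => .var σ.base 17) (arr σ.base t)
        (fun _ => .var σ.base 8) σ.size m2 (fun _ => c) (fun _ => j)
        (fun m3 h3 l => by rw [Term.eval_var, h3 _ (by simp), g2 _ _ (by simp), h17,
          Int.floor_natCast])
        (fun m3 h3 l => by rw [Term.eval_var, h3 _ (by simp), g2 _ _ (by simp), hv,
          Int.floor_natCast])
        (fun l l' hl h => hl (by simpa using h.1))
        (fun l l' hl h => hl ((arr_inj.1 h.1).2))
      set m3 := (Cmd.copy (arr σ.base 41) (fun _ => .var σ.base 17) (arr σ.base t)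
        (fun _ => .var σ.base 8) σ.size).exec m2 with hm3
      have g3 : ∀ t i, t ≠ 41 → m3 (arr σ.base t i) = m2 (arr σ.base t i) := by
        intro t i ht
        funext z
        refine hB2 _ _ ?_
        rintro l - ⟨h, -⟩
        rw [arr_inj] at h
        exact ht h.1
      set m4 := (m3.write (arr σ.base 17 0) 0 _).write (arr σ.base 8 0) 0 _ with hm4
      have g4 : Frame σ.base [8, 17] m3 m4 :=
        ((Frame.refl _).write (by simp) _ _ _).write (by simp) _ _ _
      have k40 : ∀ k (z : ℤ), z ≠ c → m4 (arr σ.base 40 k) z = m' (arr σ.base 40 k) z :=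
        fun k z hz => by
          rw [g4 _ _ (by simp), g3 _ _ (by simp)]
          exact hA2 _ _ fun _ _ h => hz h.2
      have k41 : ∀ l (z : ℤ), z ≠ c → m4 (arr σ.base 41 l) z = m' (arr σ.base 41 l) z :=
        fun l z hz => by
          rw [g4 _ _ (by simp), hB2 _ _ fun _ _ h => hz h.2, g2 _ _ (by simp)]
      refine ⟨?_, fun i hi hji => ⟨fun k hk' => ?_, fun hki l => ?_⟩, fun i hi hki => ?_⟩
      · simp only [m4, Store.write_apply, Term.eval, Term.eval_var, arr_inj]
        norm_num
        rw [g3 _ _ (by simp), g2 _ _ (by simp), h17, Nat.count_succ, if_pos hkj]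
        push_cast
        rfl
      · rw [k40 _ _ (by omega), (hrest i hi (by omega)).1 k hk']
      · rw [← (hrest i hi (by omega)).2 hki l]
        rcases ht with rfl | rfl
        · exact k41 _ _ (by omega)
        · rw [g4 _ _ (by simp), g3 _ _ (by simp), g2 _ _ (by simp)]
      · rcases Nat.lt_succ_iff_lt_or_eq.1 hi with hi | rfl
        · have hlt : Nat.count keep i < c := Nat.count_strict_mono hki hi
          refine ⟨fun k hk' => ?_, fun l => ?_⟩
          · rw [k40 _ _ (by omega), (hdone i hi hki).1 k hk']
          · rw [k41 _ _ (by omega), (hdone i hi hki).2 l]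
        · refine ⟨fun k hk' => ?_, fun l => ?_⟩
          · rw [g4 _ _ (by simp), g3 _ _ (by simp), hA1 k hk', (hrest i hj le_rfl).1 k hk']
          · rw [g4 _ _ (by simp), hB1 l l.2, g2 _ _ ht40, (hrest i hj le_rfl).2 hki l]
    · simp only [selectStep, Cmd.exec, mt hk.1 hkj, if_false]
      have g4 : Frame σ.base [8] m' (m'.write (arr σ.base 8 0) 0 (j + 1)) :=
        (Frame.refl _).write (by simp) _ _ _
      have ht8 : t ∉ [8] := by rcases ht with rfl | rfl <;> simp
      refine ⟨?_, fun i hi hji => ⟨fun k hk' => ?_, fun hki l => ?_⟩, fun i hi hki => ?_⟩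
      · rw [g4 _ _ (by simp), h17, Nat.count_succ, if_neg hkj, add_zero]
      · rw [g4 _ _ (by simp), (hrest i hi (by omega)).1 k hk']
      · rw [g4 _ _ ht8, (hrest i hi (by omega)).2 hki l]
      · rcases Nat.lt_succ_iff_lt_or_eq.1 hi with hi | rfl
        · refine ⟨fun k hk' => ?_, fun l => ?_⟩
          · rw [g4 _ _ (by simp), (hdone i hi hki).1 k hk']
          · rw [g4 _ _ (by simp), (hdone i hi hki).2 l]
        · exact absurd hki hkj
  · rintro m' hf - ⟨h17, -, hdone⟩
    refine .seq (T := 1) (T' := 1) (.set (.skip ⟨?_, fun j hj hkj => ?_⟩)) (by omega)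
    · simp [Store.write_apply, h17]
    · refine ⟨fun k hk => ?_, fun l => ?_⟩
      · rw [Store.write_of_ne _ _ _ (by simp), (hdone j hj hkj).1 k hk]
      · rw [Store.write_of_ne _ _ _ (by simp), (hdone j hj hkj).2 l]

end
end RealRAM

/-! ### Connectivity clusterings -/

section Clusterings

variable {ι : Type} {d : ℕ} {p : ι → EuclideanSpace ℝ (Fin d)}

/-- Two points are connected in the distance graph. -/
def Conn (p : ι → EuclideanSpace ℝ (Fin d)) (r : ℝ) (i j : ι) : Prop :=
  (distanceGraph p r).Reachable i j

theorem Conn.refl {r : ℝ} (i : ι) : Conn p r i i := SimpleGraph.Reachable.refl i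

theorem Conn.symm {r : ℝ} {i j : ι} (h : Conn p r i j) : Conn p r j i :=
  SimpleGraph.Reachable.symm h

theorem Conn.trans {r : ℝ} {i j k : ι} (h : Conn p r i j) (h' : Conn p r j k) : Conn p r i k :=
  SimpleGraph.Reachable.trans h h'

theorem distanceGraph_adj {r : ℝ} {i j : ι} :
    (distanceGraph p r).Adj i j ↔ i ≠ j ∧ dist (p i) (p j) ≤ r := by
  rw [distanceGraph, SimpleGraph.fromRel_adj, dist_comm (p j), or_self]

theorem Conn.of_dist_le {r : ℝ} {i j : ι} (h : dist (p i) (p j) ≤ r) : Conn p r i j := by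
  by_cases hij : i = j
  · exact hij ▸ Conn.refl i
  · exact (distanceGraph_adj.2 ⟨hij, h⟩).reachable

/-- The standard way below to confine a component: exhibit a set closed under steps of length at
most `r`. -/
theorem Conn.mem {r : ℝ} {A : Set ι} (hA : ∀ x ∈ A, ∀ y, dist (p x) (p y) ≤ r → y ∈ A)
    {i j : ι} (h : Conn p r i j) (hi : i ∈ A) : j ∈ A := by
  obtain ⟨w⟩ := h
  induction w with
  | nil => exact hi
  | cons hadj _ ih => exact ih (hA _ hi _ (distanceGraph_adj.1 hadj).2)

theorem Conn.mono {r r' : ℝ} (hr : r ≤ r') {i j : ι} (h : Conn p r i j) : Conn p r' i j :=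
  Conn.mem (A := {j | Conn p r' i j})
    (fun _ hx _ hxy => Conn.trans hx (.of_dist_le (hxy.trans hr))) h (Conn.refl i)

theorem mem_fiberUnion [DecidableEq ι] {S : ℕ → Finset ι} {f : ℕ → ℕ} {m c : ℕ} {x : ι} :
    x ∈ RealRAM.fiberUnion S f m c ↔ ∃ j < m, f j = c ∧ x ∈ S j := by
  simp [RealRAM.fiberUnion, and_assoc]

variable [Fintype ι]

open Classical in
/-- The set of the connectivity clustering that contains a given point. -/
noncomputable def comp (p : ι → EuclideanSpace ℝ (Fin d)) (r : ℝ) (i : ι) : Finset ι :=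
  Finset.univ.filter (Conn p r i)

@[simp] theorem mem_comp {r : ℝ} {i j : ι} : j ∈ comp p r i ↔ Conn p r i j := by simp [comp]

theorem comp_mono {r r' : ℝ} (hr : r ≤ r') (i : ι) : comp p r i ⊆ comp p r' i := fun j hj => by
  rw [mem_comp] at hj ⊢
  exact hj.mono hr

variable {F : Set (Finset ι)}

/-! ### Nets of clusters -/

/-- `m` disjoint clusters `S j` with representatives `q j`. They are connected at radius `g`, a
small fraction of the optimal radius, and the points outside of them are separated from them at
the optimal radius. -/
structure NetInv (p : ι → EuclideanSpace ℝ (Fin d)) (F : Set (Finset ι)) (ropt : ℝ) (m : ℕ)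
    (S : ℕ → Finset ι) (q : ℕ → ι) (g : ℝ) : Prop where
  nonneg : 0 ≤ g
  le : 16 * g ≤ ropt
  mem : ∀ j < m, q j ∈ S j
  disj : ∀ i < m, ∀ j < m, i ≠ j → Disjoint (S i) (S j)
  conn : ∀ j < m, ∀ x ∈ S j, Conn p g (q j) x
  near : ∀ j < m, ∀ x ∈ S j, dist (p (q j)) (p x) ≤ 2 * g
  sep : ∀ i < m, ∀ j < m, i ≠ j → 2 * g < 3 * dist (p (q i)) (p (q j))
  far : ∀ j < m, ∀ x ∈ S j, ∀ y, (∀ i < m, y ∉ S i) → ropt < dist (p x) (p y)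
  pruned : ∀ x, (∀ i < m, x ∉ S i) → comp p g x ∈ F

namespace NetInv

variable {ropt : ℝ} {m : ℕ} {S : ℕ → Finset ι} {q : ℕ → ι} {g : ℝ}

theorem initial (hr : 0 ≤ ropt) (hq : ∀ x, ∃ j < m, q j = x)
    (hinj : ∀ i < m, ∀ j < m, i ≠ j → p (q i) ≠ p (q j)) :
    NetInv p F ropt m (fun j => {q j}) q 0 where
  nonneg := le_rfl
  le := by simpa using hr
  mem j _ := by simp
  disj i hi j hj hij := by
    rw [Finset.disjoint_singleton]
    exact fun h => hinj i hi j hj hij (by rw [h])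
  conn j _ x hx := by
    rw [Finset.mem_singleton] at hx
    exact hx ▸ Conn.refl _
  near j _ x hx := by
    rw [Finset.mem_singleton] at hx
    simp [hx]
  sep i hi j hj hij := by
    have := dist_pos.2 (hinj i hi j hj hij)
    linarith
  far j _ x _ y hy := by
    obtain ⟨i, hi, rfl⟩ := hq y
    exact absurd (Finset.mem_singleton_self _) (hy i hi)
  pruned y hy := by
    obtain ⟨i, hi, rfl⟩ := hq y
    exact absurd (Finset.mem_singleton_self _) (hy i hi)

/-- Each cluster stays within `2 * g` of its representative; this is the whole loss in replacing
points by representatives. -/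
theorem dist_rep_le (H : NetInv p F ropt m S q g) {i j : ℕ} (hi : i < m) (hj : j < m) {x y : ι}
    (hx : x ∈ S i) (hy : y ∈ S j) : dist (p (q i)) (p (q j)) ≤ dist (p x) (p y) + 4 * g := by
  have h1 := H.near i hi x hx
  have h2 := H.near j hj y hy
  rw [dist_comm] at h2
  have h3 := dist_triangle4 (p (q i)) (p x) (p y) (p (q j))
  linarith

end NetInv

variable [DecidableEq ι]

/-- Whole components are the best choice: a part of any admissible partition sits inside a
component, which then inherits membership by upward closure. -/
theorem mem_connectedRadii (hF : IsUpperSet F) {r : ℝ} :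
    r ∈ connectedRadii p F ↔ 0 ≤ r ∧ ∀ i, comp p r i ∈ F := by
  refine and_congr_right fun _ => ⟨?_, fun h => ?_⟩
  · rintro ⟨Q, hQ⟩ i
    obtain ⟨A, hA, hiA⟩ := Q.exists_mem (Finset.mem_univ i)
    obtain ⟨hAF, X, ⟨K, rfl⟩, hAX⟩ := hQ A hA
    refine hF (fun j hj => ?_) hAF
    have hi : i ∈ K.supp := hAX hiA
    have hj' : j ∈ K.supp := hAX hj
    rw [SimpleGraph.ConnectedComponent.mem_supp_iff] at hi hj'
    rw [mem_comp]
    exact SimpleGraph.ConnectedComponent.exact (hi.trans hj'.symm)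
  · classical
    refine ⟨Finpartition.ofSetoid (distanceGraph p r).reachableSetoid, fun A hA => ?_⟩
    obtain ⟨i, rfl⟩ : ∃ i, comp p r i = A := by
      rw [Finpartition.ofSetoid, Finpartition.ofSetSetoid_parts, Finset.mem_image] at hA
      obtain ⟨i, -, rfl⟩ := hA
      refine ⟨i, ?_⟩
      ext j
      simp only [mem_comp, Conn, Finset.mem_filter, Finset.mem_univ, true_and]
      rfl
    refine ⟨h i, _, ⟨(distanceGraph p r).connectedComponentMk i, rfl⟩, fun j hj => ?_⟩
    rw [Finset.mem_coe, mem_comp] at hj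
    rw [SimpleGraph.ConnectedComponent.mem_supp_iff]
    exact SimpleGraph.ConnectedComponent.sound hj.symm

/-- Rounding a radius down to the largest pairwise distance below it, or to zero, preserves all
edges. Hence finitely many candidates suffice. -/
theorem exists_isLeast_connectedRadii (hF : IsUpperSet F) (h : (connectedRadii p F).Nonempty) :
    ∃ r, IsLeast (connectedRadii p F) r := by
  classical
  let D : Finset ℝ := insert 0 (Finset.univ.image fun x : ι × ι => dist (p x.1) (p x.2))
  have key : ∀ r ∈ connectedRadii p F, ∃ r' ∈ D, r' ≤ r ∧ r' ∈ connectedRadii p F := by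
    intro r hr
    rw [mem_connectedRadii hF] at hr
    have hne : (D.filter (· ≤ r)).Nonempty := ⟨0, by simp [D, hr.1]⟩
    obtain ⟨r', hr', hmax⟩ := Finset.exists_max_image _ id hne
    rw [Finset.mem_filter] at hr'
    refine ⟨r', hr'.1, hr'.2, (mem_connectedRadii hF).2 ⟨?_, fun i => ?_⟩⟩
    · exact hmax 0 (by simp [D, hr.1])
    · refine hF (fun j hj => ?_) (hr.2 i)
      rw [mem_comp] at hj ⊢
      refine Conn.mem (A := {j | Conn p r' i j}) (fun x hx y hxy => Conn.trans hx ?_) hj (.refl i)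
      refine .of_dist_le (hmax _ ?_)
      rw [Finset.mem_filter]
      exact ⟨Finset.mem_insert_of_mem (Finset.mem_image.2 ⟨(x, y), Finset.mem_univ _, rfl⟩), hxy⟩
  obtain ⟨r, hr⟩ := h
  obtain ⟨r', hr', -, hr'F⟩ := key r hr
  obtain ⟨r0, hr0, hmin⟩ := Finset.exists_min_image (D.filter (· ∈ connectedRadii p F)) id
    ⟨r', by simp [hr', hr'F]⟩
  rw [Finset.mem_filter] at hr0
  refine ⟨r0, hr0.2, fun s hs => ?_⟩
  obtain ⟨s', hs', hle, hs'F⟩ := key s hs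
  exact (hmin s' (by simp [hs', hs'F])).trans hle

/-! ### Consequences for the optimal radius -/

namespace NetInv

variable {ropt : ℝ} {m : ℕ} {S : ℕ → Finset ι} {q : ℕ → ι} {g : ℝ}

/-- Components meeting a live cluster contain a tested union; those of removed points are covered by
`pruned`. -/
theorem le_of_forall_mem (H : NetInv p F ropt m S q g) (hF : IsUpperSet F)
    (hopt : IsLeast (connectedRadii p F) ropt) {f : ℕ → ℕ} {r : ℝ} (hr : g ≤ r)
    (hf : ∀ i < m, ∀ j < m, f i = f j → Conn p r (q i) (q j))
    (h : ∀ j < m, RealRAM.fiberUnion S f m (f j) ∈ F) : ropt ≤ r := by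
  refine hopt.2 ((mem_connectedRadii hF).2 ⟨H.nonneg.trans hr, fun x => ?_⟩)
  by_cases hx : ∀ i < m, x ∉ S i
  · exact hF (comp_mono hr x) (H.pruned x hx)
  · push Not at hx
    obtain ⟨j, hj, hx⟩ := hx
    refine hF (fun y hy => ?_) (h j hj)
    obtain ⟨i, hi, hij, hy⟩ := mem_fiberUnion.1 hy
    rw [mem_comp]
    exact ((H.conn j hj x hx).mono hr).symm.trans
      ((hf j hj i hi hij.symm).trans ((H.conn i hi y hy).mono hr))

/-- If `ropt ≤ r`, a component at radius `ropt` starting in a live cluster cannot reach a removed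
point because of `far`, nor change its label because of `dist_rep_le`. Every tested union then
contains a member of the family. -/
theorem lt_of_not_forall_mem (H : NetInv p F ropt m S q g) (hF : IsUpperSet F)
    (hopt : IsLeast (connectedRadii p F) ropt) {f : ℕ → ℕ} {r : ℝ}
    (hf : ∀ i < m, ∀ j < m, dist (p (q i)) (p (q j)) ≤ r + 4 * g → f i = f j)
    (h : ¬ ∀ j < m, RealRAM.fiberUnion S f m (f j) ∈ F) : r < ropt := by
  by_contra! hr
  refine h fun j hj => hF (fun y hy => ?_) (((mem_connectedRadii hF).1 hopt.1).2 (q j))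
  rw [mem_comp] at hy
  refine Conn.mem (A := RealRAM.fiberUnion S f m (f j)) (fun x hx y hxy => ?_) hy
    (mem_fiberUnion.2 ⟨j, hj, rfl, H.mem j hj⟩)
  obtain ⟨i, hi, hij, hx⟩ := mem_fiberUnion.1 hx
  by_cases hy : ∀ i < m, y ∉ S i
  · exact absurd (H.far i hi x hx y hy) (not_lt.2 hxy)
  · push Not at hy
    obtain ⟨k, hk, hy⟩ := hy
    refine mem_fiberUnion.2 ⟨k, hk, ?_, hy⟩
    rw [← hij]
    exact (hf i hi k hk ((H.dist_rep_le hi hk hx hy).trans (by linarith))).symm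

/-- The component at the optimal radius is trapped in `S j`, and `S j` is already connected at
radius `g`. So the smaller radius yields a component that contains it. -/
theorem comp_mem_of_isolated (H : NetInv p F ropt m S q g) (hF : IsUpperSet F)
    (hopt : IsLeast (connectedRadii p F) ropt) {j : ℕ} (hj : j < m)
    (hiso : ∀ i < m, i ≠ j → ropt + 4 * g < dist (p (q j)) (p (q i))) {x : ι} (hx : x ∈ S j) :
    comp p g x ∈ F := by
  refine hF (fun y hy => ?_) (((mem_connectedRadii hF).1 hopt.1).2 x)
  rw [mem_comp] at hy
  rw [mem_comp]
  refine (H.conn j hj x hx).symm.trans (H.conn j hj y (Conn.mem (A := S j) ?_ hy hx))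
  intro x hx y hxy
  by_cases hy : ∀ i < m, y ∉ S i
  · exact absurd (H.far j hj x hx y hy) (not_lt.2 hxy)
  · push Not at hy
    obtain ⟨k, hk, hy⟩ := hy
    by_cases hkj : k = j
    · exact hkj ▸ hy
    · have := H.dist_rep_le hj hk hx hy
      have := hiso k hk hkj
      linarith

/-- A single live cluster is isolated, so radius `g` is feasible and `ropt ≤ g`; together with `16 *
g ≤ ropt` this leaves only zero. -/
theorem eq_zero (H : NetInv p F ropt m S q g) (hF : IsUpperSet F)
    (hopt : IsLeast (connectedRadii p F) ropt) (hm : m ≤ 1) : ropt = 0 := by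
  have h1 : ropt ≤ g := hopt.2 ((mem_connectedRadii hF).2 ⟨H.nonneg, fun x => by
    by_cases hx : ∀ i < m, x ∉ S i
    · exact H.pruned x hx
    · push Not at hx
      obtain ⟨j, hj, hx⟩ := hx
      exact H.comp_mem_of_isolated hF hopt hj (fun i hi hij => by omega) hx⟩)
  have h2 := H.le
  have h3 := H.nonneg
  linarith

/-- Isolation beyond `ropt + 4 * g` serves twice: it keeps the discarded points far from the
surviving clusters, and it makes them satisfied at radius `g`. -/
theorem prune (H : NetInv p F ropt m S q g) (hF : IsUpperSet F)
    (hopt : IsLeast (connectedRadii p F) ropt) {m' : ℕ} {e : ℕ → ℕ} (he : ∀ i < m', e i < m)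
    (hinj : ∀ i < m', ∀ j < m', e i = e j → i = j)
    (hiso : ∀ j < m, (∃ i < m', e i = j) ∨
      ∀ i < m, i ≠ j → ropt + 4 * g < dist (p (q j)) (p (q i))) :
    NetInv p F ropt m' (fun i => S (e i)) (fun i => q (e i)) g where
  nonneg := H.nonneg
  le := H.le
  mem j hj := H.mem _ (he j hj)
  disj i hi j hj hij := H.disj _ (he i hi) _ (he j hj) fun h => hij (hinj i hi j hj h)
  conn j hj := H.conn _ (he j hj)
  near j hj := H.near _ (he j hj)
  sep i hi j hj hij := H.sep _ (he i hi) _ (he j hj) fun h => hij (hinj i hi j hj h)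
  far j hj x hx y hy := by
    by_cases hy' : ∀ i < m, y ∉ S i
    · exact H.far _ (he j hj) x hx y hy'
    · push Not at hy'
      obtain ⟨k, hk, hyk⟩ := hy'
      rcases hiso k hk with ⟨i, hi, rfl⟩ | hiso
      · exact absurd hyk (hy i hi)
      · have h1 := H.dist_rep_le hk (he j hj) hyk hx
        have h2 := hiso (e j) (he j hj) fun h => hy j hj (h ▸ hyk)
        rw [dist_comm (p x)]
        linarith
  pruned x hx := by
    by_cases hx' : ∀ i < m, x ∉ S i
    · exact H.pruned x hx'
    · push Not at hx'
      obtain ⟨k, hk, hxk⟩ := hx'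
      rcases hiso k hk with ⟨i, hi, rfl⟩ | hiso
      · exact absurd hxk (hx i hi)
      · exact H.comp_mem_of_isolated hF hopt hk hiso hxk

/-- The new radius is `3 * l`. Absorption adds at most `3 * l`, so points lie within `3 * l + 2 * g
≤ 2 * (3 * l)` of the new representative. The factor `48` is `16 * 3`, and separation by more than
`2 * l` is exactly what `sep` requires at radius `3 * l`. -/
theorem net (H : NetInv p F ropt m S q g) (hF : IsUpperSet F) {adj : ℕ → ℕ → Prop} {f : ℕ → ℕ}
    {l : ℝ} (hnet : RealRAM.IsNet adj f m) (hl : 2 * g < 3 * l) (hl' : 48 * l ≤ ropt)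
    (hadj : ∀ i < m, ∀ j < m, adj i j → dist (p (q i)) (p (q j)) ≤ 3 * l)
    (hadj' : ∀ i < m, ∀ j < m, dist (p (q i)) (p (q j)) ≤ 2 * l → adj i j)
    {m' : ℕ} {e : ℕ → ℕ} (he : ∀ i < m', e i < m ∧ f (e i) = e i)
    (hinj : ∀ i < m', ∀ j < m', e i = e j → i = j)
    (hsurj : ∀ j < m, f j = j → ∃ i < m', e i = j) :
    NetInv p F ropt m' (fun i => RealRAM.fiberUnion S f m (e i)) (fun i => q (e i)) (3 * l) := by
  have hg := H.nonneg
  have hdist : ∀ j < m, dist (p (q (f j))) (p (q j)) ≤ 3 * l := by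
    intro j hj
    by_cases hjf : f j = j
    · rw [hjf, dist_self]
      linarith
    · rw [dist_comm]
      exact hadj j hj _ ((hnet.le j hj).trans_lt hj) (hnet.mem_adj j hj hjf)
  have hinact : ∀ x, (∀ i < m', x ∉ RealRAM.fiberUnion S f m (e i)) → ∀ i < m, x ∉ S i := by
    intro x hx i hi hxi
    obtain ⟨k, hk, hki⟩ := hsurj (f i) ((hnet.le i hi).trans_lt hi) (hnet.idem i hi)
    exact hx k hk (mem_fiberUnion.2 ⟨i, hi, hki.symm, hxi⟩)
  refine ⟨by linarith, by linarith, ?_, ?_, ?_, ?_, ?_, ?_, ?_⟩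
  · intro j hj
    exact mem_fiberUnion.2 ⟨e j, (he j hj).1, (he j hj).2, H.mem _ (he j hj).1⟩
  · intro i hi j hj hij
    rw [Finset.disjoint_left]
    intro x hx hx'
    obtain ⟨a, ha, hai, hxa⟩ := mem_fiberUnion.1 hx
    obtain ⟨c, hc, hcj, hxc⟩ := mem_fiberUnion.1 hx'
    refine Finset.disjoint_left.1 (H.disj a ha c hc ?_) hxa hxc
    rintro rfl
    exact hij (hinj i hi j hj (hai.symm.trans hcj))
  · intro j hj x hx
    obtain ⟨a, ha, hai, hxa⟩ := mem_fiberUnion.1 hx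
    have := hdist a ha
    rw [hai] at this
    exact (Conn.of_dist_le this).trans ((H.conn a ha x hxa).mono (by linarith))
  · intro j hj x hx
    obtain ⟨a, ha, hai, hxa⟩ := mem_fiberUnion.1 hx
    have h1 := hdist a ha
    rw [hai] at h1
    have h2 := H.near a ha x hxa
    have h3 := dist_triangle (p (q (e j))) (p (q a)) (p x)
    linarith
  · have key : ∀ i < m', ∀ j < m', e j < e i → 2 * l < dist (p (q (e i))) (p (q (e j))) := by
      intro i hi j hj hij
      by_contra! h
      exact hnet.sep _ (he i hi).1 _ hij (he i hi).2 (he j hj).2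
        (hadj' _ (he i hi).1 _ (he j hj).1 h)
    intro i hi j hj hij
    rcases lt_trichotomy (e i) (e j) with h | h | h
    · have := key j hj i hi h
      rw [dist_comm] at this
      linarith
    · exact absurd (hinj i hi j hj h) hij
    · have := key i hi j hj h
      linarith
  · intro j hj x hx y hy
    obtain ⟨a, ha, hai, hxa⟩ := mem_fiberUnion.1 hx
    exact H.far a ha x hxa y (hinact y hy)
  · intro x hx
    exact hF (comp_mono (by linarith) x) (H.pruned x (hinact x hx))

end NetInv

end Clusterings

/-! ### Progress of a random round -/

section Progress

open Finset

/-- At most half of the points that have another point at distance at most `l` are net points. -/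
theorem card_close_le {m : ℕ} {D : ℕ → ℕ → ℝ} (hsymm : ∀ i j, D i j = D j i)
    (htri : ∀ i j k, D i k ≤ D i j + D j k) {adj : ℕ → ℕ → Prop}
    {f : ℕ → ℕ} {l : ℝ} (hl : 0 ≤ l) (hnet : RealRAM.IsNet adj f m)
    (hadj : ∀ i < m, ∀ j < m, D i j ≤ 2 * l → adj i j) (A : Finset ℕ) (hA : A ⊆ range m)
    (hclose : ∀ i ∈ A, ∃ j < m, j ≠ i ∧ D i j ≤ l) :
    A.card + 2 * ((range m).filter fun j => f j = j).card ≤ 2 * m := by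
  classical
  have hsep : ∀ i < m, ∀ j < m, f i = i → f j = j → D i j ≤ 2 * l → i = j := by
    intro i hi j hj hfi hfj hij
    rcases lt_trichotomy i j with h | h | h
    · exact absurd (hadj j hj i hi (by rwa [hsymm])) (hnet.sep j hj i h hfj hfi)
    · exact h
    · exact absurd (hadj i hi j hj hij) (hnet.sep i hi j h hfi hfj)
  choose! nb h1 h2 h3 using hclose
  -- A close neighbour of a net point is not a net point, and two net points sharing one would be
  -- within `2 * l` of each other.
  have hle : (A.filter fun j => f j = j).card ≤ ((range m).filter fun j => ¬ f j = j).card := by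
    refine card_le_card_of_injOn nb (fun i hi => ?_) (fun i hi j hj hij => ?_)
    · simp only [coe_filter, Set.mem_ofPred_eq] at hi
      simp only [coe_filter, mem_range, Set.mem_ofPred_eq]
      refine ⟨h1 i hi.1, fun h => h2 i hi.1 ?_⟩
      have := h3 i hi.1
      exact (hsep i (mem_range.1 (hA hi.1)) _ (h1 i hi.1) hi.2 h (by linarith)).symm
    · simp only [coe_filter, Set.mem_ofPred_eq] at hi hj
      have e1 := h3 i hi.1
      have e2 := h3 j hj.1
      rw [← hij, hsymm] at e2
      have e3 := htri i (nb i) j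
      exact hsep i (mem_range.1 (hA hi.1)) j (mem_range.1 (hA hj.1)) hi.2 hj.2 (by linarith)
  have h4 := card_filter_add_card_filter_not (s := A) fun j => f j = j
  have h5 := card_filter_add_card_filter_not (s := range m) fun j => f j = j
  have h6 : (A.filter fun j => ¬ f j = j).card ≤ ((range m).filter fun j => ¬ f j = j).card :=
    card_le_card (filter_subset_filter _ hA)
  rw [card_range] at h5
  omega

/-- All selected indices lie below the one with the largest value, whose rank is at most `t`. -/
theorem card_filter_rank_le {α : Type*} [LinearOrder α] (m t : ℕ) (u : ℕ → α) :
    ((range m).filter fun j => ((range m).filter fun i => u i ≤ u j).card ≤ t).card ≤ t := by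
  set A := (range m).filter fun j => ((range m).filter fun i => u i ≤ u j).card ≤ t
  rcases A.eq_empty_or_nonempty with h | h
  · simp [h]
  · obtain ⟨j, hj, hmax⟩ := exists_max_image A u h
    refine le_trans (card_le_card fun i hi => ?_) (mem_filter.1 hj).2
    exact mem_filter.2 ⟨(mem_filter.1 hi).1, hmax i hi⟩

/-- Bound on the number of clusters left after a round with pivot `j`, where `u` contains the
nearest-neighbour distances. -/
noncomputable def roundBound (m : ℕ) (u : ℕ → ℝ) (j : ℕ) : ℕ :=
  max (m - ((range m).filter fun i => u j ≤ u i).card)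
    ((2 * m - ((range m).filter fun i => u i ≤ u j).card) / 2)

/-- At most half of the pivots have rank at most `m / 4` from below or from above; they count with
`m`. Any other pivot leaves at most `7 m / 8` clusters, whichever branch the round takes, so the
average is at most `15 m / 16`. -/
theorem sum_roundBound_le (m : ℕ) (u : ℕ → ℝ) :
    16 * ∑ j ∈ range m, roundBound m u j ≤ 15 * m ^ 2 := by
  set a := fun j => ((range m).filter fun i => u i ≤ u j).card with ha
  set c := fun j => ((range m).filter fun i => u j ≤ u i).card with hc
  have ham : ∀ j, a j ≤ m := fun j => (card_filter_le _ _).trans (card_range m).le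
  have hcm : ∀ j, c j ≤ m := fun j => (card_filter_le _ _).trans (card_range m).le
  set t := m / 4 with ht
  have h1 : ((range m).filter fun j => a j ≤ t).card ≤ t := card_filter_rank_le m t u
  have h2 : ((range m).filter fun j => c j ≤ t).card ≤ t :=
    card_filter_rank_le m t fun j => OrderDual.toDual (u j)
  set B := (range m).filter fun j => a j ≤ t ∨ c j ≤ t with hB
  have hBc : B.card ≤ 2 * t := by
    rw [hB, filter_or]
    exact (card_union_le _ _).trans (by omega)
  have hterm : ∀ j ∈ range m, 8 * roundBound m u j ≤ 8 * m - m * if j ∈ B then 0 else 1 := by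
    intro j hj
    have e1 := ham j
    have e2 := hcm j
    have e : roundBound m u j = max (m - c j) ((2 * m - a j) / 2) := rfl
    rw [e]
    split_ifs with hjB
    · rw [mul_zero, Nat.sub_zero]
      rcases max_cases (m - c j) ((2 * m - a j) / 2) with h | h <;> omega
    · have : t < a j ∧ t < c j := by
        by_contra hcon
        exact hjB (mem_filter.2 ⟨hj, by omega⟩)
      rw [mul_one]
      rcases max_cases (m - c j) ((2 * m - a j) / 2) with h | h <;> omega
  have hsum : ∑ j ∈ range m, (8 * roundBound m u j + m * if j ∈ B then 0 else 1) ≤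
      ∑ j ∈ range m, 8 * m := sum_le_sum fun j hj => by
    have := hterm j hj
    split_ifs at this ⊢ <;> omega
  rw [sum_add_distrib, ← mul_sum, ← mul_sum, sum_const, card_range, smul_eq_mul] at hsum
  have hcnt : ∑ j ∈ range m, (if j ∈ B then 0 else 1) + B.card = m := by
    have : ∑ j ∈ range m, (if j ∈ B then 0 else 1) =
        ((range m).filter fun j => ¬ (a j ≤ t ∨ c j ≤ t)).card := by
      rw [card_filter]
      refine sum_congr rfl fun j hj => ?_
      simp only [hB, mem_filter, hj, true_and]
      split_ifs <;> simp_all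
    rw [this, hB, add_comm, card_filter_add_card_filter_not, card_range]
  have h3 : m ≤ 2 * ∑ j ∈ range m, (if j ∈ B then 0 else 1) := by omega
  nlinarith

end Progress

/-! ### Distances and grids -/

section Coordinates

variable {ι : Type} {d : ℕ}

/-- The coordinates of the representatives. -/
noncomputable def coords (p : ι → EuclideanSpace ℝ (Fin d)) (q : ℕ → ι) (j k : ℕ) : ℝ :=
  if h : k < d then p (q j) ⟨k, h⟩ else 0

variable {p : ι → EuclideanSpace ℝ (Fin d)} {q : ℕ → ι}

theorem sum_coords_sub_sq (i j : ℕ) :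
    ∑ k ∈ Finset.range d, (coords p q i k - coords p q j k) ^ 2 = dist (p (q i)) (p (q j)) ^ 2 := by
  rw [EuclideanSpace.dist_sq_eq, Finset.sum_range]
  refine Finset.sum_congr rfl fun k _ => ?_
  rw [Real.dist_eq, sq_abs]
  simp [coords]

/-- The distance of two points differs little from the distance of their grid cells. -/
theorem abs_dist_sub_gridDist_le {s : ℝ} (hs : 0 < s) (i j : ℕ) :
    |dist (p (q i)) (p (q j)) - √(((∑ k ∈ Finset.range d,
      (gridCoord (coords p q) s j k - gridCoord (coords p q) s i k) ^ 2 : ℤ) : ℝ) * s ^ 2)|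
      ≤ s * (d + 1) := by
  set w : EuclideanSpace ℝ (Fin d) := WithLp.toLp 2 fun k : Fin d =>
    s * (gridCoord (coords p q) s j k - gridCoord (coords p q) s i k : ℝ) with hw
  have h1 : √(((∑ k ∈ Finset.range d,
      (gridCoord (coords p q) s j k - gridCoord (coords p q) s i k) ^ 2 : ℤ) : ℝ) * s ^ 2) =
      ‖w‖ := by
    rw [← Real.sqrt_sq (norm_nonneg w), EuclideanSpace.real_norm_sq_eq]
    congr 1
    push_cast
    rw [Finset.sum_range, Finset.sum_mul]
    refine Finset.sum_congr rfl fun k _ => ?_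
    simp only [hw]
    ring
  rw [h1, dist_comm, dist_eq_norm]
  refine (abs_norm_sub_norm_le _ _).trans ?_
  refine abs_le_of_sq_le_sq' ?_ (by positivity) |>.2
  rw [EuclideanSpace.real_norm_sq_eq]
  -- Both rounding errors lie in `[0, s]`, so no coordinate of the difference changes by more than
  -- `s`; estimating `√d` by `d + 1` keeps the factor an integer.
  calc ∑ k : Fin d, (p (q j) - p (q i) - w) k ^ 2 ≤ ∑ _k : Fin d, s ^ 2 := by
        refine Finset.sum_le_sum fun k _ => ?_
        have e : (p (q j) - p (q i) - w) k =
            (coords p q j k - s * ⌊coords p q j k / s⌋) -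
              (coords p q i k - s * ⌊coords p q i k / s⌋) := by
          simp only [hw, gridCoord, PiLp.sub_apply, coords, k.2, dif_pos]
          ring
        have hf : ∀ x : ℝ, 0 ≤ x - s * ⌊x / s⌋ ∧ x - s * ⌊x / s⌋ ≤ s := by
          intro x
          have h1 := Int.floor_le (x / s)
          have h2 := (Int.lt_floor_add_one (x / s)).le
          rw [le_div_iff₀ hs] at h1
          rw [div_le_iff₀ hs] at h2
          constructor <;> nlinarith
        rw [e]
        have h1 := hf (coords p q j k)
        have h2 := hf (coords p q i k)
        refine sq_le_sq' ?_ ?_ <;> linarith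
    _ = d * s ^ 2 := by simp
    _ ≤ (s * (d + 1)) ^ 2 := by
        have : (0 : ℝ) ≤ d := Nat.cast_nonneg d
        rw [mul_pow, mul_comm]
        gcongr
        nlinarith

/-- Representatives with indices below `n` at distance at most `r`. -/
def CloseRel (p : ι → EuclideanSpace ℝ (Fin d)) (q : ℕ → ι) (n : ℕ) (r : ℝ) (i j : ℕ) : Prop :=
  i < n ∧ j < n ∧ dist (p (q i)) (p (q j)) ≤ r

theorem codeAdj_iff {n : ℕ} {s T : ℝ} (hs : 0 < s) (hT : 0 ≤ T) (i j : ℕ) :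
    CodeAdj n (gridWidth s T ^ d) (gridCode d n (coords p q) s T)
      (offsetCode d n (coords p q) s T) i j ↔ i < n ∧ j < n ∧ √(((∑ k ∈ Finset.range d,
        (gridCoord (coords p q) s j k - gridCoord (coords p q) s i k) ^ 2 : ℤ) : ℝ) * s ^ 2)
        ≤ T := by
  refine and_congr_right fun hi => and_congr_right fun hj => ?_
  rw [gridCode_adj_iff hs hT hi hj, Real.sqrt_le_left hT]

theorem codeAdj_symm {n : ℕ} {s T : ℝ} (hs : 0 < s) (hT : 0 ≤ T) (i j : ℕ)
    (h : CodeAdj n (gridWidth s T ^ d) (gridCode d n (coords p q) s T)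
      (offsetCode d n (coords p q) s T) i j) :
    CodeAdj n (gridWidth s T ^ d) (gridCode d n (coords p q) s T)
      (offsetCode d n (coords p q) s T) j i := by
  rw [codeAdj_iff hs hT] at h ⊢
  refine ⟨h.2.1, h.1, ?_⟩
  rw [Finset.sum_congr rfl fun k _ => sub_sq_comm _ _]
  exact h.2.2

theorem codeAdj_of_dist_le {n : ℕ} {s T : ℝ} (hs : 0 < s) (hT : 0 ≤ T) {i j : ℕ} (hi : i < n)
    (hj : j < n) (h : dist (p (q i)) (p (q j)) ≤ T - s * (d + 1)) :
    CodeAdj n (gridWidth s T ^ d) (gridCode d n (coords p q) s T)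
      (offsetCode d n (coords p q) s T) i j := by
  rw [codeAdj_iff hs hT]
  have := (abs_le.1 (abs_dist_sub_gridDist_le (p := p) (q := q) hs i j)).1
  exact ⟨hi, hj, by linarith⟩

theorem CodeAdj.closeRel {n : ℕ} {s T : ℝ} (hs : 0 < s) (hT : 0 ≤ T) {i j : ℕ}
    (h : CodeAdj n (gridWidth s T ^ d) (gridCode d n (coords p q) s T)
      (offsetCode d n (coords p q) s T) i j) : CloseRel p q n (T + s * (d + 1)) i j := by
  rw [codeAdj_iff hs hT] at h
  have := (abs_le.1 (abs_dist_sub_gridDist_le (p := p) (q := q) hs i j)).2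
  exact ⟨h.1, h.2.1, by linarith [h.2.2]⟩

theorem Conn.of_eqvGen {n : ℕ} {r r' : ℝ} (hr : r ≤ r') {i j : ℕ}
    (h : Relation.EqvGen (CloseRel p q n r) i j) : Conn p r' (q i) (q j) := by
  induction h with
  | rel _ _ h => exact .of_dist_le (h.2.2.trans hr)
  | refl => exact .refl _
  | symm _ _ _ ih => exact ih.symm
  | trans _ _ _ _ _ ih ih' => exact ih.trans ih'

/-- Needed to see that a cluster sharing its label has a near neighbour. The induction treats both
ends of the chain because of the symmetry rule. -/
theorem exists_close_of_eqvGen {n : ℕ} {r : ℝ} {i j : ℕ} (hij : i ≠ j)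
    (h : Relation.EqvGen (CloseRel p q n r) i j) :
    ∃ k < n, k ≠ i ∧ dist (p (q i)) (p (q k)) ≤ r := by
  have key : ∀ i j, Relation.EqvGen (CloseRel p q n r) i j → i = j ∨
      ((∃ k < n, k ≠ i ∧ dist (p (q i)) (p (q k)) ≤ r) ∧
        ∃ k < n, k ≠ j ∧ dist (p (q j)) (p (q k)) ≤ r) := by
    intro i j h
    induction h with
    | rel a c h =>
      by_cases hac : a = c
      · exact .inl hac
      · exact .inr ⟨⟨c, h.2.1, Ne.symm hac, h.2.2⟩, a, h.1, hac, by rw [dist_comm]; exact h.2.2⟩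
    | refl => exact .inl rfl
    | symm _ _ _ ih => exact ih.imp Eq.symm And.symm
    | trans a c e _ _ ih ih' =>
      rcases ih with rfl | ih
      · exact ih'
      · rcases ih' with rfl | ih'
        · exact .inr ih
        · exact .inr ⟨ih.1, ih'.2⟩
  exact ((key i j h).resolve_left hij).1

/-- The distance from the `j`-th representative to the nearest other one. -/
noncomputable def nnDist (p : ι → EuclideanSpace ℝ (Fin d)) (q : ℕ → ι) (n j : ℕ) : ℝ :=
  sInf ((fun i => dist (p (q j)) (p (q i))) '' {i | i < n ∧ i ≠ j})

theorem nnDist_le {n i j : ℕ} (hi : i < n) (hij : i ≠ j) :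
    nnDist p q n j ≤ dist (p (q j)) (p (q i)) :=
  csInf_le ⟨0, by rintro _ ⟨i, -, rfl⟩; exact dist_nonneg⟩ ⟨i, ⟨hi, hij⟩, rfl⟩

theorem exists_dist_eq_nnDist {n : ℕ} (hn : 2 ≤ n) (j : ℕ) :
    ∃ i < n, i ≠ j ∧ dist (p (q j)) (p (q i)) = nnDist p q n j := by
  have hfin : ({i | i < n ∧ i ≠ j} : Set ℕ).Finite :=
    (Set.finite_lt_nat n).subset fun i hi => hi.1
  have hne : ({i | i < n ∧ i ≠ j} : Set ℕ).Nonempty := by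
    by_cases hj : j = 0
    · exact ⟨1, by omega, by omega⟩
    · exact ⟨0, by omega, by omega⟩
  obtain ⟨i, hi, h⟩ := (hne.image fun i => dist (p (q j)) (p (q i))).csInf_mem (hfin.image _)
  exact ⟨i, hi.1, hi.2, h⟩

end Coordinates

/-! ### Sampled distances and the approximate decision -/

namespace RealRAM

noncomputable section

/-! ### Nearest neighbours

Tags of the working arrays: `4` result, `5` index of the point, `26` smallest squared distance. -/

/-- The squared distance of the points with indices `x` and `y`. -/
def sqDistTerm (b d : ℕ) (x y : Term) : Term :=
  .sum (fun k => .mul (.sub (.get (arr b 40 k) x) (.get (arr b 40 k) y))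
    (.sub (.get (arr b 40 k) x) (.get (arr b 40 k) y))) d

def nnUpdate (b d : ℕ) : Cmd :=
  .cond (sqDistTerm b d (.var b 5) (.var b 8)) (.var b 26)
    (.set b 26 (sqDistTerm b d (.var b 5) (.var b 8))) .skip

/-- Compute the distance of a point to its nearest neighbour. -/
def nnCmd (b d : ℕ) : Cmd := .block [
  .set b 26 (.add (sqDistTerm b d (.var b 5) (.const 0)) (sqDistTerm b d (.var b 5) (.const 1))),
  .for b 8 (.var b 2) (.cond (.var b 8) (.var b 5)
    (.cond (.var b 5) (.var b 8) .skip (nnUpdate b d)) (nnUpdate b d)),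
  .set b 4 (.sqrt (.var b 26))]

theorem within_nnCmd (b d : ℕ) : (nnCmd b d).Within b [4, 8, 26] := by
  simp [nnCmd, nnUpdate]

theorem HT.nnCmd {ι : Type} {b d : ℕ} {p : ι → EuclideanSpace ℝ (Fin d)} {q : ℕ → ι} (m : Store)
    {n j : ℕ} (hn2 : 2 ≤ n) (hn : m (arr b 2 0) 0 = n) (hj : m (arr b 5 0) 0 = j)
    (hX : ∀ j < n, ∀ k < d, m (arr b 40 k) j = coords p q j k) (hjn : j < n) :
    HT (nnCmd b d) m (20 * (n + 1)) fun m' => m' (arr b 4 0) 0 = nnDist p q n j := by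
  have hsq : ∀ m' : Store, Frame b [8, 26] m m' → ∀ (x y : Term) (i i' : ℕ), i < n → i' < n →
      ⌊x.eval m'⌋ = i → ⌊y.eval m'⌋ = i' →
      (sqDistTerm b d x y).eval m' = dist (p (q i)) (p (q i')) ^ 2 := by
    intro m' hf x y i i' hi hi' hx hy
    rw [← sum_coords_sub_sq]
    simp only [sqDistTerm, Term.eval_sum, Term.eval, hx, hy]
    refine Finset.sum_congr rfl fun k hk => ?_
    rw [hf _ _ (by simp), hX i hi k (Finset.mem_range.1 hk), hX i' hi' k (Finset.mem_range.1 hk)]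
    ring
  refine .seq (T := 1) (T' := (6 + 6) * (n + 1) + 4) (.set ?_) (by ring_nf; omega)
  refine .seq (T := (6 + 6) * (n + 1)) (T' := 3) ?_ (by ring_nf; omega)
  have f0 := Frame.refl (b := b) (L := [8, 26]) m
  rw [Term.eval, hsq m f0 _ _ j 0 hjn (by omega) (by simp [hj]) (by simp [Term.eval]),
    hsq m f0 _ _ j 1 hjn (by omega) (by simp [hj]) (by simp [Term.eval])]
  set m1 := m.write (arr b 26 0) 0 (dist (p (q j)) (p (q 0)) ^ 2 + dist (p (q j)) (p (q 1)) ^ 2)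
    with hm1
  have f1 : Frame b [8, 26] m m1 := f0.write (by simp) _ _ _
  refine HT.for (L := [26]) (by simp [nnUpdate]) (by simp) (n := n) (fun a m' =>
    (∀ i < a, i ≠ j → m' (arr b 26 0) 0 ≤ dist (p (q j)) (p (q i)) ^ 2) ∧
    ∃ i < n, i ≠ j ∧ dist (p (q j)) (p (q i)) ^ 2 ≤ m' (arr b 26 0) 0) ?_ ?_ ?_ ?_
  · intro m' hf
    rw [Term.eval_var, hf _ _ (by simp), f1 _ _ (by simp), hn]
  · refine ⟨by simp, ?_⟩
    simp only [m1, Store.write_apply, arr_inj]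
    norm_num
    -- One of the points `0` and `1` differs from `j`, so the sum of the two squared distances is a
    -- legitimate starting value for the minimum.
    by_cases h0 : j = 0
    · exact ⟨1, by omega, by omega, le_add_of_nonneg_left (sq_nonneg _)⟩
    · exact ⟨0, by omega, by omega, le_add_of_nonneg_right (sq_nonneg _)⟩
  · rintro a ha m' hf hv ⟨h1, i, hi, hij, h2⟩
    have ff : Frame b [8, 26] m m' := f1.trans hf
    have e5 : m' (arr b 5 0) 0 = j := by rw [ff _ _ (by simp), hj]
    have hsq' := hsq m' ff (.var b 5) (.var b 8) j a hjn ha (by simp [e5]) (by simp [hv])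
    have hupd : a ≠ j → HT (nnUpdate b d) m' 2 fun m'' =>
        (∀ i < a + 1, i ≠ j → (m''.write (arr b 8 0) 0 (a + 1)) (arr b 26 0) 0 ≤
          dist (p (q j)) (p (q i)) ^ 2) ∧
        ∃ i < n, i ≠ j ∧ dist (p (q j)) (p (q i)) ^ 2 ≤
          (m''.write (arr b 8 0) 0 (a + 1)) (arr b 26 0) 0 := by
      intro haj
      refine .cond (T := 1) (fun h => .set ?_) (fun h => .skip ?_) le_rfl
      all_goals
        rw [hsq', Term.eval_var] at h
        simp only [Store.write_apply, arr_inj, hsq']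
        norm_num
      · refine ⟨fun i hi hij => ?_, a, ha, haj, le_rfl⟩
        rcases hi.lt_or_eq with hi | rfl
        · exact h.trans (h1 i hi hij)
        · exact le_rfl
      · refine ⟨fun i hi hij => ?_, i, hi, hij, h2⟩
        rcases hi.lt_or_eq with hi | rfl
        · exact h1 i hi hij
        · exact (not_le.1 h).le
    refine .cond (T := 5) (fun h => .cond (T := 4) (fun h' => ?_) (fun h' => ?_) le_rfl)
      (fun h => ?_) le_rfl
    · rw [Term.eval_var, Term.eval_var, hv, e5] at h h'
      have haj : a = j := by exact_mod_cast le_antisymm h h'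
      refine (HT.skip ?_).mono (by omega) fun _ => id
      simp only [Store.write_apply, arr_inj]
      norm_num
      refine ⟨fun i hi hij => ?_, i, hi, hij, h2⟩
      exact h1 i (lt_of_le_of_ne hi (haj ▸ hij)) hij
    · refine (hupd ?_).mono (by omega) fun _ => id
      rintro rfl
      rw [Term.eval_var, Term.eval_var, hv, e5] at h'
      exact h' le_rfl
    · refine (hupd ?_).mono (by omega) fun _ => id
      rintro rfl
      rw [Term.eval_var, Term.eval_var, hv, e5] at h
      exact h le_rfl
  · rintro m' - - ⟨h1, i, hi, hij, h2⟩
    refine .seq (T := 1) (T' := 1) (.set (.skip ?_)) (by omega)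
    simp only [Store.write_apply, Term.eval, Term.eval_var]
    norm_num
    obtain ⟨i', hi', hij', h3⟩ := exists_dist_eq_nnDist (p := p) (q := q) hn2 j
    have h4 : m' (arr b 26 0) 0 = nnDist p q n j ^ 2 := by
      refine le_antisymm (h3 ▸ h1 i' hi' hij') (le_trans ?_ h2)
      have h5 : 0 ≤ nnDist p q n j := h3 ▸ dist_nonneg
      have := nnDist_le (p := p) (q := q) hi hij
      gcongr
    rw [h4, Real.sqrt_sq (h3 ▸ dist_nonneg)]

/-! ### The decision procedure -/

/-- The memory holds the positions and the sketches of `n` clusters. -/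
structure ClusterMem {ι : Type} {d : ℕ} (σ : SketchScheme) (p : ι → EuclideanSpace ℝ (Fin d))
    (sk : Finset ι → Fin σ.size → ℝ) (m : Store) (n : ℕ) (S : ℕ → Finset ι) (q : ℕ → ι) :
    Prop where
  count : m (arr σ.base 2 0) 0 = n
  pos : ∀ j < n, ∀ k < d, m (arr σ.base 40 k) j = coords p q j k
  row : ∀ j < n, Row σ.base 41 m j (sk (S j))

theorem ClusterMem.congr {ι : Type} {d : ℕ} {σ : SketchScheme} {p : ι → EuclideanSpace ℝ (Fin d)}
    {sk : Finset ι → Fin σ.size → ℝ} {m m' : Store} {n : ℕ} {S : ℕ → Finset ι} {q : ℕ → ι}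
    {L : List ℕ} (H : ClusterMem σ p sk m n S q) (h : Frame σ.base L m m')
    (hL : 2 ∉ L ∧ 40 ∉ L ∧ 41 ∉ L) : ClusterMem σ p sk m' n S q :=
  ⟨by rw [h _ _ hL.1, H.count], fun j hj k hk => by rw [h _ _ hL.2.1, H.pos j hj k hk],
    fun j hj l => by rw [h _ _ hL.2.2, H.row j hj l]⟩

/-- Compute the connected components at radius about `T`, and test whether the unions of the
clusters in them belong to the family. -/
def decideCmd (σ : SketchScheme) (d : ℕ) : Cmd :=
  .block [gridCmd σ.base d, bfsCmd σ.base, fiberCmd σ, oracleCmd σ]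

theorem within_decideCmd (σ : SketchScheme) (d : ℕ) : (decideCmd σ d).Within σ.base
    [8, 9, 10, 11, 12, 13, 16, 18, 19, 20, 21, 22, 23, 25, 30, 31, 32, 33, 34, 35, 36, 42] := by
  simp [decideCmd, (within_gridCmd σ.base d).mono, (within_bfsCmd σ.base).mono,
    (within_fiberCmd σ).mono, (within_oracleCmd σ).mono]

/-- Result of the decision procedure. -/
structure Decided {ι : Type} [DecidableEq ι] {d : ℕ} (σ : SketchScheme)
    (p : ι → EuclideanSpace ℝ (Fin d)) (F : Set (Finset ι)) (n : ℕ) (S : ℕ → Finset ι)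
    (q : ℕ → ι) (T η : ℝ) (f : ℕ → ℕ) (m : Store) : Prop where
  lt : ∀ j < n, f j < n
  label : ∀ j < n, m (arr σ.base 36 0) j = f j
  card : ∀ c < n, m (arr σ.base 35 0) c = fiberCard f n c
  near : ∀ i < n, ∀ j < n, dist (p (q i)) (p (q j)) ≤ T - η → f i = f j
  far : ∀ i < n, ∀ j < n, f i = f j → Relation.EqvGen (CloseRel p q n (T + η)) i j
  flag : m (arr σ.base 13 0) 0 = truth (∀ j < n, fiberUnion S f n (f j) ∈ F)

/-- The labels are exact for the grid graph, which lies between the true graphs at `T - s * (d + 1)`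
and `T + s * (d + 1)`. The scale enters the running time only through the number of offsets. -/
theorem exists_HT_decideCmd (σ : SketchScheme) (d : ℕ) : ∃ K : ℕ, ∀ {ι : Type} [DecidableEq ι]
    {F : Set (Finset ι)} {sk : Finset ι → Fin σ.size → ℝ}, IsSketch σ F sk →
    ∀ (p : ι → EuclideanSpace ℝ (Fin d)) (m : Store) (n : ℕ) (S : ℕ → Finset ι) (q : ℕ → ι)
      (s T : ℝ), 0 < s → s * (d + 1) ≤ T →
    m (arr σ.base 7 0) 0 = s → m (arr σ.base 6 0) 0 = T → ClusterMem σ p sk m n S q →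
    (∀ i < n, ∀ j < n, i ≠ j → Disjoint (S i) (S j)) →
    HT (decideCmd σ d) m (K * (n + 1) * (gridWidth s T ^ d + 1)) fun m' =>
      ∃ f : ℕ → ℕ, Decided σ p F n S q T (s * (d + 1)) f m' := by
  obtain ⟨K1, h1⟩ := exists_HT_fiberCmd σ
  obtain ⟨K2, h2⟩ := exists_HT_oracleCmd σ
  refine ⟨K1 + K2 + 300, fun {ι} _ {F sk} hsk p m n S q s T hs hT h7 h6 H hdisj => ?_⟩
  have hT0 : 0 ≤ T := le_trans (by positivity) hT
  set W := gridWidth s T ^ d with hW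
  refine .seq (T := 50 * (n + 1) * (W + 1))
    (T' := (K1 + K2 + 220) * (n + 1) * (W + 1)) ?_
    (by ring_nf; nlinarith [Nat.zero_le (n * W)])
  refine ((HT.gridCmd m hs hT0 H.count h7 h6 H.pos).within (within_gridCmd _ _)).mono le_rfl ?_
  rintro m1 ⟨hg, f1⟩
  have H1 := H.congr f1 (by simp)
  refine .seq (T := 200 * (n + 1) * (W + 1)) (T' := (K1 + K2 + 10) * (n + 1)) ?_
    (by ring_nf; nlinarith [Nat.zero_le (n * W), Nat.zero_le (n * W * K1),
      Nat.zero_le (n * W * K2), Nat.zero_le (W * K1), Nat.zero_le (W * K2)])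
  refine ((HT.bfsCmd (codeAdj_symm hs hT0) (fun i hi => codeAdj_of_dist_le hs hT0 hi hi
    (by rw [dist_self]; linarith)) H1.count hg).within (within_bfsCmd _)).mono le_rfl ?_
  rintro m2 ⟨⟨f, hf, hconn⟩, f2⟩
  have H2 := H1.congr f2 (by simp)
  refine .seq (T := K1 * (n + 1)) (T' := (K2 + 5) * (n + 1)) ?_ (by ring_nf; omega)
  refine ((h1 hsk m2 n S f H2.count hf H2.row hdisj).within (within_fiberCmd _)).mono le_rfl ?_
  rintro m3 ⟨hfib, f3⟩
  have H3 := H2.congr f3 (by simp)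
  refine .seq (T := K2 * (n + 1)) (T' := 1) ?_ (by ring_nf; omega)
  refine ((h2 hsk m3 n S f H3.count (fun j hj => (hf j hj).1) hfib).within
    (within_oracleCmd _)).mono le_rfl ?_
  rintro m4 ⟨hflag, f4⟩
  refine .skip ⟨f, fun j hj => (hf j hj).1, fun j hj => ?_, fun c hc => ?_, fun i hi j hj hij => ?_,
    fun i hi j hj hij => ?_, hflag⟩
  · rw [f4 _ _ (by simp), f3 _ _ (by simp), (hf j hj).2]
  · rw [f4 _ _ (by simp), hfib.card c hc]
  · exact (hconn i hi j hj).2 (.rel _ _ (codeAdj_of_dist_le hs hT0 hi hj hij))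
  · exact ((hconn i hi j hj).1 hij).mono fun a c h => h.closeRel hs hT0

end
end RealRAM

/-! ### One round of the net-and-prune algorithm -/

theorem gridWidth_le {s T : ℝ} (hs : 0 < s) {c : ℕ} (h : T ≤ c * s) :
    gridWidth s T ≤ 2 * c + 1 := by
  have : gridRadius s T ≤ c := Nat.floor_le_of_le ((div_le_iff₀ hs).2 h)
  unfold gridWidth
  omega

namespace RealRAM

noncomputable section

/-- The working arrays that the main loop and the refinement may change. -/
def workTags : List ℕ := [2, 3, 4, 5, 6, 7, 8, 9, 10, 11, 12, 13, 14, 15, 16, 17, 18, 19, 20, 21,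
  22, 23, 24, 25, 26, 30, 31, 32, 33, 34, 35, 36, 40, 41, 42]

-- The function `Nat.nth keep` enumerates the survivors and inverts the row numbers `Nat.count
-- keep`.
open Classical in
theorem exists_HT_selectCmd_clusters (σ : SketchScheme) (d t : ℕ) (x y : Term)
    (ht : t = 41 ∨ t = 42) :
    ∃ K : ℕ, ∀ {ι : Type} (p : ι → EuclideanSpace ℝ (Fin d)) (sk : Finset ι → Fin σ.size → ℝ)
      (m : Store) (n : ℕ) (S : ℕ → Finset ι) (q : ℕ → ι) (keep : ℕ → Prop) [DecidablePred keep],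
    m (arr σ.base 2 0) 0 = n →
    (∀ j < n, ∀ k < d, m (arr σ.base 40 k) j = coords p q j k) →
    (∀ j < n, keep j → Row σ.base t m j (sk (S j))) →
    (∀ m', Frame σ.base [8, 17, 40, 41] m m' → ∀ j < n, m' (arr σ.base 8 0) 0 = j →
      (x.eval m' ≤ y.eval m' ↔ keep j)) →
    HT (selectCmd σ d t x y) m (K * (n + 1)) fun m' => ∃ e : ℕ → ℕ,
      ClusterMem σ p sk m' (Nat.count keep n) (fun i => S (e i)) (fun i => q (e i)) ∧
      (∀ i < Nat.count keep n, e i < n ∧ keep (e i)) ∧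
      (∀ i < Nat.count keep n, ∀ j < Nat.count keep n, e i = e j → i = j) ∧
      ∀ j < n, keep j → ∃ i < Nat.count keep n, e i = j := by
  obtain ⟨K, hK⟩ := exists_HT_selectCmd σ d t x y ht
  refine ⟨K, fun {ι} p sk m n S q keep hdec hn hX hV hkeep => ?_⟩
  obtain rfl : hdec = fun a => Classical.propDecidable (keep a) := Subsingleton.elim _ _
  refine (hK m n (coords p q) (fun j => sk (S j)) keep hn hX hV hkeep).mono le_rfl ?_
  rintro m' ⟨h2, hsel⟩
  have hlt : ∀ i < Nat.count keep n, Nat.nth keep i < n := fun i hi => Nat.nth_lt_of_lt_count hi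
  have hmem : ∀ i < Nat.count keep n, keep (Nat.nth keep i) := fun i hi =>
    Nat.nth_mem i fun hf => hi.trans_le (Nat.count_le_card hf n)
  have hcount : ∀ i < Nat.count keep n, Nat.count keep (Nat.nth keep i) = i := fun i hi =>
    Nat.count_nth fun hf => hi.trans_le (Nat.count_le_card hf n)
  refine ⟨Nat.nth keep, ⟨h2, fun i hi k hk => ?_, fun i hi => ?_⟩,
    fun i hi => ⟨hlt i hi, hmem i hi⟩, fun i hi j hj h => ?_,
    fun j hj hkj => ⟨_, Nat.count_strict_mono hkj hj, Nat.nth_count hkj⟩⟩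
  · have := (hsel _ (hlt i hi) (hmem i hi)).1 k hk
    rw [hcount i hi] at this
    exact this
  · have := (hsel _ (hlt i hi) (hmem i hi)).2
    rw [hcount i hi] at this
    exact this
  · rw [← hcount i hi, h, hcount j hj]

/-- Test whether the components at radius about `x` belong to the family. -/
def testCmd (σ : SketchScheme) (d : ℕ) (x : Term) : Cmd := .block [
  .set σ.base 6 (.add x (.add (.mul (.const 4) (.var σ.base 3))
    (.mul (.var σ.base 7) (.const (d + 1))))),
  decideCmd σ d]

theorem within_testCmd (σ : SketchScheme) (d : ℕ) (x : Term) : (testCmd σ d x).Within σ.base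
    [6, 8, 9, 10, 11, 12, 13, 16, 18, 19, 20, 21, 22, 23, 25, 30, 31, 32, 33, 34, 35, 36, 42] := by
  simp [testCmd, (within_decideCmd σ d).mono]

/-- The outcome of a comparison of the optimal radius with `r`, with error `η`. -/
def Tested (σ : SketchScheme) (ropt r η : ℝ) (m : Store) : Prop :=
  (m (arr σ.base 13 0) 0 = 1 ∧ ropt ≤ r + η) ∨ (m (arr σ.base 13 0) 0 = 0 ∧ r < ropt)

/-- For `T = r + 4 * g + s * (d + 1)` the lower radius of the decision is `r + 4 * g`, just enough
to absorb the loss in `dist_rep_le`; the upper radius is `r` plus the stated error. -/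
theorem exists_HT_testCmd (σ : SketchScheme) (d : ℕ) : ∃ K : ℕ, ∀ {ι : Type}
    [DecidableEq ι] [Fintype ι] {F : Set (Finset ι)} {sk : Finset ι → Fin σ.size → ℝ},
    IsSketch σ F sk → IsUpperSet F →
    ∀ (p : ι → EuclideanSpace ℝ (Fin d)) (x : Term) (m : Store) (n : ℕ) (S : ℕ → Finset ι)
      (q : ℕ → ι) (ropt g s r : ℝ), IsLeast (connectedRadii p F) ropt → NetInv p F ropt n S q g →
    ClusterMem σ p sk m n S q → m (arr σ.base 3 0) 0 = g → m (arr σ.base 7 0) 0 = s → 0 < s →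
    x.eval m = r → 0 ≤ r →
    HT (testCmd σ d x) m (K * (n + 1) * (gridWidth s (r + (4 * g + s * (d + 1))) ^ d + 1))
      (Tested σ ropt r (4 * g + 2 * (s * (d + 1)))) := by
  obtain ⟨K, hK⟩ := exists_HT_decideCmd σ d
  refine ⟨K + 10, fun {ι} _ _ {F sk} hsk hF p x m n S q ropt g s r hopt H hm h3 h7 hs hx hr => ?_⟩
  set T := r + (4 * g + s * (d + 1)) with hT
  have hg := H.nonneg
  refine .seq (T := 1) (T' := (K + 3) * (n + 1) * (gridWidth s T ^ d + 1)) (.set ?_)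
    (by ring_nf; nlinarith [Nat.zero_le (n * gridWidth s T ^ d), Nat.zero_le (gridWidth s T ^ d)])
  have hev : (Term.add x (.add (.mul (.const 4) (.var σ.base 3))
      (.mul (.var σ.base 7) (.const (d + 1))))).eval m = T := by
    simp [Term.eval, hx, h3, h7, hT]
  rw [hev]
  set m1 := m.write (arr σ.base 6 0) 0 T with hm1
  have f1 : Frame σ.base [6] m m1 := (Frame.refl m).write (by simp) _ _ _
  refine .seq (T := K * (n + 1) * (gridWidth s T ^ d + 1)) (T' := 1) ?_
    (by ring_nf; nlinarith [Nat.zero_le (n * gridWidth s T ^ d), Nat.zero_le (gridWidth s T ^ d)])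
  refine (hK hsk p m1 n S q s T hs (by linarith) (by rw [f1 _ _ (by simp), h7])
    (by simp [hm1, Store.write_apply]) (hm.congr f1 (by simp)) H.disj).mono le_rfl ?_
  rintro m2 ⟨f, hf⟩
  refine .skip ?_
  by_cases hc : ∀ j < n, fiberUnion S f n (f j) ∈ F
  · refine .inl ⟨by rw [hf.flag, truth_of hc], ?_⟩
    have hsd : 0 ≤ s * ((d : ℝ) + 1) := by positivity
    refine H.le_of_forall_mem hF hopt (f := f) (by linarith) (fun i hi j hj hij => ?_) hc
    exact Conn.of_eqvGen (by linarith) (hf.far i hi j hj hij)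
  · refine .inr ⟨by rw [hf.flag, truth_of_not hc], ?_⟩
    refine H.lt_of_not_forall_mem hF hopt (f := f) (fun i hi j hj hij => ?_) hc
    exact hf.near i hi j hj (by linarith)

/-- Remove the clusters that are isolated at radius about half the content of variable `4`. -/
def pruneCmd (σ : SketchScheme) (d : ℕ) : Cmd := .block [
  .set σ.base 6 (.div (.var σ.base 4) (.const 2)),
  decideCmd σ d,
  selectCmd σ d 41 (.const 2) (.get (arr σ.base 35 0) (.get (arr σ.base 36 0) (.var σ.base 8)))]

theorem within_pruneCmd (σ : SketchScheme) (d : ℕ) : (pruneCmd σ d).Within σ.base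
    [2, 6, 8, 9, 10, 11, 12, 13, 16, 17, 18, 19, 20, 21, 22, 23, 25, 30, 31, 32, 33, 34, 35, 36,
      40, 41, 42] := by
  simp [pruneCmd, (within_decideCmd σ d).mono, (within_selectCmd σ d _ _ _).mono]

/-- The memory holds `n` clusters that satisfy the invariant. -/
def NetMem {ι : Type} [Fintype ι] {d : ℕ} (σ : SketchScheme) (p : ι → EuclideanSpace ℝ (Fin d))
    (F : Set (Finset ι)) (sk : Finset ι → Fin σ.size → ℝ) (ropt : ℝ) (m : Store) (n : ℕ) : Prop :=
  ∃ S q, ClusterMem σ p sk m n S q ∧ NetInv p F ropt n S q (m (arr σ.base 3 0) 0)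

theorem one_lt_fiberCard_iff {f : ℕ → ℕ} {n j : ℕ} (hj : j < n) :
    2 ≤ fiberCard f n (f j) ↔ ∃ i < n, i ≠ j ∧ f i = f j := by
  unfold fiberCard
  rw [Nat.succ_le_iff, Finset.one_lt_card_iff_nontrivial]
  constructor
  · intro h
    obtain ⟨i, hi, hij⟩ := h.exists_ne j
    rw [Finset.mem_filter, Finset.mem_range] at hi
    exact ⟨i, hi.1, hij, hi.2⟩
  · rintro ⟨i, hi, hij, h⟩
    exact ⟨i, by simp [hi, h], j, by simp [hj], hij⟩

/-- The decision at `l / 2` has error `l / 64`. Since `ropt + 4 * g ≤ 5 * ropt / 4` is below `l / 2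
- l / 64`, a cluster alone in its label is isolated as `NetInv.prune` requires. Since `l / 2 + l /
64 < l`, a cluster that survives has nearest-neighbour distance below `l`. -/
theorem exists_HT_pruneCmd (σ : SketchScheme) (d : ℕ) : ∃ K : ℕ, ∀ {ι : Type}
    [DecidableEq ι] [Fintype ι] {F : Set (Finset ι)} {sk : Finset ι → Fin σ.size → ℝ},
    IsSketch σ F sk → IsUpperSet F →
    ∀ (p : ι → EuclideanSpace ℝ (Fin d)) (m : Store) (n : ℕ) (S : ℕ → Finset ι)
      (q : ℕ → ι) (ropt g s l : ℝ), IsLeast (connectedRadii p F) ropt → NetInv p F ropt n S q g →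
    ClusterMem σ p sk m n S q → m (arr σ.base 3 0) 0 = g → m (arr σ.base 7 0) 0 = s → 0 < s →
    m (arr σ.base 4 0) 0 = l → s * (d + 1) = l / 64 → 24 * ropt ≤ 5 * l →
    HT (pruneCmd σ d) m (K * (n + 1)) fun m' => ∃ n' : ℕ, NetMem σ p F sk ropt m' n' ∧
      n' ≤ n - ((Finset.range n).filter fun i => l ≤ nnDist p q n i).card := by
  obtain ⟨K1, h1⟩ := exists_HT_decideCmd σ d
  obtain ⟨K2, h2⟩ := exists_HT_selectCmd_clusters σ d 41 (.const 2)
    (.get (arr σ.base 35 0) (.get (arr σ.base 36 0) (.var σ.base 8))) (.inl rfl)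
  -- From `l / 2 = 32 * (d + 1) * s`: the number of offsets is bounded in terms of `d` alone.
  set W := (2 * (32 * (d + 1)) + 1) ^ d with hW
  refine ⟨K1 * (W + 1) + K2 + 10,
    fun {ι} _ _ {F sk} hsk hF p m n S q ropt g s l hopt H hm h3 h7 hs h4 hsl hl => ?_⟩
  have hd : (0 : ℝ) < d + 1 := by positivity
  have hsd : 0 < s * ((d : ℝ) + 1) := by positivity
  have hw : gridWidth s (l / 2) ^ d ≤ W := by
    refine Nat.pow_le_pow_left (gridWidth_le hs ?_) d
    push_cast
    linarith
  refine .seq (T := 1) (T' := (K1 * (W + 1) + K2 + 6) * (n + 1)) (.set ?_) (by ring_nf; omega)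
  set m1 := m.write (arr σ.base 6 0) 0 _ with hm1
  have f1 : Frame σ.base [6] m m1 := (Frame.refl m).write (by simp) _ _ _
  have hm1' := hm.congr f1 (by simp)
  refine .seq (T := K1 * (n + 1) * (W + 1)) (T' := (K2 + 4) * (n + 1)) ?_ (by ring_nf; omega)
  refine ((h1 hsk p m1 n S q s (l / 2) hs (by linarith) (by rw [f1 _ _ (by simp), h7])
    (by simp [hm1, Store.write_apply, Term.eval, h4]) hm1' H.disj).within
    (within_decideCmd σ d)).mono (by gcongr) ?_
  rintro m2 ⟨⟨f, hf⟩, f2⟩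
  have hm2 := hm1'.congr f2 (by simp)
  refine .seq (T := K2 * (n + 1)) (T' := 1) ?_ (by ring_nf; omega)
  refine ((h2 p sk m2 n S q (fun j => 2 ≤ fiberCard f n (f j)) hm2.count hm2.pos
    (fun j hj _ => hm2.row j hj) ?_).within (within_selectCmd σ d _ _ _)).mono le_rfl ?_
  · intro m' hfr j hj h8
    simp only [Term.eval, Term.eval_var, h8, Int.floor_natCast]
    rw [hfr _ _ (by simp), hfr _ _ (by simp), hf.label j hj, Int.floor_natCast,
      hf.card _ (hf.lt j hj)]
    norm_cast
  · rintro m3 ⟨⟨e, hc, he, hinj, hsurj⟩, f3⟩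
    refine .skip ⟨_, ⟨_, _, hc, ?_⟩, ?_⟩
    · rw [f3 _ _ (by simp), f2 _ _ (by simp), f1 _ _ (by simp), h3]
      refine H.prune hF hopt (fun i hi => (he i hi).1) hinj fun j hj => ?_
      by_cases hk : 2 ≤ fiberCard f n (f j)
      · exact .inl (hsurj j hj hk)
      · refine .inr fun i hi hij => ?_
        by_contra hle
        refine hk ((one_lt_fiberCard_iff hj).2 ⟨i, hi, hij, ?_⟩)
        refine hf.near i hi j hj ?_
        have := H.le
        rw [dist_comm]
        linarith
    · rw [Nat.count_eq_card_filter_range, Nat.le_sub_iff_add_le (by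
        simpa using Finset.card_filter_le (Finset.range n) _), ← Finset.card_union_of_disjoint]
      · refine (Finset.card_le_card (Finset.union_subset (Finset.filter_subset _ _)
          (Finset.filter_subset _ _))).trans (by simp)
      · rw [Finset.disjoint_filter]
        intro j hj hk hle
        rw [Finset.mem_range] at hj
        obtain ⟨i, hi, hij, h⟩ := (one_lt_fiberCard_iff hj).1 hk
        obtain ⟨k, hk, hkj, hd⟩ := exists_close_of_eqvGen hij.symm (hf.far j hj i hi h.symm)
        have := nnDist_le (p := p) (q := q) hk hkj
        linarith

/-- Merge each cluster into a cluster of a net, at the scale given by variable `4`. -/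
def coarsenCmd (σ : SketchScheme) (d : ℕ) : Cmd := .block [
  .set σ.base 6 (.div (.mul (.const 5) (.var σ.base 4)) (.const 2)),
  gridCmd σ.base d,
  netCmd σ.base,
  fiberCmd σ,
  selectCmd σ d 42 (.var σ.base 8) (.get (arr σ.base 36 0) (.var σ.base 8)),
  .set σ.base 3 (.mul (.const 3) (.var σ.base 4))]

theorem within_coarsenCmd (σ : SketchScheme) (d : ℕ) : (coarsenCmd σ d).Within σ.base
    [2, 3, 6, 8, 9, 10, 11, 12, 13, 16, 17, 18, 19, 20, 21, 22, 23, 24, 25, 30, 31, 32, 33, 34, 35,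
      36, 40, 41, 42] := by
  simp [coarsenCmd, (within_gridCmd σ.base d).mono, (within_netCmd σ.base).mono,
    (within_fiberCmd σ).mono, (within_selectCmd σ d _ _ _).mono]

/-- Radius `5 * l / 2` with error `l / 64` makes grid adjacency hold up to distance `2 * l` and fail
beyond `3 * l`. The bound on offsets comes from `5 * l / 2 = 160 * (d + 1) * s`. -/
theorem exists_HT_coarsenCmd (σ : SketchScheme) (d : ℕ) : ∃ K : ℕ, ∀ {ι : Type}
    [DecidableEq ι] [Fintype ι] {F : Set (Finset ι)} {sk : Finset ι → Fin σ.size → ℝ},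
    IsSketch σ F sk → IsUpperSet F →
    ∀ (p : ι → EuclideanSpace ℝ (Fin d)) (m : Store) (n : ℕ) (S : ℕ → Finset ι)
      (q : ℕ → ι) (ropt g s l : ℝ), 2 ≤ n → NetInv p F ropt n S q g →
    ClusterMem σ p sk m n S q → m (arr σ.base 7 0) 0 = s → 0 < s →
    m (arr σ.base 4 0) 0 = l → s * (d + 1) = l / 64 → 48 * l ≤ ropt → 2 * g < 3 * l →
    HT (coarsenCmd σ d) m (K * (n + 1)) fun m' => ∃ n' : ℕ, NetMem σ p F sk ropt m' n' ∧
      n' ≤ (2 * n - ((Finset.range n).filter fun i => nnDist p q n i ≤ l).card) / 2 := by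
  obtain ⟨K1, h1⟩ := exists_HT_fiberCmd σ
  obtain ⟨K2, h2⟩ := exists_HT_selectCmd_clusters σ d 42 (.var σ.base 8)
    (.get (arr σ.base 36 0) (.var σ.base 8)) (.inr rfl)
  set W := (2 * (160 * (d + 1)) + 1) ^ d with hW
  refine ⟨150 * (W + 1) + K1 + K2 + 20,
    fun {ι} _ _ {F sk} hsk hF p m n S q ropt g s l hn2 H hm h7 hs h4 hsl hl hgl => ?_⟩
  have hd : (0 : ℝ) < d + 1 := by positivity
  have hsd : 0 < s * ((d : ℝ) + 1) := by positivity
  set T := 5 * l / 2 with hT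
  have hT0 : 0 ≤ T := by linarith
  have hw : gridWidth s T ^ d ≤ W := by
    refine Nat.pow_le_pow_left (gridWidth_le hs ?_) d
    push_cast
    linarith
  refine .seq (T := 1) (T' := (150 * (W + 1) + K1 + K2 + 17) * (n + 1)) (.set ?_)
    (by ring_nf; omega)
  set m1 := m.write (arr σ.base 6 0) 0 _ with hm1
  have f1 : Frame σ.base [6] m m1 := (Frame.refl m).write (by simp) _ _ _
  have hm1' := hm.congr f1 (by simp)
  refine .seq (T := 50 * (n + 1) * (W + 1)) (T' := (100 * (W + 1) + K1 + K2 + 14) * (n + 1)) ?_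
    (by ring_nf; omega)
  refine ((HT.gridCmd m1 hs hT0 hm1'.count (by rw [f1 _ _ (by simp), h7])
    (by simp [hm1, Store.write_apply, Term.eval, h4, hT]) hm1'.pos).within
    (within_gridCmd _ _)).mono (by gcongr) ?_
  rintro m2 ⟨hg, f2⟩
  have hm2 := hm1'.congr f2 (by simp)
  refine .seq (T := 100 * (n + 1) * (W + 1)) (T' := (K1 + K2 + 10) * (n + 1)) ?_
    (by ring_nf; omega)
  refine ((HT.netCmd hm2.count hg).within (within_netCmd _)).mono (by gcongr) ?_
  rintro m3 ⟨⟨f, h36, hnet⟩, f3⟩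
  have hm3 := hm2.congr f3 (by simp)
  refine .seq (T := K1 * (n + 1)) (T' := (K2 + 7) * (n + 1)) ?_ (by ring_nf; omega)
  have hfn : ∀ j < n, f j < n := fun j hj => (hnet.le j hj).trans_lt hj
  refine ((h1 hsk m3 n S f hm3.count (fun j hj => ⟨hfn j hj, h36 j hj⟩) hm3.row H.disj).within
    (within_fiberCmd _)).mono le_rfl ?_
  rintro m4 ⟨hfib, f4⟩
  have hm4 := hm3.congr f4 (by simp)
  refine .seq (T := K2 * (n + 1)) (T' := 3) ?_ (by ring_nf; omega)
  have hself : ∀ j < n, f j = j → 0 < fiberCard f n j := fun j hj h => by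
    have := fiberCard_pos (f := f) hj
    rwa [h] at this
  refine ((h2 p sk m4 n (fun j => fiberUnion S f n j) q (fun j => f j = j) hm4.count hm4.pos
    (fun j hj hfj => hfib.row j hj (hself j hj hfj)) ?_).within
    (within_selectCmd σ d _ _ _)).mono le_rfl ?_
  · intro m' hfr j hj h8
    simp only [Term.eval, Term.eval_var, h8, Int.floor_natCast]
    rw [hfr _ _ (by simp), f4 _ _ (by simp), h36 j hj]
    have := hnet.le j hj
    norm_cast
    omega
  · rintro m5 ⟨⟨e, hc, he, hinj, hsurj⟩, f5⟩
    refine .seq (T := 1) (T' := 1) (.set (.skip ?_)) (by omega)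
    set m6 := m5.write (arr σ.base 3 0) 0 _ with hm6
    have f6 : Frame σ.base [3] m5 m6 := (Frame.refl m5).write (by simp) _ _ _
    have h3 : m6 (arr σ.base 3 0) 0 = 3 * l := by
      have : m5 (arr σ.base 4 0) 0 = l := by
        rw [f5 _ _ (by simp), f4 _ _ (by simp), f3 _ _ (by simp), f2 _ _ (by simp),
          f1 _ _ (by simp), h4]
      simp [hm6, Store.write_apply, Term.eval, this]
    have hadj : ∀ i < n, ∀ j < n, dist (p (q i)) (p (q j)) ≤ 2 * l →
        CodeAdj n (gridWidth s T ^ d) (gridCode d n (coords p q) s T)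
          (offsetCode d n (coords p q) s T) i j := fun i hi j hj hij =>
      codeAdj_of_dist_le hs hT0 hi hj (by linarith)
    refine ⟨_, ⟨_, _, hc.congr f6 (by simp), ?_⟩, ?_⟩
    · rw [h3]
      refine H.net hF hnet hgl hl (fun i _ j _ hij => ?_) hadj he hinj hsurj
      exact (hij.closeRel hs hT0).2.2.trans (by linarith)
    · rw [Nat.le_div_iff_mul_le (by norm_num), Nat.count_eq_card_filter_range]
      have := card_close_le (D := fun i j => dist (p (q i)) (p (q j)))
        (fun i j => dist_comm _ _) (fun i j k => dist_triangle _ _ _) (by linarith : 0 ≤ l) hnet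
        hadj ((Finset.range n).filter fun i => nnDist p q n i ≤ l) (Finset.filter_subset _ _)
        fun i hi => by
          obtain ⟨k, hk, hki, h⟩ := exists_dist_eq_nnDist (p := p) (q := q) hn2 i
          exact ⟨k, hk, hki, by simpa [h] using (Finset.mem_filter.1 hi).2⟩
      omega

end
end RealRAM

/-! ### A complete round: three cases by the scale of the sampled distance -/

namespace RealRAM

noncomputable section

/-- Record that the optimal radius is between `l / 8` and `65 * l`, and end the main loop. -/
def bracketCmd (b : ℕ) : Cmd := .block [
  .set b 14 (.div (.var b 4) (.const 8)),
  .set b 15 (.mul (.const 65) (.var b 4)),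
  .set b 2 (.const 0)]

/-- One round, for the drawn cluster with the index in variable `5`. -/
def roundCmd (σ : SketchScheme) (d : ℕ) : Cmd := .block [
  nnCmd σ.base d,
  .set σ.base 7 (.div (.var σ.base 4) (.const (64 * (d + 1)))),
  testCmd σ d (.div (.var σ.base 4) (.const 8)),
  .cond (.const 1) (.var σ.base 13) (pruneCmd σ d) (.seq
    (testCmd σ d (.mul (.const 48) (.var σ.base 4)))
    (.cond (.const 1) (.var σ.base 13) (bracketCmd σ.base) (coarsenCmd σ d)))]

theorem within_roundCmd (σ : SketchScheme) (d : ℕ) :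
    (roundCmd σ d).Within σ.base workTags := by
  simp [roundCmd, bracketCmd, workTags, (within_nnCmd σ.base d).mono, (within_testCmd σ d _).mono,
    (within_pruneCmd σ d).mono, (within_coarsenCmd σ d).mono]

/-- Variables `14` and `15` hold lower and upper bounds for the optimal radius. -/
structure Bracket (σ : SketchScheme) (ropt : ℝ) (m : Store) : Prop where
  nonneg : 0 ≤ m (arr σ.base 14 0) 0
  lower : m (arr σ.base 14 0) 0 ≤ ropt
  upper : ropt ≤ m (arr σ.base 15 0) 0
  ratio : m (arr σ.base 15 0) 0 ≤ 520 * m (arr σ.base 14 0) 0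

/-- Success of the test at `l / 8` gives `ropt ≤ 5 * l / 32 + 4 * g`, and `4 * g ≤ ropt / 4` turns
this into `24 * ropt ≤ 5 * l`, the premise for pruning. Failure at `48 * l` gives the premise for
coarsening. In the remaining case `ropt` lies between `l / 8` and `65 * l`, whence the ratio `520`.
-/
theorem exists_HT_roundCmd (σ : SketchScheme) (d : ℕ) : ∃ K : ℕ, ∀ {ι : Type}
    [DecidableEq ι] [Fintype ι] {F : Set (Finset ι)} {sk : Finset ι → Fin σ.size → ℝ},
    IsSketch σ F sk → IsUpperSet F →
    ∀ (p : ι → EuclideanSpace ℝ (Fin d)) (m : Store) (n : ℕ) (S : ℕ → Finset ι)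
      (q : ℕ → ι) (ropt g : ℝ) (j : ℕ), 2 ≤ n → j < n → IsLeast (connectedRadii p F) ropt →
    NetInv p F ropt n S q g → ClusterMem σ p sk m n S q → m (arr σ.base 3 0) 0 = g →
    m (arr σ.base 5 0) 0 = j →
    HT (roundCmd σ d) m (K * (n + 1)) fun m' =>
      (∃ n' ≤ roundBound n (nnDist p q n) j, NetMem σ p F sk ropt m' n' ∧
        m' (arr σ.base 14 0) 0 = m (arr σ.base 14 0) 0 ∧
        m' (arr σ.base 15 0) 0 = m (arr σ.base 15 0) 0) ∨
      (m' (arr σ.base 2 0) 0 = 0 ∧ Bracket σ ropt m') := by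
  obtain ⟨K1, h1⟩ := exists_HT_testCmd σ d
  obtain ⟨K2, h2⟩ := exists_HT_pruneCmd σ d
  obtain ⟨K3, h3⟩ := exists_HT_coarsenCmd σ d
  -- With `4 * g < 6 * l` all grid radii used are below `55 * l`, and `55 * 64 = 3520`.
  set W := (2 * (3520 * (d + 1)) + 1) ^ d with hW
  refine ⟨2 * K1 * (W + 1) + K2 + K3 + 60,
    fun {ι} _ _ {F sk} hsk hF p m n S q ropt g j hn2 hj hopt H hm hg hJ => ?_⟩
  obtain ⟨i, hi, hij, hl⟩ := exists_dist_eq_nnDist (p := p) (q := q) hn2 j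
  set l := nnDist p q n j with hldef
  have hg0 := H.nonneg
  -- The separation of representatives makes `l` positive and not small compared with `g`.
  have hgl : 2 * g < 3 * l := by
    rw [← hl]
    exact H.sep j hj i hi hij.symm
  have hl0 : 0 < l := by linarith
  have hgr := H.le
  set s := l / (64 * (d + 1)) with hs
  have hd : (0 : ℝ) < d + 1 := by positivity
  have hs0 : 0 < s := by positivity
  have hsl : s * (d + 1) = l / 64 := by
    rw [hs]
    field_simp
  have hw : ∀ r, r ≤ 48 * l → gridWidth s (r + (4 * g + s * (d + 1))) ^ d ≤ W := fun r hr => by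
    refine Nat.pow_le_pow_left (gridWidth_le hs0 ?_) d
    push_cast
    linarith
  refine .seq (T := 20 * (n + 1)) (T' := (2 * K1 * (W + 1) + K2 + K3 + 35) * (n + 1)) ?_
    (by ring_nf; omega)
  refine ((HT.nnCmd m hn2 hm.count hJ hm.pos hj).within (within_nnCmd _ _)).mono le_rfl ?_
  rintro m1 ⟨h4, f1⟩
  refine .seq (T := 1) (T' := (2 * K1 * (W + 1) + K2 + K3 + 30) * (n + 1)) (.set ?_)
    (by ring_nf; omega)
  have hev : (Term.div (.var σ.base 4) (.const (64 * (d + 1)))).eval m1 = s := by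
    simp [Term.eval, h4, hs, hldef]
  rw [hev]
  set m2 := m1.write (arr σ.base 7 0) 0 s with hm2
  have f2 : Frame σ.base [4, 7, 8, 26] m m2 := (f1.mono (by simp)).write (by simp) _ _ _
  have h4' : m2 (arr σ.base 4 0) 0 = l := by simp [hm2, Store.write_apply, h4, hldef]
  have h7' : m2 (arr σ.base 7 0) 0 = s := by simp [hm2, Store.write_apply]
  have hc2 := hm.congr f2 (by simp)
  refine .seq (T := K1 * (n + 1) * (W + 1))
    (T' := (K1 * (W + 1) + K2 + K3 + 25) * (n + 1)) ?_ (by ring_nf; omega)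
  refine ((h1 hsk hF p _ m2 n S q ropt g s (l / 8) hopt H hc2 (by rw [f2 _ _ (by simp), hg]) h7'
    hs0 (by simp [Term.eval, h4']) (by linarith)).within (within_testCmd σ d _)).mono
      (by have := hw (l / 8) (by linarith); gcongr) ?_
  rintro m3 ⟨ht, f3⟩
  have h4'' : m3 (arr σ.base 4 0) 0 = l := by rw [f3 _ _ (by simp), h4']
  have h7'' : m3 (arr σ.base 7 0) 0 = s := by rw [f3 _ _ (by simp), h7']
  have hg'' : m3 (arr σ.base 3 0) 0 = g := by rw [f3 _ _ (by simp), f2 _ _ (by simp), hg]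
  have hc3 := hc2.congr f3 (by simp)
  refine .seq (T := (K1 * (W + 1) + K2 + K3 + 20) * (n + 1)) (T' := 1) ?_ (by ring_nf; omega)
  refine .cond (T := (K1 * (W + 1) + K2 + K3 + 15) * (n + 1)) (fun hle => ?_) (fun hle => ?_)
    (by ring_nf; omega)
  · rw [Term.eval_var] at hle
    have hr : ropt ≤ l / 8 + (4 * g + 2 * (s * (d + 1))) := by
      rcases ht with ht | ht
      · exact ht.2
      · rw [ht.1] at hle
        norm_num [Term.eval] at hle
    refine ((h2 hsk hF p m3 n S q ropt g s l hopt H hc3 hg'' h7'' hs0 h4'' hsl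
      (by linarith)).within (within_pruneCmd σ d)).mono (by ring_nf; omega) ?_
    rintro m4 ⟨⟨n', hn', hle⟩, f4⟩
    refine .skip (.inl ⟨n', hle.trans (le_max_left _ _), hn', ?_, ?_⟩)
    · rw [f4 _ _ (by simp), f3 _ _ (by simp), f2 _ _ (by simp)]
    · rw [f4 _ _ (by simp), f3 _ _ (by simp), f2 _ _ (by simp)]
  refine .seq (T := K1 * (n + 1) * (W + 1))
    (T' := (K3 + 12) * (n + 1)) ?_ (by ring_nf; omega)
  refine ((h1 hsk hF p _ m3 n S q ropt g s (48 * l) hopt H hc3 hg'' h7''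
    hs0 (by simp [Term.eval, h4'']) (by linarith)).within (within_testCmd σ d _)).mono
      (by have := hw (48 * l) le_rfl; gcongr) ?_
  rintro m4 ⟨ht', f4⟩
  have h4''' : m4 (arr σ.base 4 0) 0 = l := by rw [f4 _ _ (by simp), h4'']
  have h7''' : m4 (arr σ.base 7 0) 0 = s := by rw [f4 _ _ (by simp), h7'']
  have hc4 := hc3.congr f4 (by simp)
  refine .cond (T := (K3 + 11) * (n + 1)) (fun hle' => ?_) (fun hle' => ?_)
    (by ring_nf; omega)
  · rw [Term.eval_var] at hle hle'
    have hr : l / 8 < ropt := by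
      rcases ht with ht | ht
      · rw [ht.1] at hle
        norm_num [Term.eval] at hle
      · exact ht.2
    have hr' : ropt ≤ 48 * l + (4 * g + 2 * (s * (d + 1))) := by
      rcases ht' with ht | ht
      · exact ht.2
      · rw [ht.1] at hle'
        norm_num [Term.eval] at hle'
    refine .mono (T := 8) ?_ (by ring_nf; omega) fun _ => id
    refine .seq (T := 1) (T' := 6) (.set (.seq (T := 1) (T' := 4) (.set (.seq (T := 1) (T' := 1)
      (.set (.skip (.skip (.inr ?_)))) (by omega))) (by omega))) (by omega)
    simp only [Store.write_apply, Term.eval, Term.eval_var, arr_inj, h4''']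
    norm_num
    constructor <;> simp only [Store.write_apply, arr_inj]
      <;> norm_num <;> linarith
  · rw [Term.eval_var] at hle'
    have hr' : 48 * l < ropt := by
      rcases ht' with ht | ht
      · rw [ht.1] at hle'
        norm_num [Term.eval] at hle'
      · exact ht.2
    refine ((h3 hsk hF p m4 n S q ropt g s l hn2 H hc4 h7''' hs0 h4''' hsl hr'.le hgl).within
      (within_coarsenCmd σ d)).mono (by ring_nf; omega) ?_
    rintro m5 ⟨⟨n', hn', hle⟩, f5⟩
    refine .skip (.inl ⟨n', hle.trans (le_max_right _ _), hn', ?_, ?_⟩)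
    · rw [f5 _ _ (by simp), f4 _ _ (by simp), f3 _ _ (by simp), f2 _ _ (by simp)]
    · rw [f5 _ _ (by simp), f4 _ _ (by simp), f3 _ _ (by simp), f2 _ _ (by simp)]

/-! ### The main loop -/

theorem Good.seq {P : Store → Prop} {B : ℝ≥0∞} {c c' : Cmd} {k : List Cmd} {m : Store}
    (h : Good P B (c :: c' :: k, m)) : Good P (1 + B) (.seq c c' :: k, m) :=
  .step_const (by simp) fun s' hs' => by
    simp only [RealRAM.step, PMF.support_pure, Set.mem_singleton_iff] at hs'
    exact hs' ▸ h

theorem Good.loop {P : Store → Prop} {B : ℝ≥0∞} {x y : Term} {c : Cmd} {k : List Cmd} {m : Store}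
    (h : x.eval m ≤ y.eval m → Good P B (c :: .loop x y c :: k, m))
    (h' : ¬ x.eval m ≤ y.eval m → Good P B (k, m)) : Good P (1 + B) (.loop x y c :: k, m) :=
  .step_const (by simp) fun s' hs' => by
    simp only [RealRAM.step, PMF.support_pure, Set.mem_singleton_iff] at hs'
    by_cases hle : x.eval m ≤ y.eval m
    · rw [if_pos hle] at hs'
      exact hs' ▸ h hle
    · rw [if_neg hle] at hs'
      exact hs' ▸ h' hle

/-- Reduce the clusters to at most one, unless bounds for the optimal radius are found earlier. -/
def mainLoop (σ : SketchScheme) (d : ℕ) : Cmd :=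
  .loop (.const 2) (.var σ.base 2)
    (.seq (.draw (arr σ.base 5 0) (.const 0) (.var σ.base 2)) (roundCmd σ d))

/-- The decrease for every pivot, not only on average, permits induction on the number of clusters.
-/
theorem roundBound_lt {n j : ℕ} (hj : j < n) (u : ℕ → ℝ) : roundBound n u j < n := by
  have h1 : 0 < ((Finset.range n).filter fun i => u j ≤ u i).card :=
    Finset.card_pos.2 ⟨j, by simp [hj]⟩
  have h2 : 0 < ((Finset.range n).filter fun i => u i ≤ u j).card :=
    Finset.card_pos.2 ⟨j, by simp [hj]⟩
  unfold roundBound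
  omega

/-- The states at the beginning of an iteration of the main loop. -/
def MainMem {ι : Type} [Fintype ι] {d : ℕ} (σ : SketchScheme) (p : ι → EuclideanSpace ℝ (Fin d))
    (F : Set (Finset ι)) (sk : Finset ι → Fin σ.size → ℝ) (ropt : ℝ) (m : Store) (n : ℕ) : Prop :=
  (NetMem σ p F sk ropt m n ∧ m (arr σ.base 14 0) 0 = 0 ∧ m (arr σ.base 15 0) 0 = 0) ∨
  (n = 0 ∧ m (arr σ.base 2 0) 0 = 0 ∧ Bracket σ ropt m)

/-- The potential `C * n` drops in expectation by at least `C * n / 16 = (2 * K + 3) * n`. This pays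
for the round, at most `K * (n + 1)`, and for the three steps spent on the loop test, the sequencing
and the draw. -/
theorem exists_good_mainLoop (σ : SketchScheme) (d : ℕ) : ∃ C : ℕ, ∀ {ι : Type}
    [DecidableEq ι] [Fintype ι] {F : Set (Finset ι)} {sk : Finset ι → Fin σ.size → ℝ},
    IsSketch σ F sk → IsUpperSet F →
    ∀ (p : ι → EuclideanSpace ℝ (Fin d)) (ropt : ℝ), IsLeast (connectedRadii p F) ropt →
    ∀ (m0 : Store) (P : Store → Prop) (B : ℝ≥0∞) (k : List Cmd),
    (∀ m', Frame σ.base workTags m0 m' → Bracket σ ropt m' → Good P B (k, m')) →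
    ∀ (n : ℕ) (m : Store), Frame σ.base workTags m0 m → MainMem σ p F sk ropt m n →
    Good P ((C * n : ℕ) + (1 + B)) (mainLoop σ d :: k, m) := by
  obtain ⟨K, hK⟩ := exists_HT_roundCmd σ d
  refine ⟨16 * (2 * K + 3), fun {ι} _ _ {F sk} hsk hF p ropt hopt m0 P B k hk n => ?_⟩
  set C := 16 * (2 * K + 3) with hC
  induction n using Nat.strong_induction_on with
  | _ n ih =>
  intro m hf hm
  have hexit : Bracket σ ropt m → Good P B (k, m) := hk m hf
  by_cases hn : 2 ≤ n
  · rcases hm with ⟨⟨S, q, hc, H⟩, h14, h15⟩ | ⟨rfl, -⟩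
    swap
    · omega
    have hdraw : ∀ v < n, Good P ((K * (n + 1) + C * roundBound n (nnDist p q n) v : ℕ) + (1 + B))
        (roundCmd σ d :: mainLoop σ d :: k,
          m.write (arr σ.base 5 0) ⌊(Term.const 0).eval m⌋ v) := by
      intro v hv
      set m1 := m.write (arr σ.base 5 0) ⌊(Term.const 0).eval m⌋ v with hm1
      have f1 : Frame σ.base [5] m m1 := (Frame.refl m).write (by simp) _ _ _
      have := ((hK hsk hF p m1 n S q ropt _ v hn hv hopt H (hc.congr f1 (by simp))
        (by rw [f1 _ _ (by simp)]) (by simp [hm1, Store.write_apply, Term.eval])).within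
        (within_roundCmd σ d)).good (P := P) (k := mainLoop σ d :: k)
        (B := (C * roundBound n (nnDist p q n) v : ℕ) + (1 + B)) ?_
      · refine this.mono (le_of_eq ?_)
        push_cast
        ring
      rintro m2 ⟨h2, f2⟩
      have ff : Frame σ.base workTags m0 m2 := (hf.trans (f1.mono (by decide))).trans f2
      rcases h2 with ⟨n', hn', hnet, h14', h15'⟩ | ⟨h2, hb⟩
      · refine (ih n' (hn'.trans_lt (roundBound_lt hv _)) m2 ff (.inl ⟨hnet, ?_, ?_⟩)).mono ?_
        · rw [h14', f1 _ _ (by simp), h14]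
        · rw [h15', f1 _ _ (by simp), h15]
        · gcongr
      · refine (ih 0 (by omega) m2 ff (.inr ⟨rfl, h2, hb⟩)).mono ?_
        gcongr
        omega
    have hsum : ∑ v ∈ Finset.range n,
        (((K * (n + 1) + C * roundBound n (nnDist p q n) v : ℕ) : ℝ≥0∞) + (1 + B)) ≤
        (((C * n - 3 : ℕ) : ℝ≥0∞) + (1 + B)) * n := by
      rw [Finset.sum_add_distrib, Finset.sum_const, Finset.card_range, nsmul_eq_mul, add_mul,
        mul_comm (n : ℝ≥0∞)]
      gcongr
      have hrb := sum_roundBound_le n (nnDist p q n)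
      have hnat : ∑ v ∈ Finset.range n, (K * (n + 1) + C * roundBound n (nnDist p q n) v) ≤
          (C * n - 3) * n := by
        rw [Finset.sum_add_distrib, Finset.sum_const, Finset.card_range, smul_eq_mul,
          ← Finset.mul_sum]
        obtain ⟨Y, hY⟩ : ∃ Y, C * n = Y + 3 := ⟨C * n - 3, by
          have : 1 * n ≤ C * n := Nat.mul_le_mul_right n (by omega)
          have : 3 * n ≤ C * n := Nat.mul_le_mul_right n (by omega)
          omega⟩
        rw [hY, Nat.add_sub_cancel]
        have hY' : C * n * n = Y * n + 3 * n := by rw [hY]; ring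
        have : C * ∑ v ∈ Finset.range n, roundBound n (nnDist p q n) v ≤
            15 * (2 * K + 3) * n ^ 2 := by
          rw [hC]
          nlinarith
        have hCn : C * n * n = 16 * (2 * K + 3) * n ^ 2 := by rw [hC]; ring
        nlinarith [Nat.zero_le (K * n), Nat.zero_le (K * n * n),
          mul_le_mul hn le_rfl (Nat.zero_le n) (Nat.zero_le n)]
      exact_mod_cast hnat
    have hd := Good.draw (P := P) (a := arr σ.base 5 0) (i := .const 0) (x := .var σ.base 2)
      (k := roundCmd σ d :: mainLoop σ d :: k) (m := m) (N := n) (by omega)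
      (by rw [Term.eval_var, hc.count]) _ hdraw
    refine (Good.loop (fun _ => Good.seq hd) fun hle => ?_).mono ?_
    · refine absurd ?_ hle
      rw [Term.eval_var, hc.count]
      simp only [Term.eval]
      exact_mod_cast hn
    · have h3 : 3 ≤ C * n := by nlinarith
      have hle := ENNReal.div_le_of_le_mul hsum
      calc _ ≤ 1 + (1 + (1 + (((C * n - 3 : ℕ) : ℝ≥0∞) + (1 + B)))) := by gcongr
        _ = ((C * n - 3 + 3 : ℕ) : ℝ≥0∞) + (1 + B) := by push_cast; ring
        _ = _ := by rw [Nat.sub_add_cancel h3]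
  · have h2 : m (arr σ.base 2 0) 0 ≤ 1 ∧ Bracket σ ropt m := by
      rcases hm with ⟨⟨S, q, hc, H⟩, h14, h15⟩ | ⟨-, h2, hb⟩
      -- Without a recorded bracket at most one cluster is left; then `ropt = 0`, the value that
      -- both bounds still have.
      · have h0 := H.eq_zero hF hopt (by omega)
        refine ⟨?_, ⟨h14.ge, by rw [h14, h0], by rw [h15, h0], by simp [h14, h15]⟩⟩
        rw [hc.count]
        exact_mod_cast (by omega : n ≤ 1)
      · exact ⟨by rw [h2]; norm_num, hb⟩
    refine (Good.loop (B := B) (fun hle => ?_) fun _ => hexit h2.2).mono le_add_self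
    rw [Term.eval_var] at hle
    simp only [Term.eval] at hle
    norm_num at hle
    linarith [h2.1]

end
end RealRAM

/-! ### From a constant factor to the factor `1 + ε` -/

namespace RealRAM

noncomputable section

/-! ### Refinement of the bounds -/

theorem Reach.exists {R : Config → Prop} {T : ℕ} {s : Config} (h : Reach R T s) : ∃ s, R s := by
  induction h with
  | done h => exact ⟨_, h⟩
  | @step t s _ _ ih => exact ih _ (RealRAM.step s).support_nonempty.some_mem

/-- Loops with a potential that pays for the iterations. -/
theorem HT.loop_of_potential {x y : Term} {c : Cmd} {Q : Store → Prop} (I : Store → Prop)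
    (Φ : Store → ℝ) (hΦ : ∀ m, I m → 0 ≤ Φ m)
    (hbody : ∀ m, I m → x.eval m ≤ y.eval m →
      ∃ T : ℕ, HT c m T fun m' => I m' ∧ T + 1 + Φ m' ≤ Φ m)
    (hend : ∀ m, I m → ¬ x.eval m ≤ y.eval m → Q m) {N : ℕ} {m : Store} (hm : I m)
    (hN : ⌊Φ m⌋₊ ≤ N) : HT (.loop x y c) m (N + 1) Q := by
  induction N using Nat.strong_induction_on generalizing m with
  | _ N ih =>
  by_cases hxy : x.eval m ≤ y.eval m
  · obtain ⟨T, hT⟩ := hbody m hm hxy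
    have hTN : T + 1 ≤ N := by
      -- The drop of the potential is a property of final memories; at least one is reachable,
      -- because a step has nonempty support.
      obtain ⟨⟨_, m'⟩, -, h⟩ := (hT []).exists
      refine le_trans (Nat.le_floor ?_) hN
      push_cast
      linarith [h.2, hΦ m' h.1]
    refine .loop_of_le (T' := N - (T + 1) + 1) hxy (hT.mono le_rfl fun m' h => ?_) (by omega)
    refine ih _ (by omega) h.1 ?_
    have h1 : Φ m' ≤ Φ m - (T + 1 : ℕ) := by push_cast; linarith [h.2]
    have h2 := Nat.floor_le_floor h1
    rw [Nat.floor_sub_natCast] at h2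
    omega
  · exact .loop_of_not_le hxy (hend m hm hxy) (by omega)

/-- Shrink the interval given by variables `14` and `15` by a third. -/
def refineStep (σ : SketchScheme) (d : ℕ) : Cmd := .block [
  .set σ.base 4 (.div (.sub (.var σ.base 15) (.var σ.base 14)) (.const 3)),
  .set σ.base 7 (.div (.var σ.base 4) (.const (2 * (d + 1)))),
  testCmd σ d (.add (.var σ.base 14) (.var σ.base 4)),
  .cond (.const 1) (.var σ.base 13)
    (.set σ.base 15 (.add (.var σ.base 14) (.mul (.const 2) (.var σ.base 4))))
    (.set σ.base 14 (.add (.var σ.base 14) (.var σ.base 4)))]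

def refineLoop (σ : SketchScheme) (d : ℕ) : Cmd :=
  .loop (.add (.const 1) (.var σ.base 1)) (.div (.var σ.base 15) (.var σ.base 14))
    (refineStep σ d)

theorem within_refineStep (σ : SketchScheme) (d : ℕ) :
    (refineStep σ d).Within σ.base [4, 6, 7, 8, 9, 10, 11, 12, 13, 14, 15, 16, 18, 19, 20, 21, 22,
      23, 25, 30, 31, 32, 33, 34, 35, 36, 42] := by
  simp [refineStep, (within_testCmd σ d _).mono]

theorem gridWidth_le_real {s T y : ℝ} (hy : 1 ≤ y) (hT : 0 ≤ T / s) (h : T / s ≤ y) :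
    (gridWidth s T : ℝ) ≤ 3 * y := by
  have : (gridRadius s T : ℝ) ≤ T / s := Nat.floor_le hT
  unfold gridWidth
  push_cast
  linarith

/-- With `s * (d + 1)` a sixth of the interval, the test at one third has total error one third, so
it certifies the lower or the upper two thirds. The grid radius is at most `hi` and `s` is
proportional to `hi - lo`, hence the power of their ratio. Only `g = 0` leaves no further error. -/
theorem exists_HT_refineStep (σ : SketchScheme) (d : ℕ) : ∃ K : ℕ, ∀ {ι : Type}
    [DecidableEq ι] [Fintype ι] {F : Set (Finset ι)} {sk : Finset ι → Fin σ.size → ℝ},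
    IsSketch σ F sk → IsUpperSet F →
    ∀ (p : ι → EuclideanSpace ℝ (Fin d)) (m : Store) (n : ℕ) (S : ℕ → Finset ι)
      (q : ℕ → ι) (ropt lo hi : ℝ), IsLeast (connectedRadii p F) ropt →
    NetInv p F ropt n S q 0 → ClusterMem σ p sk m n S q → m (arr σ.base 3 0) 0 = 0 →
    m (arr σ.base 14 0) 0 = lo → m (arr σ.base 15 0) 0 = hi → 0 ≤ lo → lo < hi → lo ≤ ropt →
    ropt ≤ hi → ∃ T : ℕ, (T + 1 : ℝ) ≤ K * (n + 1) * (hi / (hi - lo)) ^ d ∧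
      HT (refineStep σ d) m T fun m' => lo ≤ m' (arr σ.base 14 0) 0 ∧
        m' (arr σ.base 14 0) 0 ≤ ropt ∧ ropt ≤ m' (arr σ.base 15 0) 0 ∧
        m' (arr σ.base 15 0) 0 ≤ hi ∧
        m' (arr σ.base 15 0) 0 - m' (arr σ.base 14 0) 0 = 2 / 3 * (hi - lo) := by
  obtain ⟨K, hK⟩ := exists_HT_testCmd σ d
  refine ⟨(K + 20) * ((18 * (d + 1)) ^ d + 1),
    fun {ι} _ _ {F sk} hsk hF p m n S q ropt lo hi hopt H hm h3 h14 h15 hlo hlt hlr hrh => ?_⟩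
  set x := hi - lo with hx
  have hx0 : 0 < x := by rw [hx]; linarith
  have hd : (0 : ℝ) < d + 1 := by positivity
  set s := x / 3 / (2 * (d + 1)) with hs
  have hs0 : 0 < s := by positivity
  have hsd : s * (d + 1) = x / 6 := by
    rw [hs]
    field_simp
    norm_num
  set y := hi / x with hy
  have hy1 : 1 ≤ y := by
    rw [hy, le_div_iff₀ hx0]
    linarith
  set R := lo + x / 3 + (4 * 0 + s * (d + 1)) with hR
  have hwidth : (gridWidth s R : ℝ) ≤ 18 * (d + 1) * y := by
    have hd1 : (1 : ℝ) ≤ d + 1 := by linarith [Nat.cast_nonneg (α := ℝ) d]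
    have h1 : R / s ≤ 6 * (d + 1) * y := by
      rw [div_le_iff₀ hs0]
      have : 6 * (d + 1) * y * s = 6 * y * (s * (d + 1)) := by ring
      rw [this, hsd, show 6 * y * (x / 6) = y * x by ring, hy, div_mul_cancel₀ _ hx0.ne', hR, hsd]
      linarith
    refine (gridWidth_le_real ?_ ?_ h1).trans (le_of_eq (by ring))
    · nlinarith
    · rw [hR, hsd]
      positivity
  have hyd : (1 : ℝ) ≤ y ^ d := one_le_pow₀ hy1
  refine ⟨(K + 19) * (n + 1) * (gridWidth s R ^ d + 1), ?_, ?_⟩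
  · have h1 : (gridWidth s R : ℝ) ^ d ≤ (18 * (d + 1)) ^ d * y ^ d := by
      rw [← mul_pow]
      exact pow_le_pow_left₀ (Nat.cast_nonneg _) hwidth d
    have h2 : (gridWidth s R : ℝ) ^ d + 1 ≤ ((18 * (d + 1)) ^ d + 1) * y ^ d := by linarith
    have h3 : (0 : ℝ) ≤ (gridWidth s R : ℝ) ^ d := by positivity
    push_cast
    calc ((K : ℝ) + 19) * (n + 1) * ((gridWidth s R : ℝ) ^ d + 1) + 1
        ≤ (K + 20) * (n + 1) * ((gridWidth s R : ℝ) ^ d + 1) := by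
          have : (0 : ℝ) ≤ n * (gridWidth s R : ℝ) ^ d := by positivity
          nlinarith [Nat.cast_nonneg (α := ℝ) n]
      _ ≤ (K + 20) * (n + 1) * (((18 * (d + 1)) ^ d + 1) * y ^ d) := by gcongr
      _ = _ := by ring
  set W := gridWidth s R ^ d with hW
  refine .seq (T := 1) (T' := (K + 17) * (n + 1) * (W + 1)) (.set ?_)
    (by ring_nf; nlinarith [Nat.zero_le (n * W), Nat.zero_le W])
  have e1 : (Term.div (.sub (.var σ.base 15) (.var σ.base 14)) (.const 3)).eval m = x / 3 := by
    simp [Term.eval, h14, h15, hx]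
  rw [e1]
  set m1 := m.write (arr σ.base 4 0) 0 (x / 3) with hm1
  refine .seq (T := 1) (T' := (K + 15) * (n + 1) * (W + 1)) (.set ?_)
    (by ring_nf; nlinarith [Nat.zero_le (n * W), Nat.zero_le W])
  have e2 : (Term.div (.var σ.base 4) (.const (2 * (d + 1)))).eval m1 = s := by
    simp [Term.eval, hm1, Store.write_apply, hs]
  rw [e2]
  set m2 := m1.write (arr σ.base 7 0) 0 s with hm2
  have f2 : Frame σ.base [4, 7] m m2 :=
    ((Frame.refl m).write (by simp) _ _ _).write (by simp) _ _ _
  have h4 : m2 (arr σ.base 4 0) 0 = x / 3 := by simp [hm2, hm1, Store.write_apply]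
  have h7 : m2 (arr σ.base 7 0) 0 = s := by simp [hm2, Store.write_apply]
  refine .seq (T := K * (n + 1) * (W + 1)) (T' := 6) ?_
    (by ring_nf; nlinarith [Nat.zero_le (n * W), Nat.zero_le W])
  refine ((hK hsk hF p _ m2 n S q ropt 0 s (lo + x / 3) hopt H (hm.congr f2 (by simp))
    (by rw [f2 _ _ (by simp), h3]) h7 hs0 (by simp [Term.eval, h4, f2 _ _, h14])
    (by positivity)).within (within_testCmd σ d _)).mono le_rfl ?_
  rintro m3 ⟨ht, f3⟩
  have k14 : m3 (arr σ.base 14 0) 0 = lo := by rw [f3 _ _ (by simp), f2 _ _ (by simp), h14]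
  have k15 : m3 (arr σ.base 15 0) 0 = hi := by rw [f3 _ _ (by simp), f2 _ _ (by simp), h15]
  have k4 : m3 (arr σ.base 4 0) 0 = x / 3 := by rw [f3 _ _ (by simp), h4]
  refine .seq (T := 2) (T' := 1) (.cond (T := 1) (fun hle => .set (.skip ?_))
    (fun hle => .set (.skip ?_)) le_rfl) (by omega)
  · simp only [Store.write_apply, Term.eval, Term.eval_var, arr_inj, k14, k4]
    norm_num
    rcases ht with ⟨-, ht⟩ | ⟨ht, -⟩
    · refine ⟨hlr, ?_, ?_, ?_⟩ <;> linarith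
    · rw [Term.eval_var, ht] at hle
      norm_num [Term.eval] at hle
  · simp only [Store.write_apply, Term.eval, Term.eval_var, arr_inj, k14, k4]
    norm_num
    rcases ht with ⟨ht, -⟩ | ⟨-, ht⟩
    · rw [Term.eval_var, ht] at hle
      norm_num [Term.eval] at hle
    · rw [k15]
      refine ⟨?_, ?_, hrh, le_rfl, ?_⟩ <;> linarith

/-- Shrinking the interval by `2 / 3` multiplies `(hi0 / (hi - lo)) ^ d` by at least `3 / 2` if `d ≠
0`, so the costs form a geometric series. While the guard holds, `hi - lo ≥ ε * lo0` and `hi0 ≤ 520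
* lo0` bound the ratio by `520 / ε`; one more step makes it at most `780 / ε`. -/
theorem exists_HT_refineLoop (σ : SketchScheme) (d : ℕ) : ∃ K : ℕ, ∀ {ι : Type}
    [DecidableEq ι] [Fintype ι] {F : Set (Finset ι)} {sk : Finset ι → Fin σ.size → ℝ},
    IsSketch σ F sk → IsUpperSet F →
    ∀ (p : ι → EuclideanSpace ℝ (Fin d)) (m : Store) (n : ℕ) (S : ℕ → Finset ι)
      (q : ℕ → ι) (ropt ε : ℝ), IsLeast (connectedRadii p F) ropt → (0 < ropt → d ≠ 0) →
    NetInv p F ropt n S q 0 → ClusterMem σ p sk m n S q → m (arr σ.base 3 0) 0 = 0 →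
    m (arr σ.base 1 0) 0 = ε → 0 < ε → ε < 1 → Bracket σ ropt m →
    ∃ T : ℕ, (T : ℝ) ≤ K * (n + 1) / ε ^ d ∧ HT (refineLoop σ d) m T fun m' =>
      ropt ≤ m' (arr σ.base 15 0) 0 ∧ m' (arr σ.base 15 0) 0 ≤ (1 + ε) * ropt := by
  obtain ⟨K, hK⟩ := exists_HT_refineStep σ d
  refine ⟨3 * K * 780 ^ d + 1,
    fun {ι} _ _ {F sk} hsk hF p m n S q ropt ε hopt hd H hm h3 h1 hε hε1 hb => ?_⟩
  have hεd : 0 < ε ^ d := by positivity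
  have hεd1 : ε ^ d ≤ 1 := pow_le_one₀ hε.le hε1.le
  obtain ⟨lo0, hlo0⟩ : ∃ x, m (arr σ.base 14 0) 0 = x := ⟨_, rfl⟩
  obtain ⟨hi0, hhi0⟩ : ∃ x, m (arr σ.base 15 0) 0 = x := ⟨_, rfl⟩
  obtain ⟨hb1, hb2, hb3, hb4⟩ := hb
  rw [hlo0] at hb1 hb2 hb4
  rw [hhi0] at hb3 hb4
  have hn : (0 : ℝ) ≤ K * (n + 1) := by positivity
  by_cases hguard : (Term.add (.const 1) (.var σ.base 1)).eval m ≤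
      (Term.div (.var σ.base 15) (.var σ.base 14)).eval m
  · have hg' : 1 + ε ≤ hi0 / lo0 := by simpa [Term.eval, h1, hlo0, hhi0] using hguard
    have hlo : 0 < lo0 := by
      rcases hb1.eq_or_lt with h | h
      -- Division by zero gives `0`, so the guard fails when the lower bound is `0`.
      · rw [← h, div_zero] at hg'
        linarith
      · exact h
    rw [le_div_iff₀ hlo] at hg'
    have hd0 : d ≠ 0 := hd (by linarith)
    have hhi : 0 < hi0 := by nlinarith
    set a := (K : ℝ) * (n + 1) with ha
    -- The power increases per step by at least half its value; the factor `3` makes this exceed the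
    -- cost `a` times the power.
    set Φ : Store → ℝ := fun m' => 3 * a * ((780 / ε) ^ d -
      (hi0 / (m' (arr σ.base 15 0) 0 - m' (arr σ.base 14 0) 0)) ^ d) with hΦ
    set I : Store → Prop := fun m' => Frame σ.base workTags m m' ∧ ClusterMem σ p sk m' n S q ∧
      m' (arr σ.base 3 0) 0 = 0 ∧ lo0 ≤ m' (arr σ.base 14 0) 0 ∧ m' (arr σ.base 14 0) 0 ≤ ropt ∧
      ropt ≤ m' (arr σ.base 15 0) 0 ∧ m' (arr σ.base 15 0) 0 ≤ hi0 ∧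
      m' (arr σ.base 14 0) 0 < m' (arr σ.base 15 0) 0 ∧
      hi0 / (m' (arr σ.base 15 0) 0 - m' (arr σ.base 14 0) 0) ≤ 780 / ε with hI
    have hy : ∀ lo hi : ℝ, lo0 ≤ lo → lo * (1 + ε) ≤ hi → hi0 / (hi - lo) ≤ 520 / ε := by
      intro lo hi h h'
      have : 0 < ε * lo := mul_pos hε (by linarith)
      rw [div_le_div_iff₀ (by linarith) hε]
      nlinarith
    have hI0 : I m := by
      refine ⟨.refl m, hm, h3, hlo0.ge, by rwa [hlo0], by rwa [hhi0], hhi0.le, ?_, ?_⟩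
      · rw [hlo0, hhi0]
        nlinarith
      · rw [hlo0, hhi0]
        refine (hy lo0 hi0 le_rfl (by linarith)).trans ?_
        gcongr
        norm_num
    refine ⟨⌊Φ m⌋₊ + 1, ?_, HT.loop_of_potential I Φ ?_ ?_ ?_ hI0 le_rfl⟩
    · have h2 : Φ m ≤ 3 * a * (780 / ε) ^ d := by
        refine mul_le_mul_of_nonneg_left (sub_le_self _ (pow_nonneg ?_ _)) (by positivity)
        rw [hlo0, hhi0]
        exact div_nonneg hhi.le (by nlinarith)
      have h4 : (⌊Φ m⌋₊ : ℝ) ≤ 3 * a * (780 / ε) ^ d :=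
        (Nat.cast_le.2 (Nat.floor_le_floor h2)).trans (Nat.floor_le (by positivity))
      push_cast
      rw [le_div_iff₀ hεd]
      rw [div_pow] at h4
      have h5 : 3 * a * (780 ^ d / ε ^ d) * ε ^ d = 3 * a * 780 ^ d := by field_simp
      nlinarith [Nat.cast_nonneg (α := ℝ) n]
    · rintro m' ⟨-, -, -, -, -, -, -, hlt, hle⟩
      refine mul_nonneg (by positivity) (sub_nonneg.2 (pow_le_pow_left₀ ?_ hle d))
      exact div_nonneg hhi.le (by linarith)
    · rintro m' ⟨hf, hc, h3', hl1, hl2, hl3, hl4, hlt, hle⟩ hgd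
      obtain ⟨lo, hlo'⟩ : ∃ x, m' (arr σ.base 14 0) 0 = x := ⟨_, rfl⟩
      obtain ⟨hi, hhi'⟩ : ∃ x, m' (arr σ.base 15 0) 0 = x := ⟨_, rfl⟩
      rw [hlo'] at hl1 hl2 hlt hle
      rw [hhi'] at hl3 hl4 hlt hle
      have hgd' : 1 + ε ≤ hi / lo := by
        simpa [Term.eval, hf 1 0 (by decide), h1, hlo', hhi'] using hgd
      rw [le_div_iff₀ (by linarith)] at hgd'
      obtain ⟨T, hT, hHT⟩ := hK hsk hF p m' n S q ropt lo hi hopt H hc h3' hlo' hhi' (by linarith)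
        hlt hl2 hl3
      refine ⟨T, (hHT.within (within_refineStep σ d)).mono le_rfl ?_⟩
      rintro m'' ⟨⟨g1, g2, g3, g4, g5⟩, f⟩
      have hx : 0 < hi - lo := by linarith
      have hy' := hy lo hi hl1 (by linarith)
      have hyy : hi0 / (2 / 3 * (hi - lo)) = 3 / 2 * (hi0 / (hi - lo)) := by
        field_simp
      refine ⟨⟨hf.trans (f.mono (by decide)), hc.congr f (by simp),
        by rw [f _ _ (by simp), h3'], hl1.trans g1, g2, g3, g4.trans hl4, by linarith, ?_⟩, ?_⟩
      · rw [g5, hyy, show (780 : ℝ) / ε = 3 / 2 * (520 / ε) by ring]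
        gcongr
      · simp only [hΦ]
        rw [g5, hyy, hlo', hhi', mul_pow]
        have h5 : (hi / (hi - lo)) ^ d ≤ (hi0 / (hi - lo)) ^ d := by
          have : 0 ≤ hi := by linarith
          gcongr
        have h6 : (3 / 2 : ℝ) ≤ (3 / 2) ^ d := le_self_pow₀ (by norm_num) hd0
        have h7 : a * (hi / (hi - lo)) ^ d ≤ a * (hi0 / (hi - lo)) ^ d := by gcongr
        have h8 : (0 : ℝ) ≤ a * (hi0 / (hi - lo)) ^ d := by positivity
        nlinarith
    · rintro m' ⟨hf, hc, h3', hl1, hl2, hl3, hl4, hlt, hle⟩ hgd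
      have hgd' : ¬ 1 + ε ≤ m' (arr σ.base 15 0) 0 / m' (arr σ.base 14 0) 0 := by
        simpa [Term.eval, hf 1 0 (by decide), h1] using hgd
      rw [le_div_iff₀ (by linarith), not_le] at hgd'
      exact ⟨hl3, by nlinarith⟩
  · refine ⟨1, ?_, .loop_of_not_le hguard ?_ le_rfl⟩
    · rw [le_div_iff₀ hεd]
      push_cast
      have : (0 : ℝ) ≤ 3 * K * 780 ^ d * (n + 1) := by positivity
      nlinarith [Nat.cast_nonneg (α := ℝ) n]
    · have hg' : ¬ 1 + ε ≤ hi0 / lo0 := by simpa [Term.eval, h1, hlo0, hhi0] using hguard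
      rw [hhi0]
      refine ⟨hb3, ?_⟩
      rcases hb1.eq_or_lt with h | h
      -- With lower bound `0` the ratio condition forces the upper bound, and so `ropt`, to be `0`.
      · nlinarith
      · rw [le_div_iff₀ h, not_le] at hg'
        nlinarith

end
end RealRAM

namespace RealRAM

noncomputable section

/-! ### Loading the input -/

/-- For all `j` below `N`, copy `k` cells to cell `j` of the arrays with tag `t`. -/
def copyRows (b t : ℕ) (N : Term) (src : ℕ → ℕ) (s : ℕ → Term) (k : ℕ) : Cmd :=
  .for b 8 N (.copy (arr b t) (fun _ => .var b 8) src s k)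

theorem within_copyRows {b t : ℕ} {N : Term} {src : ℕ → ℕ} {s : ℕ → Term} {k : ℕ} :
    (copyRows b t N src s k).Within b [8, t] := by
  simp [copyRows, Cmd.within_copy]

theorem exists_HT_copyRows {b t : ℕ} {N : Term} {src : ℕ → ℕ} {s : ℕ → Term} {k : ℕ}
    (ht : t ≠ 8) (z : ℕ → ℕ → ℤ)
    (hs : ∀ (m : Store) (j : ℕ), m (arr b 8 0) 0 = j → ∀ l, ⌊(s l).eval m⌋ = z j l)
    (hsrc : ∀ l l', src l ≠ arr b t l') (hsrc8 : ∀ l, src l ≠ arr b 8 0) :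
    ∃ K : ℕ, ∀ (m : Store) (n : ℕ), (∀ m', Frame b [8, t] m m' → N.eval m' = n) →
    HT (copyRows b t N src s k) m (K * (n + 1)) fun m' =>
      ∀ j < n, ∀ l < k, m' (arr b t l) j = m (src l) (z j l) := by
  refine ⟨(Cmd.copy (arr b t) (fun _ => .var b 8) src s k).cost + 6, fun m n hN =>
    HT.for (L := [t]) (Cmd.within_copy (by simp)) (by simp [ht.symm])
    (n := n) (fun j m' => (∀ l, m' (src l) = m (src l)) ∧
      ∀ i < j, ∀ l < k, m' (arr b t l) i = m (src l) (z i l)) hN ?_ ?_ ?_⟩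
  · exact ⟨fun l => Store.write_of_ne _ _ _ (hsrc8 l), by simp⟩
  · rintro j hj m' hf hv ⟨h1, h2⟩
    refine HT.exec (by simp) ?_
    have hne : ∀ l, arr b 8 0 ≠ arr b t l := by simp [ht.symm]
    obtain ⟨hA1, hA2⟩ := Cmd.exec_copy (arr b t) (fun _ => .var b 8) src s k m' (fun _ => j) (z j)
      (fun m3 h3 l => by rw [Term.eval_var, h3 _ hne, hv, Int.floor_natCast])
      (fun m3 h3 l => hs m3 j (by rw [h3 _ hne, hv]) l)
      (fun l l' hl h => hl (by simpa using h.1))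
      (fun l l' hl h => hsrc _ _ h.1)
    have h8 : ∀ l, arr b t l ≠ arr b 8 0 := fun l => (hne l).symm
    refine ⟨fun l => ?_, fun i hi l hl => ?_⟩
    · rw [Store.write_of_ne _ _ _ (hsrc8 l), ← h1 l]
      funext z'
      exact hA2 _ _ fun l' _ h => hsrc _ _ h.1
    · rw [Store.write_of_ne _ _ _ (h8 l)]
      rcases Nat.lt_succ_iff_lt_or_eq.1 hi with hi | rfl
      · rw [hA2 _ _ fun l' _ h => hi.ne (by exact_mod_cast h.2), h2 i hi l hl]
      · rw [hA1 l hl, h1]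
  · rintro m' - - ⟨-, h⟩
    exact h

/-- Copy the input from the arrays with tags `43` and `44` to the working arrays. -/
def loadCmd (σ : SketchScheme) (d : ℕ) : Cmd := .block [
  copyRows σ.base 40 (.var σ.base 0) (arr σ.base 43) (fun _ => .var σ.base 8) d,
  copyRows σ.base 41 (.var σ.base 0) (arr σ.base 44) (fun _ => .var σ.base 8) σ.size,
  .set σ.base 2 (.var σ.base 0),
  .set σ.base 3 (.const 0)]

theorem within_loadCmd (σ : SketchScheme) (d : ℕ) :
    (loadCmd σ d).Within σ.base [2, 3, 8, 40, 41] := by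
  simp [loadCmd, within_copyRows.mono]

/-- The memory holds a copy of the input. -/
structure InputMem {ι : Type} {d : ℕ} (σ : SketchScheme) (p : ι → EuclideanSpace ℝ (Fin d))
    (sk : Finset ι → Fin σ.size → ℝ) (ε : ℝ) (m : Store) (n : ℕ) (q : ℕ → ι) : Prop where
  count : m (arr σ.base 0 0) 0 = n
  eps : m (arr σ.base 1 0) 0 = ε
  pos : ∀ j < n, ∀ k < d, m (arr σ.base 43 k) j = coords p q j k
  row : ∀ j < n, Row σ.base 44 m j (sk {q j})

theorem InputMem.congr {ι : Type} {d : ℕ} {σ : SketchScheme} {p : ι → EuclideanSpace ℝ (Fin d)}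
    {sk : Finset ι → Fin σ.size → ℝ} {ε : ℝ} {m m' : Store} {n : ℕ} {q : ℕ → ι} {L : List ℕ}
    (H : InputMem σ p sk ε m n q) (h : Frame σ.base L m m')
    (hL : 0 ∉ L ∧ 1 ∉ L ∧ 43 ∉ L ∧ 44 ∉ L) : InputMem σ p sk ε m' n q :=
  ⟨by rw [h _ _ hL.1, H.count], by rw [h _ _ hL.2.1, H.eps],
    fun j hj k hk => by rw [h _ _ hL.2.2.1, H.pos j hj k hk],
    fun j hj l => by rw [h _ _ hL.2.2.2, H.row j hj l]⟩

theorem exists_HT_loadCmd (σ : SketchScheme) (d : ℕ) : ∃ K : ℕ, ∀ {ι : Type}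
    (p : ι → EuclideanSpace ℝ (Fin d)) (sk : Finset ι → Fin σ.size → ℝ) (ε : ℝ) (m : Store)
    (n : ℕ) (q : ℕ → ι), InputMem σ p sk ε m n q →
    HT (loadCmd σ d) m (K * (n + 1)) fun m' =>
      (ClusterMem σ p sk m' n (fun j => {q j}) q ∧ m' (arr σ.base 3 0) 0 = 0) ∧
      Frame σ.base [2, 3, 8, 40, 41] m m' := by
  obtain ⟨K1, h1⟩ := exists_HT_copyRows (b := σ.base) (t := 40) (N := .var σ.base 0)
    (src := arr σ.base 43) (s := fun _ => .var σ.base 8) (k := d) (by norm_num) (fun j _ => j)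
    (fun m j h l => by rw [Term.eval_var, h, Int.floor_natCast]) (by simp) (by simp)
  obtain ⟨K2, h2⟩ := exists_HT_copyRows (b := σ.base) (t := 41) (N := .var σ.base 0)
    (src := arr σ.base 44) (s := fun _ => .var σ.base 8) (k := σ.size) (by norm_num) (fun j _ => j)
    (fun m j h l => by rw [Term.eval_var, h, Int.floor_natCast]) (by simp) (by simp)
  refine ⟨K1 + K2 + 10, fun {ι} p sk ε m n q H => HT.within (within_loadCmd σ d) ?_⟩
  refine .seq (T := K1 * (n + 1)) (T' := (K2 + 8) * (n + 1)) ?_ (by ring_nf; omega)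
  refine ((h1 m n fun m' hf => by rw [Term.eval_var, hf _ _ (by simp), H.count]).within
    within_copyRows).mono le_rfl ?_
  rintro m1 ⟨hX, f1⟩
  refine .seq (T := K2 * (n + 1)) (T' := 6) ?_ (by ring_nf; omega)
  refine ((h2 m1 n fun m' hf => by
    rw [Term.eval_var, hf _ _ (by simp), f1 _ _ (by simp), H.count]).within
    within_copyRows).mono le_rfl ?_
  rintro m2 ⟨hY, f2⟩
  refine .seq (T := 1) (T' := 4) (.set (.seq (T := 1) (T' := 1) (.set (.skip ?_)) (by omega)))
    (by omega)
  set m3 := m2.write (arr σ.base 2 0) 0 _ with hm3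
  have f3 : Frame σ.base [2, 3] m2 (m3.write (arr σ.base 3 0) 0 ((Term.const 0).eval m3)) :=
    ((Frame.refl m2).write (by simp) _ _ _).write (by simp) _ _ _
  refine ⟨⟨?_, fun j hj k hk => ?_, fun j hj l => ?_⟩, ?_⟩
  · rw [Store.write_of_ne _ _ _ (by simp)]
    simp [hm3, Store.write_apply, f2 0 0 (by simp), f1 0 0 (by simp), H.count]
  · rw [f3 _ _ (by simp), f2 _ _ (by simp), hX j hj k hk, H.pos j hj k hk]
  · rw [f3 _ _ (by simp), hY j hj l l.2, f1 _ _ (by simp), H.row j hj l]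
  · simp [Store.write_apply, Term.eval]

/-- Copy the input to arrays that are not used for other purposes. -/
def initCmd (σ : SketchScheme) (d : ℕ) : Cmd := .block [
  .set σ.base 0 (.get 0 (.const 0)),
  .set σ.base 1 (.get 0 (.const 1)),
  copyRows σ.base 43 (.var σ.base 0) (fun _ => 1)
    (fun l => .add (.mul (.var σ.base 8) (.const d)) (.const l)) d,
  copyRows σ.base 44 (.var σ.base 0) (fun _ => 2)
    (fun l => .add (.mul (.var σ.base 8) (.const σ.size)) (.const l)) σ.size]

theorem within_initCmd (σ : SketchScheme) (d : ℕ) :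
    (initCmd σ d).Within σ.base [0, 1, 8, 43, 44] := by
  simp [initCmd, within_copyRows.mono]

/-- Division with remainder by `k` recovers row and column from the cell number, so exactly one
summand survives. -/
theorem sum_rows_eq {n k : ℕ} (f : Fin n → Fin k → ℝ) (i : Fin n) (j : Fin k) :
    (∑ i' : Fin n, ∑ j' : Fin k, if (i : ℤ) * k + j = (i' : ℤ) * k + j' then f i' j' else 0) =
      f i j := by
  have key : ∀ (i' : Fin n) (j' : Fin k), (i : ℤ) * k + j = (i' : ℤ) * k + j' → i' = i := by
    intro i' j' h
    have hk : 0 < k := j.pos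
    have h' : (i : ℕ) * k + j = i' * k + j' := by exact_mod_cast h
    have e : ∀ (a b : ℕ), b < k → (a * k + b) / k = a := fun a b hb => by
      rw [add_comm, Nat.add_mul_div_right _ _ hk, Nat.div_eq_of_lt hb, zero_add]
    ext
    rw [← e i' j' j'.2, ← h', e i j j.2]
  rw [Finset.sum_eq_single i, Finset.sum_eq_single j]
  · simp
  · intro j' _ hj'
    refine if_neg fun h => hj' ?_
    ext
    have : ((j : ℕ) : ℤ) = j' := by linarith
    exact_mod_cast this.symm
  · simp
  · intro i' _ hi'
    exact Finset.sum_eq_zero fun j' _ => if_neg fun h => hi' (key i' j' h)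
  · simp

theorem exists_HT_initCmd (σ : SketchScheme) (d : ℕ) : ∃ K : ℕ, ∀ {n : ℕ}
    (p : Fin n → EuclideanSpace ℝ (Fin d)) (sk : Finset (Fin n) → Fin σ.size → ℝ) (ε : ℝ)
    (q : ℕ → Fin n), (∀ i : Fin n, q i = i) →
    HT (initCmd σ d) (inputStore p ε sk) (K * (n + 1)) fun m' =>
      InputMem σ p sk ε m' n q ∧ Frame σ.base [0, 1, 8, 43, 44] (inputStore p ε sk) m' := by
  obtain ⟨K1, h1⟩ := exists_HT_copyRows (b := σ.base) (t := 43) (N := .var σ.base 0)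
    (src := fun _ => 1) (s := fun l => .add (.mul (.var σ.base 8) (.const d)) (.const l)) (k := d)
    (by norm_num) (fun j l => (j : ℤ) * d + l)
    (fun m j h l => by
      simp only [Term.eval, Term.eval_var, h]
      exact_mod_cast Int.floor_natCast (R := ℝ) (j * d + l))
    (fun _ _ => ne_arr (by norm_num) _ _) (fun _ => ne_arr (by norm_num) _ _)
  obtain ⟨K2, h2⟩ := exists_HT_copyRows (b := σ.base) (t := 44) (N := .var σ.base 0)
    (src := fun _ => 2) (s := fun l => .add (.mul (.var σ.base 8) (.const σ.size)) (.const l))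
    (k := σ.size) (by norm_num) (fun j l => (j : ℤ) * σ.size + l)
    (fun m j h l => by
      simp only [Term.eval, Term.eval_var, h]
      exact_mod_cast Int.floor_natCast (R := ℝ) (j * σ.size + l))
    (fun _ _ => ne_arr (by norm_num) _ _) (fun _ => ne_arr (by norm_num) _ _)
  refine ⟨K1 + K2 + 10, fun {n} p sk ε q hq => HT.within (within_initCmd σ d) ?_⟩
  set m := inputStore p ε sk with hm
  refine .seq (T := 1) (T' := (K1 + K2 + 8) * (n + 1)) (.set ?_) (by ring_nf; omega)
  have e0 : (Term.get 0 (.const 0)).eval m = n := by simp [Term.eval, hm, inputStore]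
  rw [e0]
  set m1 := m.write (arr σ.base 0 0) 0 n with hm1
  refine .seq (T := 1) (T' := (K1 + K2 + 6) * (n + 1)) (.set ?_) (by ring_nf; omega)
  have e1 : (Term.get 0 (.const 1)).eval m1 = ε := by
    have : m1 0 = m 0 := Store.write_of_ne _ _ _ (ne_arr (by norm_num) _ _)
    simp [Term.eval, this, hm, inputStore]
  rw [e1]
  set m2 := m1.write (arr σ.base 1 0) 0 ε with hm2
  have g2 : ∀ a < 3, m2 a = m a := fun a ha => by
    rw [hm2, Store.write_of_ne _ _ _ (ne_arr ha _ _), hm1, Store.write_of_ne _ _ _ (ne_arr ha _ _)]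
  have h0 : m2 (arr σ.base 0 0) 0 = n := by simp [hm2, hm1, Store.write_apply]
  refine .seq (T := K1 * (n + 1)) (T' := (K2 + 4) * (n + 1)) ?_ (by ring_nf; omega)
  refine (((h1 m2 n fun m' hf => by rw [Term.eval_var, hf _ _ (by simp), h0]).within
    within_copyRows).frame).mono le_rfl ?_
  rintro m3 ⟨⟨hX, f3⟩, g3⟩
  refine .seq (T := K2 * (n + 1)) (T' := 1) ?_ (by ring_nf; omega)
  refine ((h2 m3 n fun m' hf => by
    rw [Term.eval_var, hf _ _ (by simp), f3 _ _ (by simp), h0]).within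
    within_copyRows).mono le_rfl ?_
  rintro m4 ⟨hY, f4⟩
  have g3' : m3 2 = m 2 := by
    rw [g3 2, g2 2 (by norm_num)]
    simp only [copyRows, Cmd.for, Cmd.set, Cmd.Writes, Cmd.writes_copy]
    rintro (h | ⟨l, -, h⟩ | h) <;> exact ne_arr (by norm_num) _ _ h
  refine .skip ⟨?_, ?_, fun j hj k hk => ?_, fun j hj l => ?_⟩
  · rw [f4 _ _ (by simp), f3 _ _ (by simp), h0]
  · rw [f4 _ _ (by simp), f3 _ _ (by simp)]
    simp [hm2, Store.write_apply]
  · rw [f4 _ _ (by simp), hX j hj k hk, g2 1 (by norm_num)]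
    have := sum_rows_eq (fun i j => p i j) (⟨j, hj⟩ : Fin n) (⟨k, hk⟩ : Fin d)
    rw [coords, dif_pos hk, show q j = ⟨j, hj⟩ from hq ⟨j, hj⟩, ← this]
    rfl
  · rw [hY j hj l l.2, g3']
    have := sum_rows_eq (fun i j => sk {i} j) (⟨j, hj⟩ : Fin n) l
    rw [show q j = ⟨j, hj⟩ from hq ⟨j, hj⟩, ← this]
    rfl

/-! ### The algorithm -/

/-- Approximate the optimal radius up to a constant factor, then refine the bounds. -/
def algorithm (σ : SketchScheme) (d : ℕ) : Cmd :=
  .seq (initCmd σ d) (.seq (loadCmd σ d) (.seq (mainLoop σ d) (.seq (loadCmd σ d)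
    (.seq (refineLoop σ d) (.assign 0 (.const 0) (.var σ.base 15))))))

/-- The input is loaded a second time because the main loop overwrites its working arrays, while the
refinement needs the original points: an error `4 * g` would not shrink with `ε`. The master copy
has tags outside `workTags` and lies above the reach of the sketch procedures. -/
theorem exists_good_algorithm (σ : SketchScheme) (d : ℕ) : ∃ C : ℝ, ∀ {n : ℕ}
    {p : Fin n → EuclideanSpace ℝ (Fin d)} {F : Set (Finset (Fin n))}
    {sk : Finset (Fin n) → Fin σ.size → ℝ} {ε ropt : ℝ}, 1 ≤ n → Function.Injective p →
    IsUpperSet F → IsSketch σ F sk → 0 < ε → ε < 1 → IsLeast (connectedRadii p F) ropt →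
    Good (fun m => ropt ≤ outputValue m ∧ outputValue m ≤ (1 + ε) * ropt)
      (ENNReal.ofReal (C * (n / ε ^ d))) ([algorithm σ d], inputStore p ε sk) := by
  obtain ⟨K1, h1⟩ := exists_HT_initCmd σ d
  obtain ⟨K2, h2⟩ := exists_HT_loadCmd σ d
  obtain ⟨K3, h3⟩ := exists_good_mainLoop σ d
  obtain ⟨K4, h4⟩ := exists_HT_refineLoop σ d
  refine ⟨2 * K1 + 4 * K2 + K3 + 2 * K4 + 10,
    fun {n p F sk ε ropt} hn hp hF hsk hε hε1 hopt => ?_⟩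
  set q : ℕ → Fin n := fun j => if h : j < n then ⟨j, h⟩ else ⟨0, hn⟩ with hq
  have hq' : ∀ i : Fin n, q i = i := fun i => by simp [hq]
  have hqj : ∀ j (hj : j < n), q j = ⟨j, hj⟩ := fun j hj => hq' ⟨j, hj⟩
  have H : NetInv p F ropt n (fun j => {q j}) q 0 := by
    refine .initial (hopt.1).1 (fun x => ⟨x, x.2, hq' x⟩) fun i hi j hj hij h => hij ?_
    have := hp h
    rw [hqj i hi, hqj j hj] at this
    exact Fin.mk.inj_iff.1 this
  -- In dimension zero injectivity leaves a single point, whose optimal radius is zero.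
  have hd : 0 < ropt → d ≠ 0 := by
    rintro hr rfl
    have := hp.subsingleton
    have hn1 : n ≤ 1 := by
      rw [← Fintype.card_fin n]
      exact Fintype.card_le_one_iff_subsingleton.2 this
    exact hr.ne' (H.eq_zero hF hopt hn1)
  set P : Store → Prop := fun m => ropt ≤ outputValue m ∧ outputValue m ≤ (1 + ε) * ropt with hP
  set T := ⌊(K4 * (n + 1) / ε ^ d : ℝ)⌋₊ with hT
  have hεd : 0 < ε ^ d := by positivity
  have hεd1 : ε ^ d ≤ 1 := pow_le_one₀ hε.le hε1.le
  have htot : Good P ((1 + (K1 * (n + 1) + (1 + (K2 * (n + 1) + (1 + (K3 * n + (1 + (1 +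
      (K2 * (n + 1) + (1 + (T + (1 + 0))))))))))) : ℕ) : ℝ≥0∞)
      ([algorithm σ d], inputStore p ε sk) := by
    push_cast
    refine .seq ?_
    have b1 := (h1 p sk ε q hq').good (P := P) (k := [.seq (loadCmd σ d) (.seq (mainLoop σ d)
      (.seq (loadCmd σ d) (.seq (refineLoop σ d) (.assign 0 (.const 0) (.var σ.base 15)))))])
      (B := 1 + (K2 * (n + 1) + (1 + (K3 * n + (1 + (1 +
        (K2 * (n + 1) + (1 + (T + (1 + 0))))))))) ) ?_
    · exact_mod_cast b1
    rintro m1 ⟨hin, f1⟩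
    refine .seq ?_
    have b2 := (h2 p sk ε m1 n q hin).good (P := P) (k := [.seq (mainLoop σ d)
      (.seq (loadCmd σ d) (.seq (refineLoop σ d) (.assign 0 (.const 0) (.var σ.base 15))))])
      (B := 1 + (K3 * n + (1 + (1 + (K2 * (n + 1) + (1 + (T + (1 + 0)))))))) ?_
    · exact_mod_cast b2
    rintro m2 ⟨⟨hc, hg⟩, f2⟩
    refine .seq ?_
    -- The variables for the bounds have not been touched yet, so they hold the initial zeros that
    -- `MainMem` asks for.
    have hzero : ∀ t, t ∉ [0, 1, 8, 43, 44] → t ∉ [2, 3, 8, 40, 41] →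
        m2 (arr σ.base t 0) 0 = 0 := by
      intro t ht ht'
      rw [f2 _ _ ht', f1 _ _ ht]
      obtain ⟨a, ha⟩ : ∃ a, arr σ.base t 0 = a + 3 :=
        ⟨arr σ.base t 0 - 3, by have := (three_le_base σ).trans (le_arr σ.base t 0); omega⟩
      rw [ha]
      rfl
    have b3 := h3 hsk hF p ropt hopt m2 P (1 + (K2 * (n + 1) + (1 + (T + (1 + 0)))))
      [.seq (loadCmd σ d) (.seq (refineLoop σ d) (.assign 0 (.const 0) (.var σ.base 15)))]
      ?_ n m2 (.refl m2)
      (.inl ⟨⟨_, q, hc, by rw [hg]; exact H⟩, hzero 14 (by simp) (by simp),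
        hzero 15 (by simp) (by simp)⟩)
    · exact_mod_cast b3
    intro m3 f3 hb
    refine .seq ?_
    have b4 := (h2 p sk ε m3 n q ((hin.congr f2 (by simp)).congr f3 (by decide))).good (P := P)
      (k := [.seq (refineLoop σ d) (.assign 0 (.const 0) (.var σ.base 15))])
      (B := 1 + (T + (1 + 0))) ?_
    · exact_mod_cast b4
    rintro m4 ⟨⟨hc', hg'⟩, f4⟩
    refine .seq ?_
    have hin4 := ((hin.congr f2 (by simp)).congr f3 (by decide)).congr f4 (by simp)
    have hb4 : Bracket σ ropt m4 := by
      refine ⟨?_, ?_, ?_, ?_⟩ <;> simp only [f4 14 0 (by simp), f4 15 0 (by simp)]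
      exacts [hb.1, hb.2, hb.3, hb.4]
    obtain ⟨T', hT', hr⟩ := h4 hsk hF p m4 n _ q ropt ε hopt hd H hc' hg' hin4.eps hε hε1 hb4
    refine (hr.mono (Nat.le_floor hT') fun _ => id).good fun m5 h5 => ?_
    refine .step_const (by simp) fun s' hs' => ?_
    simp only [step, PMF.support_pure, Set.mem_singleton_iff] at hs'
    subst hs'
    refine .halt ?_
    simp only [hP, outputValue, Store.write_apply, Term.eval, Term.eval_var]
    norm_num
    exact h5
  refine htot.mono ?_
  rw [← ENNReal.ofReal_natCast]
  refine ENNReal.ofReal_le_ofReal ?_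
  have hn1 : (1 : ℝ) ≤ n := by exact_mod_cast hn
  have hTle : (T : ℝ) ≤ K4 * (n + 1) / ε ^ d := Nat.floor_le (by positivity)
  -- Both `n ≤ n / ε ^ d` and `n + 1 ≤ 2 * n` are used to express every term as a multiple of `w`.
  set w := (n : ℝ) / ε ^ d with hw
  have hw1 : (n : ℝ) ≤ w := by
    rw [hw, le_div_iff₀ hεd]
    nlinarith
  have hw2 : K4 * ((n : ℝ) + 1) / ε ^ d ≤ 2 * K4 * w := by
    rw [hw, mul_div_assoc', div_le_div_iff_of_pos_right hεd]
    nlinarith [Nat.cast_nonneg (α := ℝ) K4]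
  have hm : ∀ K : ℕ, (K : ℝ) * (n + 1) ≤ 2 * K * w := fun K => by
    nlinarith [Nat.cast_nonneg (α := ℝ) K]
  have hm' : (K3 : ℝ) * n ≤ K3 * w := by gcongr
  push_cast
  linarith [hm K1, hm K2]

end
end RealRAM

theorem mainTheorem10 (d : ℕ) (σ : SketchScheme) :
    ∃ (prog : RealRAM.Cmd) (C : ℝ),
      ∀ (n : ℕ) (p : Fin n → EuclideanSpace ℝ (Fin d)) (F : Set (Finset (Fin n)))
        (sk : Finset (Fin n) → Fin σ.size → ℝ) (ε : ℝ),
        1 ≤ n → Function.Injective p → IsUpperSet F → IsSketch σ F sk →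
        (connectedRadii p F).Nonempty → 0 < ε → ε < 1 →
        ∃ ropt : ℝ, IsLeast (connectedRadii p F) ropt ∧
          RealRAM.expectedTime ([prog], inputStore p ε sk) ≤ ENNReal.ofReal (C * (n / ε ^ d)) ∧
          ∀ (t : ℕ), ∀ s ∈ (RealRAM.runFor t ([prog], inputStore p ε sk)).support, s.1 = [] →
            ropt ≤ outputValue s.2 ∧ outputValue s.2 ≤ (1 + ε) * ropt := by
  obtain ⟨C, hC⟩ := RealRAM.exists_good_algorithm σ d
  refine ⟨RealRAM.algorithm σ d, C, fun n p F sk ε hn hp hF hsk hne hε hε1 => ?_⟩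
  obtain ⟨ropt, hopt⟩ := exists_isLeast_connectedRadii hF hne
  exact ⟨ropt, hopt, (hC hn hp hF hsk hε hε1 hopt).1, (hC hn hp hF hsk hε hε1 hopt).2⟩
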